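/- Let $H_0$ and $H$ be self-adjoint (possibly unbounded) operators in a complex Hilbert space. For $z\in\rho(H_0)\cap\rho(H)$ put $D(z)=(H-z)^{-1}-(H_0-z)^{-1}$, and assume that $D(z)$ is compact for all such $z$ and that $\lim_{y\to+\infty}y\,\|D(\lambda+iy)\|=0$ for every $\lambda\in\mathbb R$. For such $z$ define the unitary operator $$M(z)=\bigl(I+(z-\bar z)(H-z)^{-1}\bigr)\bigl(I+(\bar z-z)(H_0-\bar z)^{-1}\bigr);$$ then $M(z)-I$ is compact. *The function $\mu$.* Let $\widetilde X$ be the set of functions $f:\mathbb T\setminus\{1\}\to\mathbb Z$ such that $(0,2\pi)\ni\theta\mapsto f(e^{i\theta})$ is left continuous and non-increasing, with the metric $\widetilde\rho(f,g)=\sup_{n\in\mathbb Z}|\nu(n;f)-\nu(n;g)|$, where $\nu(n;f)=\sup(\{0\}\cup\{\theta\in(0,2\pi): f(e^{i\theta})>n\})$. Let $\pi:\widetilde X\to X$ be the quotient by the relation "$f-g$ is an integer constant", with the quotient metric $\rho(F,G)=\inf\{\widetilde\rho(f,g):\pi(f)=F,\ \pi(g)=G\}$; $\pi$ is a covering. For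 a unitary $W$ with $W-I$ compact and $\theta_1,\theta_2\in(0,2\pi)$ let $N(e^{i\theta_1},e^{i\theta_2};W)$ be $\operatorname{rank}E_W([e^{i\theta_1},e^{i\theta_2}))$ if $\theta_1<\theta_2$, $0$ if $\theta_1=\theta_2$, and $-\operatorname{rank}E_W([e^{i\theta_2},e^{i\theta_1}))$ if $\theta_2<\theta_1$, where $E_W$ is the spectral measure of $W$ and $[e^{i\alpha},e^{i\beta})=\{e^{i\theta}:\alpha\le\theta<\beta\}$. Put $\eta(W)=\pi(N(\cdot,z_0;W))\in X$ for any $z_0\in\mathbb T\setminus(\{1\}\cup\sigma(W))$; this does not depend on $z_0$. If $\lambda\in\mathbb R$ is such that $\lim_{y\to0+}\eta(M(\lambda+iy))$ exists in $X$, then the path $(0,1)\ni t\mapsto\eta\bigl(M(\lambda+i(1-t)t^{-1})\bigr)$ extends continuously to $[0,1]$; let $\widetilde\gamma:[0,1]\to\widetilde X$ be a continuous lift of the extended path and define $$\mu(\theta;\lambda)=\widetilde\gamma(1)(e^{i\theta})-\widetilde\gamma(0)(e^{i\theta}),\qquad\theta\in(0,2\pi),$$ which does not depend on the choice of the lift.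 *Counting functions.* For a self-adjoint operator $A$ with spectral measure $E_A$ and $\lambda_1,\lambda_2\in\mathbb R$ let $N(\lambda_1,\lambda_2;A)$ be $\operatorname{rank}E_A([\lambda_1,\lambda_2))$ if $\lambda_1<\lambda_2$, $0$ if $\lambda_1=\lambda_2$, and $-\operatorname{rank}E_A([\lambda_2,\lambda_1))$ if $\lambda_2<\lambda_1$. **Theorem.** Let $\lambda_1,\lambda_2\in\rho(H)\cap\rho(H_0)$ be real numbers such that the closed interval with endpoints $\lambda_1,\lambda_2$ does not meet the essential spectrum $\sigma_{\rm ess}(H_0)$ (which equals $\sigma_{\rm ess}(H)$). Then the limits $\lim_{y\to0+}\eta(M(\lambda_j+iy))$, $j=1,2$, exist, the ranks in $N(\lambda_1,\lambda_2;H)$ and $N(\lambda_1,\lambda_2;H_0)$ are finite, and for all $\theta\in(0,2\pi)$ $$\mu(\theta;\lambda_2)-\mu(\theta;\lambda_1)=N(\lambda_1,\lambda_2;H)-N(\lambda_1,\lambda_2;H_0).$$ -/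

import Mathlib

open Set Filter Topology MeasureTheory

noncomputable section

namespace SpectralFlow

/-! ### Self-adjoint operators: resolvent, spectrum, spectral subspaces -/

section SelfAdjoint

variable {E : Type*} [NormedAddCommGroup E] [InnerProductSpace ℂ E]

/-- `R` is a bounded everywhere defined two-sided inverse of `A - z`. -/
def IsResolventAt (A : E →ₗ.[ℂ] E) (z : ℂ) (R : E →L[ℂ] E) : Prop :=
  (∀ y : E, ∃ h : R y ∈ A.domain, A ⟨R y, h⟩ - z • R y = y) ∧
    ∀ x : A.domain, R (A x - z • (x : E)) = x

/-- The resolvent set `ρ(A)`. -/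
def rho (A : E →ₗ.[ℂ] E) : Set ℂ := {z | ∃ R, IsResolventAt A z R}

/-- The resolvent `(A - z)⁻¹` for `z ∈ ρ(A)` (and `0` for other `z`). -/
def res (A : E →ₗ.[ℂ] E) (z : ℂ) : E →L[ℂ] E :=
  open Classical in if h : ∃ R, IsResolventAt A z R then h.choose else 0

/-- The spectrum `σ(A)`. -/
def sigma (A : E →ₗ.[ℂ] E) : Set ℂ := (rho A)ᶜ

/-- The eigenspace `Ker (A - z)`. -/
def eigenspace (A : E →ₗ.[ℂ] E) (z : ℂ) : Submodule ℂ A.domain :=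
  LinearMap.ker (A.toFun - z • A.domain.subtype)

/-- The essential spectrum of a self-adjoint operator: the accumulation points of the spectrum
together with the eigenvalues of infinite multiplicity. -/
def sigmaEss (A : E →ₗ.[ℂ] E) : Set ℝ :=
  {l | AccPt (l : ℂ) (𝓟 (sigma A)) ∨ ¬ FiniteDimensional ℂ (eigenspace A l)}

/-- `m` is the scalar spectral measure `⟨x, E_A(·) x⟩` of the self-adjoint operator `A`: the
unique finite measure on `ℝ` whose Stieltjes transform is `z ↦ ⟨x, (A - z)⁻¹ x⟩`. -/
def IsScalarSpectralMeasure (A : E →ₗ.[ℂ] E) (x : E) (m : Measure ℝ) : Prop :=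
  IsFiniteMeasure m ∧
    ∀ z : ℂ, z.im ≠ 0 → inner ℂ x (res A z x) = ∫ t : ℝ, ((t : ℂ) - z)⁻¹ ∂m

/-- The range of the spectral projection `E_A(D)` of a self-adjoint operator `A`. It consists of
the vectors `x` whose scalar spectral measure is carried by `D` (such vectors form a subspace, so
taking the span adds nothing). -/
def ranE (A : E →ₗ.[ℂ] E) (D : Set ℝ) : Submodule ℂ E :=
  Submodule.span ℂ {x | ∃ m : Measure ℝ, IsScalarSpectralMeasure A x m ∧ m Dᶜ = 0}

/-- `N(l₁, l₂; A)`: the signed rank of the spectral projection of the half-open interval. -/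
def counting (A : E →ₗ.[ℂ] E) (l₁ l₂ : ℝ) : ℤ :=
  if l₁ < l₂ then (Module.finrank ℂ (ranE A (Ico l₁ l₂)) : ℤ)
  else if l₂ < l₁ then -(Module.finrank ℂ (ranE A (Ico l₂ l₁)) : ℤ)
  else 0

end SelfAdjoint

/-! ### The covering `XTilde → XInf` -/

/-- The interval `(0, 2π)`, which parametrizes the punctured circle by `t ↦ exp (i t)`. -/
abbrev Angle : Type := Ioo (0 : ℝ) (2 * Real.pi)

/-- Integer valued functions `f` on the punctured circle such that `t ↦ f (exp (i t))` is
non-increasing and left continuous on `(0, 2π)`. -/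
structure XTilde where
  toFun : Angle → ℤ
  antitone : Antitone toFun
  leftCont : ∀ t, ContinuousWithinAt toFun (Iic t) t

namespace XTilde

/-- `ν(n; f) = sup ({0} ∪ {t ∈ (0, 2π) : f (exp (i t)) > n})`. -/
def nu (f : XTilde) (n : ℤ) : ℝ :=
  sSup ({0} ∪ {t : ℝ | ∃ h : t ∈ Ioo (0 : ℝ) (2 * Real.pi), n < f.toFun ⟨t, h⟩})

/-- The translate `f + n`. -/
def shift (f : XTilde) (n : ℤ) : XTilde where
  toFun t := f.toFun t + n
  antitone _ _ h := by
    have := f.antitone h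
    simpa using this
  leftCont t := (f.leftCont t).add continuousWithinAt_const

lemma bddAbove_nuSet (f : XTilde) (n : ℤ) : BddAbove ({0} ∪
    {t : ℝ | ∃ h : t ∈ Ioo (0 : ℝ) (2 * Real.pi), n < f.toFun ⟨t, h⟩}) := by
  refine ⟨2 * Real.pi, ?_⟩
  rintro x (hx | ⟨h, -⟩)
  · rw [mem_singleton_iff.1 hx]; positivity
  · exact h.2.le

lemma nu_nonneg (f : XTilde) (n : ℤ) : 0 ≤ f.nu n :=
  le_csSup (f.bddAbove_nuSet n) (Or.inl rfl)

lemma nu_le (f : XTilde) (n : ℤ) : f.nu n ≤ 2 * Real.pi := by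
  refine csSup_le ⟨0, Or.inl rfl⟩ ?_
  rintro x (hx | ⟨h, -⟩)
  · rw [mem_singleton_iff.1 hx]; positivity
  · exact h.2.le

lemma nu_shift (f : XTilde) (m n : ℤ) : (f.shift m).nu n = f.nu (n - m) := by
  have h : ∀ a : ℤ, n < a + m ↔ n - m < a := fun a => by omega
  simp only [nu, shift, h]

lemma bddAbove_range (f g : XTilde) : BddAbove (range fun n : ℤ => |f.nu n - g.nu n|) := by
  refine ⟨2 * Real.pi, ?_⟩
  rintro _ ⟨n, rfl⟩
  have h1 := f.nu_nonneg n
  have h2 := f.nu_le n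
  have h3 := g.nu_nonneg n
  have h4 := g.nu_le n
  exact abs_le.2 ⟨by linarith, by linarith⟩

/-- The distance of `f` and `g` is the `ℓ^∞(ℤ)` norm of `ν(·; f) - ν(·; g)`. -/
instance : PseudoMetricSpace XTilde where
  dist f g := ⨆ n : ℤ, |f.nu n - g.nu n|
  dist_self f := by simp
  dist_comm f g := by simp only [abs_sub_comm]
  dist_triangle f g h := by
    refine ciSup_le fun n => (abs_sub_le _ (g.nu n) _).trans ?_
    exact add_le_add (le_ciSup (bddAbove_range f g) n) (le_ciSup (bddAbove_range g h) n)

lemma dist_def (f g : XTilde) : dist f g = ⨆ n : ℤ, |f.nu n - g.nu n| := rfl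

lemma dist_shift (f g : XTilde) (m : ℤ) : dist (f.shift m) (g.shift m) = dist f g := by
  simp only [dist_def, nu_shift]
  exact (Equiv.subRight m).iSup_comp (g := fun n => |f.nu n - g.nu n|)

@[ext] lemma ext' {f g : XTilde} (h : ∀ t, f.toFun t = g.toFun t) : f = g := by
  cases f; cases g; congr; exact funext h

/-- `f ∼ g` if `f` and `g` differ by an integer constant. -/
instance setoid : Setoid XTilde where
  r f g := ∃ n : ℤ, ∀ t, f.toFun t = g.toFun t + n
  iseqv :=
    { refl := fun _ => ⟨0, by simp⟩
      symm := fun ⟨n, h⟩ => ⟨-n, fun t => by have := h t; omega⟩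
      trans := fun ⟨n, h⟩ ⟨m, k⟩ =>
        ⟨n + m, fun t => by have := h t; have := k t; omega⟩ }

end XTilde

/-- The quotient of `XTilde` by integer constants. -/
def XInf : Type := Quotient XTilde.setoid

namespace XInf

/-- The projection `π : XTilde → XInf`. -/
def proj (f : XTilde) : XInf := Quotient.mk XTilde.setoid f

instance : Nonempty XInf :=
  ⟨proj ⟨fun _ => 0, antitone_const, fun _ => continuousWithinAt_const⟩⟩

/-- The distances between representatives of two classes. -/
def distSet (F G : XInf) : Set ℝ := {r | ∃ f g, proj f = F ∧ proj g = G ∧ dist f g = r}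

lemma distSet_nonempty (F G : XInf) : (distSet F G).Nonempty := by
  obtain ⟨f, rfl⟩ := Quotient.exists_rep F
  obtain ⟨g, rfl⟩ := Quotient.exists_rep G
  exact ⟨_, f, g, rfl, rfl, rfl⟩

lemma distSet_bddBelow (F G : XInf) : BddBelow (distSet F G) := by
  refine ⟨0, ?_⟩
  rintro _ ⟨f, g, -, -, rfl⟩
  exact dist_nonneg

lemma proj_shift (f : XTilde) (n : ℤ) : proj (f.shift n) = proj f :=
  Quotient.sound ⟨n, fun _ => rfl⟩

/-- The distance of two classes is the infimum of the distances of their representatives. -/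
instance : PseudoMetricSpace XInf where
  dist F G := sInf (distSet F G)
  dist_self F := by
    obtain ⟨f, rfl⟩ := Quotient.exists_rep F
    refine le_antisymm (csInf_le (distSet_bddBelow _ _) ⟨f, f, rfl, rfl, dist_self f⟩) ?_
    refine le_csInf (distSet_nonempty _ _) ?_
    rintro _ ⟨f, g, -, -, rfl⟩
    exact dist_nonneg
  dist_comm F G := by
    congr 1
    ext r
    constructor
    · rintro ⟨f, g, hf, hg, rfl⟩; exact ⟨g, f, hg, hf, dist_comm g f⟩
    · rintro ⟨f, g, hf, hg, rfl⟩; exact ⟨g, f, hg, hf, dist_comm g f⟩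
  dist_triangle F G K := by
    refine le_of_forall_pos_le_add fun e he => ?_
    obtain ⟨_, ⟨f, g, hf, hg, rfl⟩, h1⟩ :=
      Real.lt_sInf_add_pos (distSet_nonempty F G) (half_pos he)
    obtain ⟨_, ⟨g', k, hg', hk, rfl⟩, h2⟩ :=
      Real.lt_sInf_add_pos (distSet_nonempty G K) (half_pos he)
    obtain ⟨n, hn⟩ : ∃ n : ℤ, ∀ t, g.toFun t = g'.toFun t + n :=
      Quotient.exact (hg.trans hg'.symm)
    have hgg : g = g'.shift n := XTilde.ext' hn
    have h3 : dist f (k.shift n) ≤ dist f g + dist g' k := by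
      refine (dist_triangle f g _).trans ?_
      rw [hgg, XTilde.dist_shift]
    have h4 : sInf (distSet F K) ≤ dist f (k.shift n) :=
      csInf_le (distSet_bddBelow _ _) ⟨f, k.shift n, hf, (proj_shift k n).trans hk, rfl⟩
    linarith

end XInf

/-! ### Spectra of unitary operators and the spectral flow -/

section Unitary

variable {E : Type*} [NormedAddCommGroup E] [InnerProductSpace ℂ E]

/-- `m` is the scalar spectral measure `⟨x, E_W(·) x⟩` of the unitary operator `W`: the unique
finite measure on the unit circle with moments `⟨x, Wⁿ x⟩` (for unitary `W`, the moments with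
`n < 0` are the complex conjugates of those with `n > 0`). -/
def IsScalarSpectralMeasureU (W : E →L[ℂ] E) (x : E) (m : Measure ℂ) : Prop :=
  IsFiniteMeasure m ∧ m (Metric.sphere (0 : ℂ) 1)ᶜ = 0 ∧
    ∀ n : ℕ, inner ℂ x ((W ^ n) x) = ∫ z : ℂ, z ^ n ∂m

/-- The range of the spectral projection `E_W(D)` of a unitary operator `W`: the vectors whose
scalar spectral measure is carried by `D`. -/
def ranEU (W : E →L[ℂ] E) (D : Set ℂ) : Submodule ℂ E :=
  Submodule.span ℂ {x | ∃ m : Measure ℂ, IsScalarSpectralMeasureU W x m ∧ m Dᶜ = 0}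

/-- The arc `[exp (i a), exp (i b))`. -/
def arc (a b : ℝ) : Set ℂ := (fun t : ℝ => Complex.exp (t * Complex.I)) '' Ico a b

/-- `N(exp (i a), exp (i b); W)`: the signed rank of the spectral projection of the arc. -/
def countingU (W : E →L[ℂ] E) (a b : ℝ) : ℤ :=
  if a < b then (Module.finrank ℂ (ranEU W (arc a b)) : ℤ)
  else if b < a then -(Module.finrank ℂ (ranEU W (arc b a)) : ℤ)
  else 0

/-- `F` is the class of the function `N(·, exp (i a); W)` for some `a ∈ (0, 2π)` such that
`exp (i a)` is not in the spectrum of `W`. -/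
def IsEta (W : E →L[ℂ] E) (F : XInf) : Prop :=
  ∃ a : Angle, Complex.exp ((a : ℝ) * Complex.I) ∉ spectrum ℂ W ∧
    ∃ f : XTilde, (∀ t : Angle, f.toFun t = countingU W t a) ∧ XInf.proj f = F

/-- The map `η` from the unitary operators `W` with `W - 1` compact to `XInf`. For such `W` there
is exactly one `F` with `IsEta W F`. -/
def eta (W : E →L[ℂ] E) : XInf := Classical.epsilon (IsEta W)

/-- `G` is the extension by continuity of `g : (0, 1) → XInf` to `[0, 1]`. -/
def IsExt (g : ℝ → XInf) (G : C(unitInterval, XInf)) : Prop :=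
  ∀ t : unitInterval, (t : ℝ) ∈ Ioo (0 : ℝ) 1 → G t = g t

/-- `L` is a lift to `XTilde` of the continuous extension of `η ∘ U` to `[0, 1]`. -/
def IsLift (U : ℝ → E →L[ℂ] E) (L : C(unitInterval, XTilde)) : Prop :=
  ∃ G : C(unitInterval, XInf), IsExt (fun t => eta (U t)) G ∧ ∀ t, XInf.proj (L t) = G t

/-- The spectral flow through `exp (i t)` of a family `U` of unitary operators on `(0, 1)`, that
is `L(1) - L(0)` evaluated at `t` for a lift `L` (any two lifts give the same value). It is
meaningful when `η ∘ U` extends continuously to `[0, 1]`, and is `0` by convention otherwise. -/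
def sf (U : ℝ → E →L[ℂ] E) (t : Angle) : ℤ :=
  open Classical in
  if h : ∃ L, IsLift U L then (h.choose 1).toFun t - (h.choose 0).toFun t else 0

end Unitary

/-! ### The function `μ` -/

section Mu

variable {E : Type*} [NormedAddCommGroup E] [InnerProductSpace ℂ E]

/-- `M(z; H, H₀) = (1 + (z - z̄) (H - z)⁻¹) (1 + (z̄ - z) (H₀ - z̄)⁻¹)`. -/
def M (z : ℂ) (H H₀ : E →ₗ.[ℂ] E) : E →L[ℂ] E :=
  (1 + (z - star z) • res H z) * (1 + (star z - z) • res H₀ (star z))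

/-- The standing assumption on the pair `H`, `H₀`: the difference of the resolvents is compact,
and its norm at `l + i y` is `o(1 / y)` as `y → +∞`, for every real `l`. -/
structure ResolventComparable (H H₀ : E →ₗ.[ℂ] E) : Prop where
  compact : ∀ z ∈ rho H₀ ∩ rho H, IsCompactOperator (res H z - res H₀ z)
  decay : ∀ l : ℝ, Tendsto
    (fun y : ℝ => y * ‖res H (l + y * Complex.I) - res H₀ (l + y * Complex.I)‖) atTop (𝓝 0)

/-- The assumption at the point `l`: `η(M(l + i y; H, H₀))` has a limit as `y → 0+`. -/
def HasBoundaryLimit (l : ℝ) (H H₀ : E →ₗ.[ℂ] E) : Prop :=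
  ∃ F : XInf, Tendsto (fun y : ℝ => eta (M (l + y * Complex.I) H H₀)) (𝓝[>] 0) (𝓝 F)

/-- `μ(t; l, H, H₀)`: the spectral flow through `exp (i t)` of the family
`s ↦ M(l + i (1 - s) / s; H, H₀)`, `s ∈ (0, 1)`. -/
def mu (t : Angle) (l : ℝ) (H H₀ : E →ₗ.[ℂ] E) : ℤ :=
  sf (fun s : ℝ => M (l + ((1 - s) / s : ℝ) * Complex.I) H H₀) t

end Mu

end SpectralFlow

end

/-! Since $M(z)=U(z)U_0(z)^*$ with Cayley transforms $U,U_0$ of $H,H_0$, the flow through a point of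
the circle should be homotopy invariant. The boundary of the strip $[l_1,l_2]\times(0,y)$ would then
relate the two values of $\mu$ to the eigenvalues on the bottom edge. The obstacle is that $M$ does
not extend continuously to that edge. An eigenvalue $a\in(l_1,l_2)$ of $H$ contributes to $U(u+iv)$
the eigenvalue $e^{ip}$ with $p=2\arg(a-u+iv)$, which has no limit at $(u,v)=(a,0)$.

The remedy is to make these angles independent parameters. On the complement of the finitely many
eigenvectors the resolvent stays bounded up to the real axis (`UpperSystem.norm_res_le_bound`), so
`UpperSystem.op` is jointly continuous in $(u,v,p)$, also at $v=0$ (`UpperSystem.continuous_op`).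
The products of `op` for $H$ and the adjoint of `op` for $H_0$ form a continuous family of unitary
operators over a real vector space. As `eta` is norm continuous (`UK.continuous_eta`) and
`XInf.proj` is a covering, this family has a global lift $\Lambda$ (`exists_flow_lift`).

All values are read at the point $-1$. The vertical edges give $\mu(\cdot;l_j)$
(`mu_eventually_eq`). On a high horizontal edge $\|M-1\|<2$, so $-1$ is never in the spectrum and
the value of $\Lambda$ does not change (`toFun_mid_eq_of_norm_lt`). At $v=0$ the operators are pure
rotations of the eigenvectors: turning the angles of $H$ from $0$ to $2\pi$ adds their number,
turning those of $H_0$ subtracts theirs (`UK.proj_step_eq_eta`), and moving $u$ does nothing. Adding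
up gives `mu_sub_mu`.

The spectral input goes through the bounded operator $(A-l_1)^{-1}$, whose spectrum above
$(l_2-l_1)^{-1}$ corresponds to $\sigma(A)\cap(l_1,l_2]$. Finiteness for $H_0$ comes from the
essential spectrum and passes to $H$ by compactness (`exists_upperSystems`). The vectors found in
this way span the range of the spectral projection (`UpperSystem.ranE_eq_span`). -/

namespace SpectralFlow

/-! ### Level functions and the metric on `XTilde` -/

namespace XTilde

lemma lt_toFun_iff (f : XTilde) (n : ℤ) (t : Angle) : n < f.toFun t ↔ (t : ℝ) ≤ f.nu n := by
  constructor
  · intro h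
    exact le_csSup (f.bddAbove_nuSet n) (Or.inr ⟨t.2, h⟩)
  · intro h
    -- Points strictly below the supremum lie in the superlevel set by monotonicity; left continuity
    -- then adds `t` itself, so the supremum is attained whenever it lies in the interval.
    have hev : ∀ s : Angle, s < t → n < f.toFun s := by
      intro s hs
      obtain ⟨x, hx, hsx⟩ := exists_lt_of_lt_csSup (Set.singleton_nonempty (0 : ℝ)).inl
        (show (s : ℝ) < sSup _ from lt_of_lt_of_le (b := (t : ℝ)) hs h)
      rcases hx with hx | ⟨hx, hn⟩
      · rw [mem_singleton_iff.1 hx] at hsx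
        exact absurd hsx (not_lt.2 s.2.1.le)
      · exact hn.trans_le (f.antitone (show s ≤ ⟨x, hx⟩ from hsx.le))
    have h1 : ∀ᶠ s in 𝓝[Iic t] t, f.toFun s = f.toFun t :=
      (f.leftCont t).eventually (eventually_of_mem ((isOpen_discrete {f.toFun t}).mem_nhds rfl)
        fun _ h => h)
    obtain ⟨u, hu, hu'⟩ := mem_nhdsWithin.1 h1
    obtain ⟨hto, hut⟩ := hu'
    obtain ⟨e, he, hball⟩ := Metric.isOpen_iff.1 hu t hto
    have ht0 := t.2.1
    have ht1 := t.2.2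
    set s : ℝ := t - min e t / 2 with hs
    have hm : 0 < min e (t : ℝ) := lt_min he ht0
    have hm1 := min_le_left e (t : ℝ)
    have hm2 := min_le_right e (t : ℝ)
    have hsI : s ∈ Ioo (0 : ℝ) (2 * Real.pi) := ⟨by linarith, by linarith⟩
    have hst : (⟨s, hsI⟩ : Angle) < t := show s < t by linarith
    have hsb : (⟨s, hsI⟩ : Angle) ∈ Metric.ball t e := by
      rw [Metric.mem_ball, Subtype.dist_eq, Real.dist_eq, abs_lt]
      constructor <;> simp only <;> linarith
    have := hut ⟨hball hsb, hst.le⟩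
    rw [← show f.toFun ⟨s, hsI⟩ = f.toFun t from this]
    exact hev _ hst

lemma le_dist (f g : XTilde) (n : ℤ) : |f.nu n - g.nu n| ≤ dist f g :=
  le_ciSup (bddAbove_range f g) n

lemma dist_le_of_nu {f g : XTilde} {r : ℝ} (h : ∀ n, |f.nu n - g.nu n| ≤ r) : dist f g ≤ r :=
  ciSup_le h

lemma toFun_le_iff (f : XTilde) (n : ℤ) (t : Angle) : f.toFun t ≤ n ↔ f.nu n < t := by
  rw [← not_lt, lt_toFun_iff, not_le]

lemma eq_of_nu_eq {f g : XTilde} (h : ∀ n, f.nu n = g.nu n) : f = g := by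
  ext t
  refine eq_of_forall_lt_iff fun n => ?_
  rw [lt_toFun_iff, lt_toFun_iff, h]

lemma eq_of_dist_eq_zero {f g : XTilde} (h : dist f g = 0) : f = g :=
  eq_of_nu_eq fun n => by
    have := le_dist f g n
    rw [h] at this
    exact sub_eq_zero.1 (abs_nonpos_iff.1 this)

/-- The numbers `nu n` determine the function, so the pseudometric separates points. Uniqueness of
limits in `XTilde` is what identifies the endpoint of a lift later on. -/
instance : T2Space XTilde :=
  letI : MetricSpace XTilde := { eq_of_dist_eq_zero := eq_of_dist_eq_zero }
  inferInstance

lemma nu_antitone (f : XTilde) : Antitone f.nu := by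
  intro n m hnm
  refine csSup_le_csSup (f.bddAbove_nuSet n) ⟨0, Or.inl rfl⟩ ?_
  rintro x (hx | ⟨hx, h⟩)
  · exact Or.inl hx
  · exact Or.inr ⟨hx, hnm.trans_lt h⟩

/-- The value at `t` is locally constant near a function which is constant around `t`. -/
lemma toFun_eq_of_dist_lt {f g : XTilde} {s t u : Angle} {d : ℝ} (hd : dist f g < d)
    (hs : (s : ℝ) ≤ t - d) (hu : t + d ≤ (u : ℝ)) (h : g.toFun s = g.toFun u) :
    f.toFun t = g.toFun t := by
  have hd0 : 0 < d := dist_nonneg.trans_lt hd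
  have hst : s ≤ t := show (s : ℝ) ≤ t by linarith
  have htu : t ≤ u := show (t : ℝ) ≤ u by linarith
  have h1 : g.toFun t = g.toFun s := le_antisymm (g.antitone hst) (h ▸ g.antitone htu)
  have h2 : g.toFun t = g.toFun u := h1.trans h
  apply le_antisymm
  · rw [toFun_le_iff]
    have := (g.toFun_le_iff (g.toFun t) s).1 h1.ge
    have h3 := (abs_le.1 (le_dist f g (g.toFun t))).2
    linarith
  · rw [← Int.sub_one_lt_iff, lt_toFun_iff]
    have := (g.lt_toFun_iff (g.toFun t - 1) u).1 (by omega)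
    have h3 := (abs_le.1 (le_dist f g (g.toFun t - 1))).1
    linarith

/-- The constant function with value `n`. -/
def const (n : ℤ) : XTilde := ⟨fun _ => n, antitone_const, fun _ => continuousWithinAt_const⟩

lemma const_shift (m n : ℤ) : (const m).shift n = const (m + n) := rfl

/-- The midpoint `π` of `(0, 2π)`. -/
noncomputable def mid : Angle := ⟨Real.pi, Real.pi_pos, by linarith [Real.pi_pos]⟩

lemma toFun_mid_of_dist_const {f : XTilde} {n : ℤ} (h : dist f (const n) < 1) :
    f.toFun mid = n := by
  have hpi := Real.pi_gt_three
  have hI : (1 : ℝ) ∈ Ioo (0 : ℝ) (2 * Real.pi) := ⟨one_pos, by linarith⟩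
  have hJ : (Real.pi + 1 : ℝ) ∈ Ioo (0 : ℝ) (2 * Real.pi) := ⟨by linarith, by linarith⟩
  exact toFun_eq_of_dist_lt (g := const n) (s := ⟨1, hI⟩) (u := ⟨_, hJ⟩) h
    (by simp only [mid]; linarith) (by simp [mid]) rfl

noncomputable instance : AddAction ℤ XTilde where
  vadd n f := f.shift n
  zero_vadd f := XTilde.ext' fun t => add_zero _
  add_vadd m n f := XTilde.ext' fun t => by
    change f.toFun t + (m + n) = f.toFun t + n + m
    ring

lemma vadd_def (n : ℤ) (f : XTilde) : n +ᵥ f = f.shift n := rfl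

/-- Translating by `n` shifts the index of `nu` by `n`. As `nu` is decreasing, a nonzero shift moves
some level at least across the gap between two consecutive ones. -/
lemma dist_shift_self (f : XTilde) {n : ℤ} (hn : n ≠ 0) (k : ℤ) :
    f.nu (k - 1) - f.nu k ≤ dist f (f.shift n) := by
  rcases lt_or_gt_of_ne hn with h | h
  · have h1 := le_dist f (f.shift n) (k - 1)
    rw [nu_shift] at h1
    have h2 := f.nu_antitone (show k ≤ k - 1 - n by omega)
    have h3 := (abs_le.1 h1).2
    linarith
  · have h1 := le_dist f (f.shift n) k
    rw [nu_shift] at h1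
    have h2 := f.nu_antitone (show k - n ≤ k - 1 by omega)
    have h3 := (abs_le.1 h1).1
    linarith

/-- Distinct translates of `f` keep a positive distance. -/
lemma exists_le_dist_shift (f : XTilde) : ∃ d > 0, ∀ n : ℤ, n ≠ 0 → d ≤ dist f (f.shift n) := by
  by_contra! H
  have hconst : ∀ k, f.nu (k - 1) = f.nu k := by
    intro k
    refine le_antisymm (le_of_forall_pos_lt_add fun e he => ?_) (f.nu_antitone (by omega))
    obtain ⟨n, hn, hlt⟩ := H e he
    have := f.dist_shift_self hn k
    linarith
  have hall : ∀ k, f.nu k = f.nu 0 := by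
    intro k
    induction k using Int.induction_on with
    | zero => rfl
    | succ i ih => rw [← hconst, ← ih]; congr 1; ring
    | pred i ih => rw [hconst, ih]
  -- The level sequence cannot be constant: it passes from at least $\pi$ to below $\pi$ at the
  -- index $f(\pi)$.
  have h1 := (f.lt_toFun_iff (f.toFun mid - 1) mid).1 (by omega)
  have h2 := (f.toFun_le_iff (f.toFun mid) mid).1 le_rfl
  rw [hall] at h1 h2
  linarith

end XTilde

/-! ### The covering `XTilde → XInf` -/

namespace XInf

open XTilde

lemma proj_eq_iff {f g : XTilde} : proj f = proj g ↔ ∃ n : ℤ, f = g.shift n :=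
  ⟨fun h => (Quotient.exact h).imp fun _ hn => XTilde.ext' hn,
    fun ⟨n, hn⟩ => by rw [hn, proj_shift]⟩

lemma dist_proj_le (f g : XTilde) : dist (proj f) (proj g) ≤ dist f g :=
  csInf_le (distSet_bddBelow _ _) ⟨f, g, rfl, rfl, rfl⟩

lemma exists_shift_of_dist_lt {f g : XTilde} {r : ℝ} (h : dist (proj f) (proj g) < r) :
    ∃ n : ℤ, dist f (g.shift n) < r := by
  obtain ⟨_, ⟨f', g', hf, hg, rfl⟩, hlt⟩ := exists_lt_of_csInf_lt (distSet_nonempty _ _) h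
  obtain ⟨m, rfl⟩ := proj_eq_iff.1 hf
  obtain ⟨k, rfl⟩ := proj_eq_iff.1 hg
  refine ⟨k - m, ?_⟩
  have heq : (g.shift (k - m)).shift m = g.shift k := by
    ext t
    simp only [shift]
    ring
  rwa [← dist_shift _ _ m, heq]

lemma continuous_proj : Continuous proj :=
  (LipschitzWith.of_dist_le_mul (K := 1) fun f g => by
    simpa using dist_proj_le f g).continuous

lemma isOpenMap_proj : IsOpenMap proj := by
  intro U hU
  rw [Metric.isOpen_iff]
  rintro _ ⟨f, hf, rfl⟩
  obtain ⟨e, he, hball⟩ := Metric.isOpen_iff.1 hU f hf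
  refine ⟨e, he, fun G hG => ?_⟩
  obtain ⟨g, rfl⟩ := Quotient.exists_rep G
  change dist (proj g) (proj f) < e at hG
  rw [dist_comm] at hG
  obtain ⟨n, hn⟩ := exists_shift_of_dist_lt hG
  exact ⟨g.shift n, hball (by rwa [Metric.mem_ball, dist_comm]), proj_shift g n⟩

lemma surjective_proj : Function.Surjective proj := Quotient.exists_rep

/-- The integers act by isometries, and the translates of a point are uniformly separated from it. A
ball of half that separation is therefore disjoint from its nontrivial translates. -/
lemma isAddQuotientCoveringMap_proj : IsAddQuotientCoveringMap proj ℤ where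
  toIsQuotientMap := isOpenMap_proj.isQuotientMap continuous_proj surjective_proj
  continuous_const_vadd n := (Isometry.of_dist_eq fun f g => dist_shift f g n).continuous
  apply_eq_iff_mem_orbit {f g} := by
    rw [proj_eq_iff, AddAction.mem_orbit_iff]
    exact exists_congr fun n => eq_comm
  disjoint f := by
    obtain ⟨d, hd, h⟩ := f.exists_le_dist_shift
    refine ⟨Metric.ball f (d / 2), Metric.ball_mem_nhds f (half_pos hd), ?_⟩
    rintro n ⟨_, ⟨g, hg, rfl⟩, hg'⟩
    by_contra hn
    have h1 := h n hn
    simp only [vadd_def, Metric.mem_ball] at hg hg'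
    have h2 := dist_triangle f (g.shift n) (f.shift n)
    rw [dist_shift, dist_comm f (g.shift n)] at h2
    linarith

lemma isCoveringMap_proj : IsCoveringMap proj := isAddQuotientCoveringMap_proj.isCoveringMap

/-- The quotient distance is an infimum, so distance zero only provides constants arbitrarily close
to `f`. Closeness below `1` already forces such a constant to be the value of `f` at $\pi$, hence it
is always the same one. -/
lemma eq_const_of_dist_proj_const {f : XTilde} {k : ℤ} (h : dist (proj f) (proj (const k)) = 0) :
    f = const (f.toFun mid) := by
  refine eq_of_dist_eq_zero (le_antisymm (le_of_forall_pos_le_add fun e he => ?_) dist_nonneg)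
  obtain ⟨n, hn⟩ := exists_shift_of_dist_lt (h.trans_lt (lt_min he one_pos))
  rw [const_shift] at hn
  rw [toFun_mid_of_dist_const (hn.trans_le (min_le_right _ _)), zero_add]
  exact (hn.trans_le (min_le_left _ _)).le

/-- Two lifts of the same map on a preconnected set differ by a constant. -/
lemma exists_shift_eqOn {A : Type*} [TopologicalSpace A] {s : Set A} (hs : IsPreconnected s)
    {L L' : A → XTilde} (hL : ContinuousOn L s) (hL' : ContinuousOn L' s)
    (h : ∀ a ∈ s, proj (L a) = proj (L' a)) : ∃ n : ℤ, ∀ a ∈ s, L a = (L' a).shift n := by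
  rcases s.eq_empty_or_nonempty with rfl | ⟨a₀, ha₀⟩
  · exact ⟨0, by simp⟩
  obtain ⟨n, hn⟩ := proj_eq_iff.1 (h a₀ ha₀)
  refine ⟨n, isCoveringMap_proj.eqOn_of_comp_eqOn hs hL (g₂ := fun a => (L' a).shift n) ?_ ?_ ha₀
    hn⟩
  · exact (isAddQuotientCoveringMap_proj.continuous_const_vadd n).comp_continuousOn hL'
  · intro a ha
    simp only [Function.comp, proj_shift, h a ha]

end XInf

/-! ### Compact operators bounded below -/

section BoundedBelow

variable {E : Type*} [NormedAddCommGroup E] [NormedSpace ℂ E]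

/-- A subspace on which a compact operator is bounded below is finite dimensional. -/
lemma finiteDimensional_of_compact_bounded_below {K : E →L[ℂ] E} (hK : IsCompactOperator K)
    (F : Submodule ℂ E) (k : ℝ) (hk : 0 < k) (h : ∀ x ∈ F, k * ‖x‖ ≤ ‖K x‖) :
    FiniteDimensional ℂ F := by
  by_contra hF
  -- Riesz: an infinite dimensional space contains a bounded sequence with mutual distances at least
  -- `1`. The images stay `k`-separated, which contradicts compactness.
  obtain ⟨R, f, -, hR, hf⟩ := exists_seq_norm_le_one_le_norm_sub (𝕜 := ℂ) hF
  have hc : IsCompact (closure ((K : E → E) '' Metric.closedBall 0 R)) :=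
    hK.isCompact_closure_image_closedBall (f := (K : E →ₗ[ℂ] E)) R
  have hmem : ∀ n, K (f n) ∈ closure ((K : E → E) '' Metric.closedBall 0 R) := fun n =>
    subset_closure ⟨f n, by simpa using hR n, rfl⟩
  obtain ⟨a, -, φ, hφ, hlim⟩ := hc.tendsto_subseq hmem
  have hcau := hlim.cauchySeq
  obtain ⟨N, hN⟩ := Metric.cauchySeq_iff'.1 hcau k hk
  have h1 := hN (N + 1) (by omega)
  have hne : φ (N + 1) ≠ φ N := (hφ (by omega)).ne'
  have h2 := h (f (φ (N + 1)) - f (φ N)) (Submodule.sub_mem _ (f _).2 (f _).2)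
  have h3 := hf hne
  rw [dist_eq_norm] at h1
  simp only [Function.comp, map_sub] at h1 h2
  have h4 : (1 : ℝ) ≤ ‖(f (φ (N + 1)) : E) - f (φ N)‖ := h3
  nlinarith

end BoundedBelow

/-! ### Eigenvectors of unitary operators close to the identity modulo compacts -/

section UnitaryEigen

variable {E : Type*} [NormedAddCommGroup E] [InnerProductSpace ℂ E]

/-- The span of the eigenvectors of `W` with eigenvalue in `D`. -/
def eigSpan (W : E →L[ℂ] E) (D : Set ℂ) : Submodule ℂ E :=
  ⨆ w ∈ D, Module.End.eigenspace (W : E →ₗ[ℂ] E) w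

lemma mem_eigSpan_of_eigen {W : E →L[ℂ] E} {D : Set ℂ} {w : ℂ} (hw : w ∈ D) {x : E}
    (hx : W x = w • x) : x ∈ eigSpan W D :=
  Submodule.mem_iSup_of_mem w <| Submodule.mem_iSup_of_mem hw <|
    Module.End.mem_eigenspace_iff.2 hx

lemma eigSpan_le {W : E →L[ℂ] E} {D : Set ℂ} {F : Submodule ℂ E}
    (h : ∀ w ∈ D, ∀ x, W x = w • x → x ∈ F) : eigSpan W D ≤ F :=
  iSup₂_le fun w hw x hx => h w hw x (Module.End.mem_eigenspace_iff.1 hx)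

lemma eigSpan_union (W : E →L[ℂ] E) (D D' : Set ℂ) :
    eigSpan W (D ∪ D') = eigSpan W D ⊔ eigSpan W D' :=
  iSup_union

variable {W : E →L[ℂ] E}

lemma finite_eigenvalues (D : Set ℂ) [FiniteDimensional ℂ (eigSpan W D)] :
    {w ∈ D | ∃ x, x ≠ 0 ∧ W x = w • x}.Finite := by
  set S := {w ∈ D | ∃ x, x ≠ 0 ∧ W x = w • x}
  choose! f hf using fun (w : ℂ) (h : w ∈ S) => h.2
  have hli : LinearIndependent ℂ fun w : S => f w :=
    Module.End.eigenvectors_linearIndependent (W : E →ₗ[ℂ] E) S _ fun w =>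
      ⟨Module.End.mem_eigenspace_iff.2 (hf w w.2).2, (hf w w.2).1⟩
  let g : S → eigSpan W D := fun w => ⟨f w, mem_eigSpan_of_eigen w.2.1 (hf w w.2).2⟩
  have hg : LinearIndependent ℂ g := LinearIndependent.of_comp (eigSpan W D).subtype hli
  have := hg.finite
  exact Set.toFinite S

variable [CompleteSpace E]

lemma unitary_norm (hW : W ∈ unitary (E →L[ℂ] E)) (x : E) : ‖W x‖ = ‖x‖ := by
  have h : star W * W = 1 := (Unitary.mem_iff.1 hW).1
  have h2 : inner ℂ (W x) (W x) = inner ℂ x x := by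
    rw [← ContinuousLinearMap.adjoint_inner_left, ← ContinuousLinearMap.star_eq_adjoint,
      ← mul_apply_eq_comp, h, one_apply_eq_self]
  rw [inner_self_eq_norm_sq_to_K, inner_self_eq_norm_sq_to_K] at h2
  have h3 : ‖W x‖ ^ 2 = ‖x‖ ^ 2 := by exact_mod_cast h2
  exact (pow_left_inj₀ (norm_nonneg _) (norm_nonneg _) two_ne_zero).1 h3

lemma norm_eigenvalue (hW : W ∈ unitary (E →L[ℂ] E)) {w : ℂ} {x : E} (hx : x ≠ 0)
    (h : W x = w • x) : ‖w‖ = 1 := by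
  have h1 := unitary_norm hW x
  rw [h, norm_smul] at h1
  exact (mul_eq_right₀ (norm_ne_zero_iff.2 hx)).1 h1

lemma adjoint_eigen (hW : W ∈ unitary (E →L[ℂ] E)) {w : ℂ} {x : E} (h : W x = w • x) :
    (star W) x = (star w) • x := by
  rcases eq_or_ne x 0 with rfl | hx
  · simp
  have h1 : (star W) (W x) = x := by
    rw [← mul_apply_eq_comp, (Unitary.mem_iff.1 hW).1, one_apply_eq_self]
  have h2 : star w * w = 1 := by
    have := Complex.conj_mul' w
    rw [norm_eigenvalue hW hx h] at this
    simpa using this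
  rw [h, map_smul] at h1
  calc (star W) x = (star w * w) • (star W) x := by rw [h2, one_smul]
    _ = star w • x := by rw [mul_smul, h1]

lemma inner_eigen_eq_zero (hW : W ∈ unitary (E →L[ℂ] E)) {w v : ℂ} {x y : E}
    (h : W x = w • x) (h' : W y = v • y) (hne : w ≠ v) : inner ℂ x y = 0 := by
  have h1 : inner ℂ x (W y) = inner ℂ ((star W) x) y := by
    rw [ContinuousLinearMap.star_eq_adjoint, ContinuousLinearMap.adjoint_inner_left]
  rw [adjoint_eigen hW h, h', inner_smul_left, inner_smul_right] at h1
  have h2 : (v - w) * inner ℂ x y = 0 := by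
    rw [sub_mul, h1]; simp
  exact (mul_eq_zero.1 h2).resolve_left (sub_ne_zero.2 hne.symm)

lemma orthogonalFamily_eigenspace (hW : W ∈ unitary (E →L[ℂ] E)) :
    OrthogonalFamily ℂ (fun w => Module.End.eigenspace (W : E →ₗ[ℂ] E) w)
      fun w => (Module.End.eigenspace (W : E →ₗ[ℂ] E) w).subtypeₗᵢ := by
  intro w v hne x y
  exact inner_eigen_eq_zero hW (Module.End.mem_eigenspace_iff.1 x.2)
    (Module.End.mem_eigenspace_iff.1 y.2) hne

lemma eigSpan_orthogonal (hW : W ∈ unitary (E →L[ℂ] E)) {D D' : Set ℂ} (h : Disjoint D D') :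
    eigSpan W D ≤ (eigSpan W D')ᗮ := by
  refine eigSpan_le fun w hw x hx => ?_
  rw [Submodule.mem_orthogonal']
  intro y hy
  have : eigSpan W D' ≤ (ℂ ∙ x)ᗮ := eigSpan_le fun v hv y hy =>
    Submodule.mem_orthogonal_singleton_iff_inner_right.2
      (inner_eigen_eq_zero hW hx hy fun h' => h.ne_of_mem hw hv h')
  exact Submodule.mem_orthogonal_singleton_iff_inner_right.1 (this hy)

/-- A vector of `eigSpan W D` is a finite sum of orthogonal eigenvectors, which computes the norm
of `(W - c) x`. -/
lemma eigSpan_norm_sq (hW : W ∈ unitary (E →L[ℂ] E)) {D : Set ℂ} {x : E}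
    (hx : x ∈ eigSpan W D) : ∃ (s : Finset ℂ) (l : ℂ → ℝ), (∀ w, 0 ≤ l w) ∧
      (∀ w ∈ s, l w ≠ 0 → w ∈ D ∧ ∃ x, x ≠ 0 ∧ W x = w • x) ∧
      ∀ c : ℂ, ‖(W - c • 1) x‖ ^ 2 = ∑ w ∈ s, ‖w - c‖ ^ 2 * l w ∧ ‖x‖ ^ 2 = ∑ w ∈ s, l w := by
  classical
  rw [eigSpan, iSup_subtype'] at hx
  obtain ⟨f, hf, rfl⟩ := (Submodule.mem_iSup_iff_exists_finsupp _ _).1 hx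
  have hW' := orthogonalFamily_eigenspace hW
  let l : ∀ w : D, Module.End.eigenspace (W : E →ₗ[ℂ] E) (w : ℂ) := fun w => ⟨f w, hf w⟩
  have hl : ∀ w : D, W (f w) = (w : ℂ) • f w := fun w => Module.End.mem_eigenspace_iff.1 (hf w)
  have hD := hW'.comp (Subtype.val_injective (p := (· ∈ D)))
  refine ⟨f.support.map ⟨Subtype.val, Subtype.val_injective⟩,
    fun w => if h : w ∈ D then ‖f ⟨w, h⟩‖ ^ 2 else 0, fun w => ?_, ?_, fun c => ?_⟩
  · dsimp only
    split_ifs <;> positivity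
  · intro w hw hne
    obtain ⟨v, hv, rfl⟩ := Finset.mem_map.1 hw
    exact ⟨v.2, _, Finsupp.mem_support_iff.1 hv, hl v⟩
  · rw [Finset.sum_map, Finset.sum_map]
    constructor
    · have h1 : (W - c • 1) (f.sum fun _ x => x) = ∑ w ∈ f.support,
          (Module.End.eigenspace (W : E →ₗ[ℂ] E) (w : ℂ)).subtypeₗᵢ (((w : ℂ) - c) • l w) := by
        rw [Finsupp.sum, map_sum]
        refine Finset.sum_congr rfl fun w _ => ?_
        simp [l, hl w, sub_smul]
      rw [h1, hD.norm_sum]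
      refine Finset.sum_congr rfl fun w _ => ?_
      simp [norm_smul, l, mul_pow]
    · have h1 : (f.sum fun _ x => x) = ∑ w ∈ f.support,
          (Module.End.eigenspace (W : E →ₗ[ℂ] E) (w : ℂ)).subtypeₗᵢ (l w) := rfl
      rw [h1, hD.norm_sum]
      refine Finset.sum_congr rfl fun w _ => ?_
      simp [l]

lemma eigSpan_norm_le (hW : W ∈ unitary (E →L[ℂ] E)) {D : Set ℂ} {c : ℂ} {r : ℝ} (hr : 0 ≤ r)
    (h : ∀ w ∈ D, (∃ x, x ≠ 0 ∧ W x = w • x) → ‖w - c‖ ≤ r) {x : E} (hx : x ∈ eigSpan W D) :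
    ‖(W - c • 1) x‖ ≤ r * ‖x‖ := by
  obtain ⟨s, l, h0, hs, heq⟩ := eigSpan_norm_sq hW hx
  refine abs_le_of_sq_le_sq' ?_ (by positivity) |>.2
  rw [(heq c).1, mul_pow, (heq c).2, Finset.mul_sum]
  refine Finset.sum_le_sum fun w hw => ?_
  rcases eq_or_ne (l w) 0 with h1 | h1
  · simp [h1]
  · have := h w (hs w hw h1).1 (hs w hw h1).2
    have h2 := h0 w
    gcongr

lemma eigSpan_le_norm (hW : W ∈ unitary (E →L[ℂ] E)) {D : Set ℂ} {c : ℂ} {r : ℝ} (hr : 0 ≤ r)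
    (h : ∀ w ∈ D, (∃ x, x ≠ 0 ∧ W x = w • x) → r ≤ ‖w - c‖) {x : E} (hx : x ∈ eigSpan W D) :
    r * ‖x‖ ≤ ‖(W - c • 1) x‖ := by
  obtain ⟨s, l, h0, hs, heq⟩ := eigSpan_norm_sq hW hx
  refine abs_le_of_sq_le_sq' ?_ (by positivity) |>.2
  rw [(heq c).1, mul_pow, (heq c).2, Finset.mul_sum]
  refine Finset.sum_le_sum fun w hw => ?_
  rcases eq_or_ne (l w) 0 with h1 | h1
  · simp [h1]
  · have := h w (hs w hw h1).1 (hs w hw h1).2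
    have h2 := h0 w
    gcongr

lemma finiteDimensional_eigSpan (hW : W ∈ unitary (E →L[ℂ] E))
    (hK : IsCompactOperator (W - 1 : E →L[ℂ] E))
    {D : Set ℂ} {k : ℝ} (hk : 0 < k) (h : ∀ w ∈ D, k ≤ ‖w - 1‖) :
    FiniteDimensional ℂ (eigSpan W D) := by
  refine finiteDimensional_of_compact_bounded_below hK _ k hk fun x hx => ?_
  have := eigSpan_le_norm hW (c := 1) hk.le (fun w hw _ => h w hw) hx
  rwa [one_smul] at this

/-- A normal operator has no Jordan blocks: $y=(W-w)x$ is killed by $W-w$, hence by $W^*-\bar w$,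
and pairing the latter with $x$ gives $\langle y,y\rangle=0$. -/
lemma eigen_of_sq_zero (hW : W ∈ unitary (E →L[ℂ] E)) {w : ℂ} (hw : w * w = 1)
    (hw' : star w = w) {x : E} (h : W (W x) - (2 * w) • W x + x = 0) : W x = w • x := by
  set y := W x - w • x with hy
  have h1 : W y = w • y := by
    rw [hy, map_sub, map_smul, smul_sub, smul_smul, hw, one_smul, sub_eq_sub_iff_sub_eq_sub,
      ← sub_eq_zero]
    rw [← h, mul_smul, two_smul]
    abel
  have h2 := adjoint_eigen hW h1
  rw [hw'] at h2
  have h3 : inner ℂ y y = 0 := by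
    conv_lhs => rw [hy, inner_sub_left, inner_smul_left]
    rw [← ContinuousLinearMap.adjoint_inner_right, ← ContinuousLinearMap.star_eq_adjoint, h2,
      inner_smul_right, ← Complex.star_def, hw', sub_self]
  exact sub_eq_zero.1 (inner_self_eq_zero.1 h3)

/-- Eigenvectors of a unitary operator which is a compact perturbation of the identity span. -/
lemma eigSpan_univ_orthogonal (hW : W ∈ unitary (E →L[ℂ] E))
    (hK : IsCompactOperator (W - 1 : E →L[ℂ] E)) : (eigSpan W univ)ᗮ = ⊥ := by
  have hWs : star W * W = 1 := (Unitary.mem_iff.1 hW).1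
  -- This combination is compact and self-adjoint, so its eigenvectors span. On each of its
  -- eigenspaces $W$ satisfies a quadratic equation with roots $w,w^{-1}$.
  have hA : W + star W - 2 = star W * ((W - 1) * (W - 1)) := by
    have : star W * ((W - 1) * (W - 1)) = (star W * W) * W - 2 * (star W * W) + star W := by
      noncomm_ring
    rw [this, hWs, one_mul, mul_one]; abel
  have hAc : IsCompactOperator (W + star W - 2 : E →L[ℂ] E) := by
    rw [hA]
    exact (hK.comp_clm (W - 1)).clm_comp (star W)
  have hAs : (W + star W - 2 : E →L[ℂ] E).IsSymmetric := by
    rw [← ContinuousLinearMap.isSelfAdjoint_iff_isSymmetric, isSelfAdjoint_iff]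
    simp [add_comm]
  have key := ContinuousLinearMap.orthogonalComplement_iSup_eigenspaces_eq_bot hAc hAs
  rw [eq_bot_iff, ← key]
  refine Submodule.orthogonal_le (iSup_le fun α x hx => ?_)
  have hx1 : W x + (star W) x = (α + 2) • x := by
    have := Module.End.mem_eigenspace_iff.1 hx
    have h2 : W x + (star W) x - (2 : E →L[ℂ] E) x = α • x := this
    rw [show (2 : E →L[ℂ] E) = 1 + 1 from one_add_one_eq_two.symm] at h2
    rw [add_smul, two_smul, ← h2]
    simp
  have hx2 : W (W x) - (α + 2) • W x + x = 0 := by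
    rw [← map_smul, ← hx1, map_add]
    have : W ((star W) x) = x := by
      rw [← mul_apply_eq_comp, (Unitary.mem_iff.1 hW).2,
        one_apply_eq_self]
    rw [this]; abel
  obtain ⟨w, hw⟩ : ∃ w : ℂ, w * w - (α + 2) * w + 1 = 0 := by
    obtain ⟨s, hs⟩ := IsAlgClosed.exists_pow_nat_eq ((α + 2) ^ 2 - 4) (n := 2) (by norm_num)
    refine ⟨((α + 2) + s) / 2, ?_⟩
    linear_combination hs / 4
  have hw0 : w ≠ 0 := by rintro rfl; simp at hw
  have hsum : α + 2 = w + w⁻¹ := by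
    field_simp
    linear_combination -hw
  rw [hsum] at hx2
  -- For distinct roots the two factors of the quadratic split $x$ into eigenvectors of $W$; a
  -- double root is $\pm1$ and needs normality.
  by_cases hww : w = w⁻¹
  · have h1 : w * w = 1 := by nth_rw 2 [hww]; exact mul_inv_cancel₀ hw0
    have h2 : star w = w := by
      rcases mul_self_eq_one_iff.1 h1 with rfl | rfl <;> simp
    refine mem_eigSpan_of_eigen (mem_univ w) (eigen_of_sq_zero hW h1 h2 ?_)
    rw [← hww, ← two_mul] at hx2
    exact hx2
  · have e1 : W (W x - w⁻¹ • x) = w • (W x - w⁻¹ • x) := by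
      rw [map_sub, map_smul, smul_sub, smul_smul, mul_inv_cancel₀ hw0, one_smul, ← sub_eq_zero,
        ← hx2, add_smul]
      abel
    have e2 : W (W x - w • x) = w⁻¹ • (W x - w • x) := by
      rw [map_sub, map_smul, smul_sub, smul_smul, inv_mul_cancel₀ hw0, one_smul, ← sub_eq_zero,
        ← hx2, add_smul]
      abel
    have hx3 : x = (w - w⁻¹)⁻¹ • ((W x - w⁻¹ • x) - (W x - w • x)) := by
      rw [sub_sub_sub_cancel_left, ← sub_smul, inv_smul_smul₀ (sub_ne_zero.2 hww)]
    rw [hx3]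
    exact Submodule.smul_mem _ _ (Submodule.sub_mem _ (mem_eigSpan_of_eigen (mem_univ w) e1)
      (mem_eigSpan_of_eigen (mem_univ _) e2))

lemma eigSpan_orthogonal_inf (hW : W ∈ unitary (E →L[ℂ] E))
    (hK : IsCompactOperator (W - 1 : E →L[ℂ] E)) (D : Set ℂ) {x : E}
    (h : x ∈ (eigSpan W D)ᗮ) (h' : x ∈ (eigSpan W Dᶜ)ᗮ) : x = 0 := by
  have h1 := eigSpan_univ_orthogonal hW hK
  rw [← union_compl_self D, eigSpan_union, ← Submodule.inf_orthogonal] at h1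
  exact (Submodule.mem_bot ℂ).1 (h1 ▸ Submodule.mem_inf.2 ⟨h, h'⟩)

/-- Eigenvectors are total, and those for `D` are orthogonal to those for `Dᶜ`. So the component of
`x` orthogonal to the second family is orthogonal to both, and vanishes. -/
lemma mem_closure_eigSpan (hW : W ∈ unitary (E →L[ℂ] E))
    (hK : IsCompactOperator (W - 1 : E →L[ℂ] E)) (D : Set ℂ) {x : E}
    (h : x ∈ (eigSpan W D)ᗮ) : x ∈ closure (eigSpan W Dᶜ : Set E) := by
  set K := (eigSpan W Dᶜ).topologicalClosure with hKdef
  obtain ⟨u, hu, v, hv, rfl⟩ := K.exists_add_mem_mem_orthogonal x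
  have hKD : K ≤ (eigSpan W D)ᗮ :=
    Submodule.topologicalClosure_minimal _ (eigSpan_orthogonal hW disjoint_compl_left)
      (Submodule.isClosed_orthogonal _)
  have h1 : v ∈ (eigSpan W D)ᗮ := by
    have := Submodule.sub_mem _ h (hKD hu)
    rwa [add_sub_cancel_left] at this
  have h2 : v ∈ (eigSpan W Dᶜ)ᗮ :=
    Submodule.orthogonal_le (Submodule.le_topologicalClosure _) hv
  rw [eigSpan_orthogonal_inf hW hK D h1 h2, add_zero]
  exact hu

lemma le_norm_of_mem_orthogonal (hW : W ∈ unitary (E →L[ℂ] E))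
    (hK : IsCompactOperator (W - 1 : E →L[ℂ] E)) {D : Set ℂ} {c : ℂ} {r : ℝ} (hr : 0 ≤ r)
    (h : ∀ w ∉ D, (∃ x, x ≠ 0 ∧ W x = w • x) → r ≤ ‖w - c‖) {x : E} (hx : x ∈ (eigSpan W D)ᗮ) :
    r * ‖x‖ ≤ ‖(W - c • 1) x‖ := by
  have hcl : IsClosed {x : E | r * ‖x‖ ≤ ‖(W - c • 1) x‖} :=
    isClosed_le (by fun_prop) (by fun_prop)
  exact hcl.closure_subset_iff.2 (fun y hy => eigSpan_le_norm hW hr h hy)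
    (mem_closure_eigSpan hW hK D hx)

lemma mem_eigSpan_of_orthogonal (hW : W ∈ unitary (E →L[ℂ] E))
    (hK : IsCompactOperator (W - 1 : E →L[ℂ] E)) {D : Set ℂ} [FiniteDimensional ℂ (eigSpan W D)]
    {x : E} (hx : x ∈ (eigSpan W Dᶜ)ᗮ) : x ∈ eigSpan W D := by
  have := mem_closure_eigSpan hW hK Dᶜ hx
  rw [compl_compl] at this
  rwa [(Submodule.closed_of_finiteDimensional (eigSpan W D)).closure_eq] at this

lemma exists_eigenvector_of_mem_spectrum (hK : IsCompactOperator (W - 1 : E →L[ℂ] E)) {w : ℂ}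
    (hw : w ≠ 1) (h : w ∈ spectrum ℂ W) : ∃ x, x ≠ 0 ∧ W x = w • x := by
  have h1 : w - 1 ∈ spectrum ℂ (W - 1) := by
    rw [spectrum.mem_iff] at h ⊢
    convert h using 2
    rw [map_sub, map_one]; abel
  obtain ⟨x, hx⟩ := ((hK.hasEigenvalue_iff_mem_spectrum (sub_ne_zero.2 hw)).2
    h1).exists_hasEigenvector
  refine ⟨x, hx.2, ?_⟩
  have h2 : W x - x = (w - 1) • x := hx.apply_eq_smul
  rw [sub_smul, one_smul] at h2
  exact sub_left_inj.1 h2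

lemma mem_spectrum_of_eigenvector {w : ℂ} {x : E} (hx : x ≠ 0) (h : W x = w • x) :
    w ∈ spectrum ℂ W := by
  rw [ContinuousLinearMap.spectrum_eq]
  exact (Module.End.hasEigenvalue_of_hasEigenvector
    (x := x) ⟨Module.End.mem_eigenspace_iff.2 h, hx⟩).mem_spectrum

end UnitaryEigen

/-! ### Spectral subspaces of unitary operators -/

section RanEU

variable {E : Type*} [NormedAddCommGroup E] [InnerProductSpace ℂ E]

lemma isScalarSpectralMeasureU_eigenvector {W : E →L[ℂ] E} {w : ℂ} (hw : ‖w‖ = 1) {x : E}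
    (hx : W x = w • x) :
    IsScalarSpectralMeasureU W x (ENNReal.ofReal (‖x‖ ^ 2) • Measure.dirac w) := by
  have hpow : ∀ n : ℕ, (W ^ n) x = w ^ n • x := by
    intro n
    induction n with
    | zero => simp
    | succ n ih => rw [pow_succ, mul_apply_eq_comp, hx, map_smul, ih, smul_smul, pow_succ, mul_comm]
  refine ⟨⟨by simp⟩, by simp [Measure.dirac_apply, hw], fun n => ?_⟩
  rw [hpow, inner_smul_right, integral_smul_measure, integral_dirac,
    ENNReal.toReal_ofReal (by positivity), inner_self_eq_norm_sq_to_K, Complex.real_smul, mul_comm]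
  simp

variable [CompleteSpace E] {W : E →L[ℂ] E}

lemma tendsto_geom_average {z : ℂ} (hz : ‖z‖ = 1) (h1 : z ≠ 1) :
    Tendsto (fun N : ℕ => (N : ℂ)⁻¹ * ∑ n ∈ Finset.range N, z ^ n) atTop (𝓝 0) := by
  have hb : ∀ N : ℕ, ‖(N : ℂ)⁻¹ * ∑ n ∈ Finset.range N, z ^ n‖ ≤ 2 / ‖z - 1‖ * (N : ℝ)⁻¹ := by
    intro N
    rw [geom_sum_eq h1, norm_mul, norm_div, norm_inv, Complex.norm_natCast, mul_comm]
    gcongr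
    calc ‖z ^ N - 1‖ ≤ ‖z ^ N‖ + ‖(1 : ℂ)‖ := norm_sub_le _ _
      _ = 2 := by rw [norm_pow, hz]; norm_num
  refine squeeze_zero_norm hb ?_
  simpa using (tendsto_inv_atTop_nhds_zero_nat (𝕜 := ℝ)).const_mul (2 / ‖z - 1‖)

/-- A vector whose spectral measure does not charge `w` is orthogonal to `Ker (W - w)`. -/
lemma inner_eigenvector_eq_zero (hW : W ∈ unitary (E →L[ℂ] E)) {x : E} {m : Measure ℂ}
    (hm : IsScalarSpectralMeasureU W x m) {w : ℂ} (hw : ‖w‖ = 1) (hmw : m {w} = 0) {y : E}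
    (hy : W y = w • y) : inner ℂ y x = 0 := by
  obtain ⟨hfin, hsph, hmom⟩ := hm
  set T : E →L[ℂ] E := (star w) • W with hT
  have hTn : ‖T‖ ≤ 1 := by
    refine ContinuousLinearMap.opNorm_le_bound _ zero_le_one fun v => ?_
    rw [hT, smul_apply, norm_smul, unitary_norm hW, norm_star, hw]
  -- Mean ergodic theorem: the averages of $(\bar wW)^nx$ converge to the projection of $x$ onto
  -- $\ker(W-w)$. Paired with $x$ they are integrals of geometric averages, which tend to $0$ off
  -- the null set $\{w\}$.
  have hlim := ContinuousLinearMap.tendsto_birkhoffAverage_orthogonalProjection T hTn x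
  set F := T.eqLocus (1 : E →L[ℂ] E)
  have hlim2 := (tendsto_const_nhds (x := x)).inner (𝕜 := ℂ) hlim
  have hTpow : ∀ n : ℕ, (T ^ n) x = (star w) ^ n • (W ^ n) x := by
    intro n
    rw [hT, smul_pow]; rfl
  have hae : ∀ᵐ z ∂m, ‖z‖ = 1 := by
    rw [ae_iff]
    convert hsph using 2
    ext z; simp
  have hint : ∀ n : ℕ, Integrable (fun z : ℂ => (star w * z) ^ n) m := by
    intro n
    refine Integrable.of_bound (C := 1) (by fun_prop) ?_
    filter_upwards [hae] with z hz
    rw [norm_pow, norm_mul, norm_star, hw, hz]; simp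
  have heq : ∀ N : ℕ, inner ℂ x (birkhoffAverage ℂ T _root_.id N x) =
      ∫ z, (N : ℂ)⁻¹ * ∑ n ∈ Finset.range N, (star w * z) ^ n ∂m := by
    intro N
    rw [birkhoffAverage, birkhoffSum, inner_smul_right, inner_sum, integral_const_mul,
      integral_finsetSum _ fun n _ => hint n]
    congr 1
    refine Finset.sum_congr rfl fun n _ => ?_
    rw [← FunLike.coe_pow_eq_iterate, _root_.id, hTpow, inner_smul_right, hmom, ← integral_const_mul]
    simp only [mul_pow]
  have hlim3 : Tendsto (fun N : ℕ => ∫ z, (N : ℂ)⁻¹ * ∑ n ∈ Finset.range N, (star w * z) ^ n ∂m)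
      atTop (𝓝 (∫ z, 0 ∂m)) := by
    refine tendsto_integral_of_dominated_convergence (fun _ => 1) (fun N => by fun_prop)
      (integrable_const 1) (fun N => ?_) ?_
    · filter_upwards [hae] with z hz
      have hz1 : ‖star w * z‖ = 1 := by rw [norm_mul, norm_star, hw, hz, one_mul]
      rw [norm_mul, norm_inv, Complex.norm_natCast]
      have : ‖∑ n ∈ Finset.range N, (star w * z) ^ n‖ ≤ N := by
        refine (norm_sum_le _ _).trans ?_
        simp [hw, hz]
      calc (N : ℝ)⁻¹ * ‖∑ n ∈ Finset.range N, (star w * z) ^ n‖ ≤ (N : ℝ)⁻¹ * N := by gcongr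
        _ ≤ 1 := inv_mul_le_one
    · have hne : ∀ᵐ z ∂m, z ≠ w := by
        rw [ae_iff]; simpa using hmw
      filter_upwards [hae, hne] with z hz hzw
      refine tendsto_geom_average (by rw [norm_mul, norm_star, hw, hz, one_mul]) fun h => hzw ?_
      have h2 : w * star w = 1 := by
        have := Complex.mul_conj' w
        rw [hw] at this
        simpa using this
      calc z = (w * star w) * z := by rw [h2, one_mul]
        _ = w := by rw [mul_assoc, h, mul_one]
  have h0 : inner ℂ x (F.orthogonalProjectionOnto x : E) = 0 := by
    refine tendsto_nhds_unique hlim2 ?_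
    simp only [heq]
    simpa using hlim3
  have h1 : (F.orthogonalProjectionOnto x : E) = 0 := by
    rw [← inner_self_eq_zero (𝕜 := ℂ)]
    have h2 : x - F.starProjection x ∈ Fᗮ := F.sub_starProjection_mem_orthogonal x
    have h3 := F.inner_left_of_mem_orthogonal (F.orthogonalProjectionOnto x).2 h2
    rw [inner_sub_left, h0, zero_sub, neg_eq_zero] at h3
    exact h3
  have hyF : y ∈ F := by
    change T y = y
    rw [hT, smul_apply, hy, smul_smul]
    have := Complex.conj_mul' w
    rw [hw] at this
    rw [show star w * w = 1 by simpa using this, one_smul]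
  have h2 : x ∈ Fᗮ := by
    rw [← Submodule.orthogonalProjectionOnto_eq_zero_iff]
    exact Subtype.ext h1
  exact h2 y hyF

/-- The spectral subspace of a set at a positive distance of `1` is spanned by eigenvectors. -/
lemma ranEU_eq_eigSpan (hW : W ∈ unitary (E →L[ℂ] E))
    (hK : IsCompactOperator (W - 1 : E →L[ℂ] E)) {D : Set ℂ} {k : ℝ} (hk : 0 < k)
    (h : ∀ w ∈ D, k ≤ ‖w - 1‖) : ranEU W D = eigSpan W D := by
  have := finiteDimensional_eigSpan hW hK hk h
  apply le_antisymm
  · refine Submodule.span_le.2 ?_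
    rintro x ⟨m, hm, hmD⟩
    refine mem_eigSpan_of_orthogonal hW hK ?_
    rw [Submodule.mem_orthogonal']
    have : eigSpan W Dᶜ ≤ (ℂ ∙ x)ᗮ := by
      refine eigSpan_le fun w hw y hy => ?_
      rw [Submodule.mem_orthogonal_singleton_iff_inner_left]
      rcases eq_or_ne y 0 with rfl | h0
      · simp
      · exact inner_eigenvector_eq_zero hW hm (norm_eigenvalue hW h0 hy)
          (measure_mono_null (singleton_subset_iff.2 hw) hmD) hy
    exact fun y hy => Submodule.mem_orthogonal_singleton_iff_inner_right.1 (this hy)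
  · refine eigSpan_le fun w hw x hx => ?_
    rcases eq_or_ne x 0 with rfl | h0
    · exact Submodule.zero_mem _
    · refine Submodule.subset_span ⟨_, isScalarSpectralMeasureU_eigenvector
        (norm_eigenvalue hW h0 hx) hx, ?_⟩
      simp [Measure.dirac_apply, hw]

end RanEU

/-! ### Arcs of the circle and angles -/

section Arcs

lemma norm_exp_sub_exp_sq (s t : ℝ) :
    ‖Complex.exp (s * Complex.I) - Complex.exp (t * Complex.I)‖ ^ 2 = 2 - 2 * Real.cos (s - t) := by
  rw [← Complex.normSq_eq_norm_sq, Complex.normSq_apply]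
  simp only [Complex.sub_re, Complex.sub_im, Complex.exp_ofReal_mul_I_re,
    Complex.exp_ofReal_mul_I_im, Real.cos_sub]
  linear_combination Real.sin_sq_add_cos_sq s + Real.sin_sq_add_cos_sq t

lemma exp_angle_injective {s t : ℝ} (hs : s ∈ Ico 0 (2 * Real.pi)) (ht : t ∈ Ico 0 (2 * Real.pi))
    (h : Complex.exp (s * Complex.I) = Complex.exp (t * Complex.I)) : s = t := by
  have h1 := norm_exp_sub_exp_sq s t
  rw [h, sub_self, norm_zero] at h1
  have h2 : Real.cos (s - t) = 1 := by nlinarith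
  have := (Real.cos_eq_one_iff_of_lt_of_lt (by linarith [hs.1, ht.2]) (by linarith [hs.2, ht.1])).1 h2
  linarith

lemma exists_angle {w : ℂ} (hw : ‖w‖ = 1) :
    ∃ t ∈ Ico 0 (2 * Real.pi), Complex.exp (t * Complex.I) = w := by
  refine ⟨toIcoMod Real.two_pi_pos 0 w.arg, by simpa using toIcoMod_mem_Ico Real.two_pi_pos 0 w.arg, ?_⟩
  have h : w = Complex.exp (w.arg * Complex.I) := by
    have := Complex.norm_mul_exp_arg_mul_I w
    rw [hw] at this
    simpa using this.symm
  rw [toIcoMod]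
  conv_rhs => rw [h]
  rw [Complex.exp_eq_exp_iff_exists_int]
  refine ⟨-toIcoDiv Real.two_pi_pos 0 w.arg, ?_⟩
  push_cast [zsmul_eq_mul]
  ring

lemma mem_arc_iff {a b t : ℝ} (ha : 0 ≤ a) (hb : b ≤ 2 * Real.pi) (ht : t ∈ Ico 0 (2 * Real.pi)) :
    Complex.exp (t * Complex.I) ∈ arc a b ↔ t ∈ Ico a b := by
  constructor
  · rintro ⟨s, hs, hst⟩
    rwa [← exp_angle_injective ⟨ha.trans hs.1, hs.2.trans_le hb⟩ ht hst]
  · exact fun h => ⟨t, h, rfl⟩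

lemma arc_dist_one {a b : ℝ} (ha : 0 < a) (hb : b < 2 * Real.pi) :
    ∃ k > 0, ∀ w ∈ arc a b, k ≤ ‖w - 1‖ := by
  rcases lt_or_ge b a with hab | hab
  · exact ⟨1, one_pos, by simp [arc, Ico_eq_empty_of_le hab.le]⟩
  obtain ⟨t, ht, hmin⟩ := isCompact_Icc.exists_isMinOn (nonempty_Icc.2 hab)
    (f := fun t : ℝ => ‖Complex.exp (t * Complex.I) - 1‖) (by fun_prop)
  refine ⟨‖Complex.exp (t * Complex.I) - 1‖, norm_pos_iff.2 (sub_ne_zero.2 fun h => ?_), ?_⟩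
  · have h0 : Complex.exp (t * Complex.I) = Complex.exp ((0 : ℝ) * Complex.I) := by simp [h]
    have := exp_angle_injective ⟨by linarith [ht.1], by linarith [ht.2]⟩
      ⟨le_rfl, Real.two_pi_pos⟩ h0
    linarith [ht.1]
  · rintro _ ⟨s, hs, rfl⟩
    exact hmin (Ico_subset_Icc_self hs)

lemma arc_union {a b c : ℝ} (hab : a ≤ b) (hbc : b ≤ c) : arc a b ∪ arc b c = arc a c := by
  rw [arc, arc, arc, ← image_union, Ico_union_Ico_eq_Ico hab hbc]

lemma arc_disjoint {a b c : ℝ} (ha : 0 ≤ a) (hc : c ≤ 2 * Real.pi) (hab : a ≤ b) (hbc : b ≤ c) :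
    Disjoint (arc a b) (arc b c) := by
  rw [Set.disjoint_left]
  rintro _ ⟨t, ht, rfl⟩ h
  have := (mem_arc_iff (ha.trans hab) hc ⟨ha.trans ht.1, by linarith [ht.2]⟩).1 h
  exact absurd this.1 (not_le.2 ht.2)

end Arcs

/-! ### The counting function and the class `eta` -/

section Counting

variable {E : Type*} [NormedAddCommGroup E] [InnerProductSpace ℂ E] [CompleteSpace E]

variable (E) in
/-- The unitary operators which are compact perturbations of the identity. -/
abbrev UK : Type _ :=
  {W : E →L[ℂ] E // W ∈ unitary (E →L[ℂ] E) ∧ IsCompactOperator (W - 1 : E →L[ℂ] E)}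

namespace UK

variable (W V : UK E)

/-- The number of eigenvalues of `W` on the arc `[exp (i a), exp (i b))`. -/
noncomputable def dim (a b : ℝ) : ℤ := Module.finrank ℂ (eigSpan W.1 (arc a b))

lemma dim_of_le {a b : ℝ} (h : b ≤ a) : W.dim a b = 0 := by
  have h0 : eigSpan W.1 ∅ = ⊥ := by simp [eigSpan]
  rw [dim, arc, Ico_eq_empty_of_le h, image_empty, h0, finrank_bot, Nat.cast_zero]

lemma dim_nonneg (a b : ℝ) : 0 ≤ W.dim a b := Int.natCast_nonneg _

lemma finiteDimensional {a b : ℝ} (ha : 0 < a) (hb : b < 2 * Real.pi) :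
    FiniteDimensional ℂ (eigSpan W.1 (arc a b)) := by
  obtain ⟨k, hk, h⟩ := arc_dist_one ha hb
  exact finiteDimensional_eigSpan W.2.1 W.2.2 hk h

lemma dim_add {a b c : ℝ} (ha : 0 < a) (hc : c < 2 * Real.pi) (hab : a ≤ b) (hbc : b ≤ c) :
    W.dim a c = W.dim a b + W.dim b c := by
  have := W.finiteDimensional ha (hbc.trans_lt hc)
  have := W.finiteDimensional (ha.trans_le hab) hc
  have h := Submodule.finrank_sup_add_finrank_inf_eq (eigSpan W.1 (arc a b)) (eigSpan W.1 (arc b c))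
  have h0 : eigSpan W.1 (arc a b) ⊓ eigSpan W.1 (arc b c) = ⊥ := by
    have h1 := eigSpan_orthogonal W.2.1 (arc_disjoint ha.le hc.le hab hbc)
    have h2 := (Submodule.orthogonal_disjoint (eigSpan W.1 (arc b c))).symm
    exact (h2.mono_left h1).eq_bot
  rw [h0, finrank_bot, ← eigSpan_union, arc_union hab hbc] at h
  simp only [dim]
  omega

/-- At least one of the two terms belongs to an empty arc and vanishes, so the signed rank is
written without cases. -/
lemma countingU_eq (a b : Angle) : countingU W.1 a b = W.dim a b - W.dim b a := by
  have hr : ∀ a b : Angle, ranEU W.1 (arc a b) = eigSpan W.1 (arc a b) := fun a b => by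
    obtain ⟨k, hk, h⟩ := arc_dist_one a.2.1 b.2.2
    exact ranEU_eq_eigSpan W.2.1 W.2.2 hk h
  unfold countingU
  split_ifs with h1 h2
  · rw [hr, W.dim_of_le h1.le, sub_zero]; rfl
  · rw [hr, W.dim_of_le h2.le, zero_sub]; rfl
  · have : (a : ℝ) = b := le_antisymm (not_lt.1 h2) (not_lt.1 h1)
    rw [this, sub_self]

lemma countingU_of_le {a b : Angle} (h : a ≤ b) : countingU W.1 a b = W.dim a b := by
  rw [countingU_eq, W.dim_of_le h, sub_zero]

lemma countingU_add (a b c : Angle) :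
    countingU W.1 a b + countingU W.1 b c = countingU W.1 a c := by
  have key : ∀ a b c : Angle, a ≤ b → b ≤ c → W.dim a c = W.dim a b + W.dim b c :=
    fun a b c hab hbc => W.dim_add a.2.1 c.2.2 hab hbc
  have h0 : ∀ a b : Angle, a ≤ b → W.dim b a = 0 := fun a b h => W.dim_of_le h
  simp only [countingU_eq]
  rcases le_total a b with h1 | h1 <;> rcases le_total b c with h2 | h2 <;>
    rcases le_total a c with h3 | h3 <;>
    first
    | (have e1 := h0 _ _ h1; have e2 := h0 _ _ h2; have e3 := h0 _ _ h3
       first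
       | (have e4 := key _ _ _ h1 h2; omega)
       | (have e4 := key _ _ _ h2 h1; omega)
       | (have e4 := key _ _ _ h1 h3; omega)
       | (have e4 := key _ _ _ h3 h1; omega)
       | (have e4 := key _ _ _ h2 h3; omega)
       | (have e4 := key _ _ _ h3 h2; omega)
       -- A cyclic chain of inequalities among the three angles forces them to coincide.
       | (have e5 := le_antisymm h1 (h2.trans h3); subst e5; omega)
       | (have e5 := le_antisymm (h3.trans h2) h1; subst e5; omega))

lemma finite_angles {a b : ℝ} (ha : 0 < a) (hb : b < 2 * Real.pi) :
    {t ∈ Ico a b | ∃ x, x ≠ 0 ∧ W.1 x = Complex.exp (t * Complex.I) • x}.Finite := by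
  have := W.finiteDimensional ha hb
  refine Finite.of_finite_image (f := fun t : ℝ => Complex.exp (t * Complex.I))
    ((finite_eigenvalues (W := W.1) (arc a b)).subset ?_) ?_
  · rintro _ ⟨t, ⟨ht, h⟩, rfl⟩
    exact ⟨⟨t, ht, rfl⟩, h⟩
  · intro s hs t ht h
    exact exp_angle_injective ⟨ha.le.trans hs.1.1, hs.1.2.trans hb⟩
      ⟨ha.le.trans ht.1.1, ht.1.2.trans hb⟩ h

lemma exp_ne_one (t : Angle) : Complex.exp ((t : ℝ) * Complex.I) ≠ 1 := by
  intro h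
  have h0 : Complex.exp ((t : ℝ) * Complex.I) = Complex.exp ((0 : ℝ) * Complex.I) := by simp [h]
  exact t.2.1.ne' (exp_angle_injective ⟨t.2.1.le, t.2.2⟩ ⟨le_rfl, Real.two_pi_pos⟩ h0)

/-- Every interval contains an angle outside the spectrum. -/
lemma exists_angle_notMem {a b : ℝ} (ha : 0 ≤ a) (hab : a < b) (hb : b ≤ 2 * Real.pi) :
    ∃ t : Angle, a < t ∧ (t : ℝ) < b ∧ Complex.exp ((t : ℝ) * Complex.I) ∉ spectrum ℂ W.1 := by
  have hfin := W.finite_angles (a := (2 * a + b) / 3) (b := (a + 2 * b) / 3)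
    (by linarith) (by linarith)
  have hinf : (Ico ((2 * a + b) / 3) ((a + 2 * b) / 3)).Infinite := Ico_infinite (by linarith)
  obtain ⟨t, ht, hnt⟩ := hinf.exists_notMem_finite hfin
  have hA : t ∈ Ioo 0 (2 * Real.pi) := ⟨by linarith [ht.1], by linarith [ht.2]⟩
  refine ⟨⟨t, hA⟩, by simp only; linarith [ht.1], by simp only; linarith [ht.2], fun h => hnt ⟨ht, ?_⟩⟩
  exact exists_eigenvector_of_mem_spectrum W.2.2 (exp_ne_one ⟨t, hA⟩) h

lemma dim_eq_zero {a b : ℝ}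
    (h : ∀ t ∈ Ico a b, ¬ ∃ x, x ≠ 0 ∧ W.1 x = Complex.exp (t * Complex.I) • x) :
    W.dim a b = 0 := by
  have : eigSpan W.1 (arc a b) = ⊥ := by
    rw [eq_bot_iff]
    refine eigSpan_le ?_
    rintro _ ⟨t, ht, rfl⟩ x hx
    by_contra h0
    exact h t ht ⟨x, fun h' => h0 (by simp [h']), hx⟩
  rw [dim, this, finrank_bot, Nat.cast_zero]

/-- Only finitely many eigenvalues lie on an arc away from `1`, and the half-open arc excludes a
possible eigenvalue at `t` itself. This is the left continuity of the counting function. -/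
lemma eventually_dim_eq_zero (t : Angle) : ∀ᶠ s : ℝ in 𝓝 (t : ℝ), W.dim s t = 0 := by
  have hfin := W.finite_angles (a := t / 2) (half_pos t.2.1) t.2.2
  have h1 : ∀ᶠ s : ℝ in 𝓝 (t : ℝ), s ∈ {s ∈ Ico (t / 2 : ℝ) t |
      ∃ x, x ≠ 0 ∧ W.1 x = Complex.exp (s * Complex.I) • x}ᶜ :=
    hfin.isClosed.isOpen_compl.mem_nhds fun h => lt_irrefl _ h.1.2
  have h2 : ∀ᶠ s : ℝ in 𝓝 (t : ℝ), (t : ℝ) / 2 < s := lt_mem_nhds (half_lt_self t.2.1)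
  obtain ⟨e, he, hball⟩ := Metric.eventually_nhds_iff_ball.1 (h1.and h2)
  filter_upwards [Metric.ball_mem_nhds _ he] with s hs
  refine W.dim_eq_zero fun u hu hx => ?_
  have hub : u ∈ Metric.ball (t : ℝ) e := by
    rw [Metric.mem_ball, Real.dist_eq] at hs ⊢
    rw [abs_lt] at hs ⊢
    exact ⟨by linarith [hu.1], by linarith [hu.2]⟩
  exact (hball u hub).1 ⟨⟨(hball u hub).2.le, hu.2⟩, hx⟩

/-- The function `N(·, exp (i a); W)`. -/
noncomputable def etaFun (a : Angle) : XTilde where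
  toFun t := countingU W.1 t a
  antitone s t h := by
    dsimp only
    rw [← W.countingU_add s t a, W.countingU_of_le h]
    linarith [W.dim_nonneg s t]
  leftCont t := by
    refine ContinuousWithinAt.congr_of_eventuallyEq (f := fun _ => countingU W.1 t a)
      continuousWithinAt_const ?_ rfl
    have h := (continuous_subtype_val.tendsto t).eventually (W.eventually_dim_eq_zero t)
    filter_upwards [mem_nhdsWithin_of_mem_nhds h, self_mem_nhdsWithin] with s hs hst
    rw [← W.countingU_add s t a, W.countingU_of_le hst, hs, zero_add]

lemma proj_etaFun (a b : Angle) : XInf.proj (W.etaFun a) = XInf.proj (W.etaFun b) :=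
  XInf.proj_eq_iff.2 ⟨countingU W.1 b a, XTilde.ext' fun t => by
    change countingU W.1 t a = countingU W.1 t b + _
    rw [W.countingU_add]⟩

/-- Moving the base angle adds an integer constant, so the choice inside `eta` is immaterial. The
base angle may even lie in the spectrum here, although `IsEta` asks for one outside it. -/
lemma eta_eq (a : Angle) : eta W.1 = XInf.proj (W.etaFun a) := by
  obtain ⟨b, -, -, hb⟩ := W.exists_angle_notMem le_rfl Real.two_pi_pos le_rfl
  have hex : ∃ F, IsEta W.1 F := ⟨_, b, hb, W.etaFun b, fun _ => rfl, rfl⟩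
  obtain ⟨c, -, f, hf, hF⟩ := Classical.epsilon_spec hex
  have : f = W.etaFun c := XTilde.ext' hf
  rw [eta, ← hF, this, W.proj_etaFun c a]

/-- A criterion without base point: a representative of `eta` is recognised by its differences
alone. -/
lemma proj_eq_eta_iff {f : XTilde} :
    XInf.proj f = eta W.1 ↔ ∀ s t, f.toFun s - f.toFun t = countingU W.1 s t := by
  constructor
  · intro h s t
    rw [W.eta_eq t] at h
    obtain ⟨n, rfl⟩ := XInf.proj_eq_iff.1 h
    change countingU W.1 s t + n - (countingU W.1 t t + n) = _
    have := W.countingU_add t t t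
    omega
  · intro h
    rw [W.eta_eq XTilde.mid]
    refine XInf.proj_eq_iff.2 ⟨f.toFun XTilde.mid, XTilde.ext' fun t => ?_⟩
    have := h t XTilde.mid
    change _ = countingU W.1 t _ + _
    omega

end UK
end Counting

/-! ### Norm continuity of `eta` -/

section Stability

variable {E : Type*} [NormedAddCommGroup E] [InnerProductSpace ℂ E] [CompleteSpace E]

lemma exists_mem_orthogonal_of_finrank_lt {F G : Submodule ℂ E} [FiniteDimensional ℂ F]
    [FiniteDimensional ℂ G] (h : Module.finrank ℂ G < Module.finrank ℂ F) :
    ∃ x ∈ F, x ≠ 0 ∧ x ∈ Gᗮ := by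
  let T : F →ₗ[ℂ] G := (G.orthogonalProjectionOnto : E →ₗ[ℂ] G) ∘ₗ F.subtype
  have hne : LinearMap.ker T ≠ ⊥ := LinearMap.ker_ne_bot_of_finrank_lt h
  obtain ⟨x, hx, h0⟩ := Submodule.exists_mem_ne_zero_of_ne_bot hne
  refine ⟨x, x.2, fun h => h0 (Subtype.ext h), ?_⟩
  exact Submodule.orthogonalProjectionOnto_eq_zero_iff.1 hx

/-- On the circle an arc is, up to its endpoints, a disc around its midpoint. This turns the
condition that an eigenvalue lies on the arc into a bound on $\|(W-c)x\|$, which is stable under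
perturbation. -/
lemma dist_arc_center {a b t : ℝ} (ha : 0 < a) (hab : a < b) (hb : b < 2 * Real.pi)
    (ht : t ∈ Ico 0 (2 * Real.pi)) :
    (t ∈ Ico a b → ‖Complex.exp (t * Complex.I) - Complex.exp (((a + b) / 2 : ℝ) * Complex.I)‖ ≤
      ‖Complex.exp (a * Complex.I) - Complex.exp (((a + b) / 2 : ℝ) * Complex.I)‖) ∧
    (t ∉ Ico a b → ‖Complex.exp (a * Complex.I) - Complex.exp (((a + b) / 2 : ℝ) * Complex.I)‖ ≤
      ‖Complex.exp (t * Complex.I) - Complex.exp (((a + b) / 2 : ℝ) * Complex.I)‖) ∧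
    (t ≠ a → t ≠ b → ‖Complex.exp (t * Complex.I) - Complex.exp (((a + b) / 2 : ℝ) * Complex.I)‖ ≠
      ‖Complex.exp (a * Complex.I) - Complex.exp (((a + b) / 2 : ℝ) * Complex.I)‖) := by
  have hpi := Real.pi_pos
  have hiff : ∀ x y : ℝ, 0 ≤ x → 0 ≤ y → x ^ 2 ≤ y ^ 2 → x ≤ y := fun x y hx hy h =>
    (pow_le_pow_iff_left₀ hx hy two_ne_zero).1 h
  have hca : Real.cos (a - (a + b) / 2) = Real.cos ((b - a) / 2) := by
    rw [← Real.cos_neg]; congr 1; ring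
  have hin : t ∈ Ioo a b → Real.cos ((b - a) / 2) < Real.cos (t - (a + b) / 2) := by
    intro h
    rw [← Real.cos_abs (t - _)]
    refine Real.cos_lt_cos_of_nonneg_of_le_pi (abs_nonneg _) (by linarith) ?_
    rw [abs_lt]
    exact ⟨by linarith [h.1], by linarith [h.2]⟩
  have hout : t < a ∨ b < t → Real.cos (t - (a + b) / 2) < Real.cos ((b - a) / 2) := by
    intro h
    rw [← Real.cos_abs (t - _)]
    have h1 : (b - a) / 2 < |t - (a + b) / 2| := by
      rcases h with h | h
      · rw [lt_abs]; right; linarith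
      · rw [lt_abs]; left; linarith
    have h2 : |t - (a + b) / 2| < 2 * Real.pi - (b - a) / 2 := by
      rw [abs_lt]; constructor <;> linarith [ht.1, ht.2]
    rcases le_total |t - (a + b) / 2| Real.pi with h3 | h3
    · exact Real.cos_lt_cos_of_nonneg_of_le_pi (by linarith) h3 h1
    · rw [← Real.cos_two_pi_sub]
      exact Real.cos_lt_cos_of_nonneg_of_le_pi (by linarith) (by linarith) (by linarith)
  have hta : t = a → Real.cos (t - (a + b) / 2) = Real.cos ((b - a) / 2) := by
    rintro rfl; exact hca
  have htb : t = b → Real.cos (t - (a + b) / 2) = Real.cos ((b - a) / 2) := by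
    rintro rfl; congr 1; ring
  refine ⟨fun h => hiff _ _ (norm_nonneg _) (norm_nonneg _) ?_,
    fun h => hiff _ _ (norm_nonneg _) (norm_nonneg _) ?_, fun h1 h2 h => ?_⟩
  · rw [norm_exp_sub_exp_sq, norm_exp_sub_exp_sq, hca]
    rcases eq_or_lt_of_le h.1 with h1 | h1
    · rw [hta h1.symm]
    · linarith [hin ⟨h1, h.2⟩]
  · rw [norm_exp_sub_exp_sq, norm_exp_sub_exp_sq, hca]
    rcases lt_or_ge t a with h1 | h1
    · linarith [hout (Or.inl h1)]
    · have : b ≤ t := not_lt.1 fun h2 => h ⟨h1, h2⟩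
      rcases eq_or_lt_of_le this with h3 | h3
      · rw [htb h3.symm]
      · linarith [hout (Or.inr h3)]
  · have h3 := congrArg (· ^ 2) h
    simp only [norm_exp_sub_exp_sq, hca] at h3
    rcases lt_or_gt_of_ne h1 with h4 | h4
    · linarith [hout (Or.inl h4)]
    · rcases lt_or_gt_of_ne h2 with h5 | h5
      · linarith [hin ⟨h4, h5⟩]
      · linarith [hout (Or.inr h5)]

namespace UK

/-- Otherwise some nonzero $x$ in the span for $W$ is orthogonal to the span for $V$. Then
$\|(W-c)x\|\le r\|x\|$ and $\|(V-c)x\|\ge r'\|x\|$, which $\|V-W\|<r'-r$ forbids. -/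
lemma finrank_eigSpan_le (W V : UK E) {D : Set ℂ} {c : ℂ} {r r' : ℝ} (hr : 0 ≤ r) (hr' : 0 ≤ r')
    (hD : ∀ w ∈ D, (∃ x, x ≠ 0 ∧ W.1 x = w • x) → ‖w - c‖ ≤ r)
    (hD' : ∀ w ∉ D, (∃ x, x ≠ 0 ∧ V.1 x = w • x) → r' ≤ ‖w - c‖)
    [FiniteDimensional ℂ (eigSpan W.1 D)]
    [FiniteDimensional ℂ (eigSpan V.1 D)] (h : ‖V.1 - W.1‖ < r' - r) :
    Module.finrank ℂ (eigSpan W.1 D) ≤ Module.finrank ℂ (eigSpan V.1 D) := by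
  by_contra! hlt
  obtain ⟨x, hx, h0, hxo⟩ := exists_mem_orthogonal_of_finrank_lt hlt
  have h1 := eigSpan_norm_le W.2.1 (c := c) hr hD hx
  have h2 := le_norm_of_mem_orthogonal V.2.1 V.2.2 hr' hD' hxo
  have h3 : (V.1 - c • 1) x = (W.1 - c • 1) x + (V.1 - W.1) x := by
    simp only [sub_apply]; abel
  have h4 := (V.1 - W.1).le_opNorm x
  rw [h3] at h2
  have h5 := norm_add_le ((W.1 - c • 1) x) ((V.1 - W.1) x)
  have h6 : 0 < ‖x‖ := norm_pos_iff.2 h0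
  nlinarith

/-- The number of eigenvalues on an arc with endpoints off the spectrum is locally constant. -/
lemma exists_dim_eq (W : UK E) {a b : ℝ} (ha : 0 < a) (hab : a < b) (hb : b < 2 * Real.pi)
    (haW : Complex.exp (a * Complex.I) ∉ spectrum ℂ W.1)
    (hbW : Complex.exp (b * Complex.I) ∉ spectrum ℂ W.1) :
    ∃ d > 0, ∀ V : UK E, dist V W < d → V.dim a b = W.dim a b := by
  set c := Complex.exp (((a + b) / 2 : ℝ) * Complex.I) with hc
  set r := ‖Complex.exp (a * Complex.I) - c‖ with hr
  have hpi := Real.pi_pos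
  have hr0 : 0 < r := norm_pos_iff.2 <| sub_ne_zero.2 fun h => by
    have := exp_angle_injective ⟨ha.le, hab.trans hb⟩ ⟨by linarith, by linarith⟩ h
    linarith
  -- The spectrum is compact and avoids both endpoints of the arc, the only points of the circle at
  -- distance exactly `r` from `c`. Taking `k ≤ r` keeps the radius `r - k` nonnegative below.
  obtain ⟨k, hk, hkr, hgap⟩ : ∃ k > 0, k ≤ r ∧ ∀ w ∈ spectrum ℂ W.1, ‖w‖ = 1 →
      k ≤ |‖w - c‖ - r| := by
    have hcpt : IsCompact (spectrum ℂ W.1 ∩ Metric.sphere 0 1) :=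
      (spectrum.isCompact W.1).inter_right Metric.isClosed_sphere
    rcases (spectrum ℂ W.1 ∩ Metric.sphere 0 1).eq_empty_or_nonempty with he | hne
    · refine ⟨r, hr0, le_rfl, fun w hw hw1 => ?_⟩
      have : w ∈ spectrum ℂ W.1 ∩ Metric.sphere 0 1 := ⟨hw, by simpa using hw1⟩
      rw [he] at this
      exact this.elim
    · obtain ⟨w, hw, hmin⟩ := hcpt.exists_isMinOn hne (f := fun w => |‖w - c‖ - r|)
        (by fun_prop)
      obtain ⟨t, ht, rfl⟩ := exists_angle (by simpa using hw.2 : ‖w‖ = 1)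
      have h1 := (dist_arc_center ha hab hb ht).2.2 (fun h => haW (h ▸ hw.1))
        (fun h => hbW (h ▸ hw.1))
      refine ⟨min r |‖Complex.exp (t * Complex.I) - c‖ - r|,
        lt_min hr0 (abs_pos.2 (sub_ne_zero.2 h1)), min_le_left _ _, fun w hw hw1 => ?_⟩
      exact (min_le_right _ _).trans (hmin ⟨hw, by simpa using hw1⟩)
  have hin : ∀ w ∈ arc a b, ‖w - c‖ ≤ r := by
    rintro _ ⟨t, ht, rfl⟩
    exact (dist_arc_center ha hab hb ⟨ha.le.trans ht.1, ht.2.trans hb⟩).1 ht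
  have hout : ∀ w ∉ arc a b, ‖w‖ = 1 → r ≤ ‖w - c‖ := by
    intro w hw hw1
    obtain ⟨t, ht, rfl⟩ := exists_angle hw1
    exact (dist_arc_center ha hab hb ht).2.1 fun h => hw ⟨t, h, rfl⟩
  refine ⟨k, hk, fun V hV => ?_⟩
  rw [Subtype.dist_eq, dist_eq_norm] at hV
  have := V.finiteDimensional ha hb
  have := W.finiteDimensional ha hb
  have hgapW : ∀ w, (∃ x, x ≠ 0 ∧ W.1 x = w • x) → ‖w‖ = 1 ∧ k ≤ |‖w - c‖ - r| := by
    rintro w ⟨x, h0, hx⟩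
    have h1 := norm_eigenvalue W.2.1 h0 hx
    exact ⟨h1, hgap w (mem_spectrum_of_eigenvector h0 hx) h1⟩
  rw [dim, dim, Nat.cast_inj]
  apply le_antisymm
  · refine finrank_eigSpan_le V W (c := c) (r := r) (r' := r + k) hr0.le (by linarith)
      (fun w hw _ => hin w hw) (fun w hw hx => ?_) ?_
    · have h1 := hout w hw (hgapW w hx).1
      have h2 := (hgapW w hx).2
      rw [abs_of_nonneg (by linarith)] at h2
      linarith
    · rw [norm_sub_rev]; linarith
  · refine finrank_eigSpan_le W V (c := c) (r := r - k) (r' := r) (by linarith) hr0.le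
      (fun w hw hx => ?_) (fun w hw ⟨x, h0, hx⟩ => hout w hw (norm_eigenvalue V.2.1 h0 hx)) ?_
    · have h1 := hin w hw
      have h2 := (hgapW w hx).2
      rw [abs_of_nonpos (by linarith)] at h2
      linarith
    · linarith

lemma exists_countingU_eq (W : UK E) {a b : Angle}
    (haW : Complex.exp ((a : ℝ) * Complex.I) ∉ spectrum ℂ W.1)
    (hbW : Complex.exp ((b : ℝ) * Complex.I) ∉ spectrum ℂ W.1) :
    ∀ᶠ V in 𝓝 W, countingU V.1 a b = countingU W.1 a b := by
  rcases lt_trichotomy (a : ℝ) b with h | h | h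
  · obtain ⟨d, hd, hV⟩ := W.exists_dim_eq a.2.1 h b.2.2 haW hbW
    filter_upwards [Metric.ball_mem_nhds W hd] with V hVd
    rw [countingU_of_le _ h.le, countingU_of_le _ h.le, hV V hVd]
  · refine Eventually.of_forall fun V => ?_
    rw [countingU_eq, countingU_eq, h, sub_self, sub_self]
  · obtain ⟨d, hd, hV⟩ := W.exists_dim_eq b.2.1 h a.2.2 hbW haW
    filter_upwards [Metric.ball_mem_nhds W hd] with V hVd
    rw [countingU_eq, countingU_eq, dim_of_le _ h.le, dim_of_le _ h.le, hV V hVd]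

/-- If the levels differed by more than two cells, a whole cell would lie between them, and the
functions would differ at its sample angle. -/
lemma nu_sub_le {N : ℕ} (hN : 0 < N) {f g : XTilde} (θ : Fin N → Angle)
    (hθ : ∀ k : Fin N, 2 * Real.pi / N * (k : ℕ) < θ k ∧ (θ k : ℝ) < 2 * Real.pi / N * ((k : ℕ) + 1))
    (h : ∀ k, f.toFun (θ k) = g.toFun (θ k)) (n : ℤ) :
    f.nu n - g.nu n ≤ 2 * (2 * Real.pi / N) := by
  have hN' : (0 : ℝ) < N := by exact_mod_cast hN
  set q := 2 * Real.pi / N with hq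
  have hq0 : 0 < q := by positivity
  by_contra! hlt
  have hg0 := g.nu_nonneg n
  have hf := f.nu_le n
  set k := ⌊g.nu n / q⌋₊ + 1 with hk
  have h1 : g.nu n < q * k := by
    have := Nat.lt_floor_add_one (g.nu n / q)
    rw [div_lt_iff₀ hq0] at this
    rw [hk]; push_cast; linarith
  have h2 : q * k ≤ g.nu n + q := by
    have := Nat.floor_le (div_nonneg hg0 hq0.le)
    rw [le_div_iff₀ hq0] at this
    rw [hk]; push_cast; linarith
  have hkN : k < N := by
    have h3 : q * k < q * N := by
      have : q * N = 2 * Real.pi := by rw [hq]; field_simp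
      linarith
    exact_mod_cast lt_of_mul_lt_mul_left h3 hq0.le
  obtain ⟨h4, h5⟩ := hθ ⟨k, hkN⟩
  simp only at h4 h5
  have h6 := (f.lt_toFun_iff n (θ ⟨k, hkN⟩)).2 (by linarith)
  have h7 := (g.toFun_le_iff n (θ ⟨k, hkN⟩)).2 (by linarith)
  have := h ⟨k, hkN⟩
  omega

/-- The map `η` is continuous in the operator norm. -/
lemma continuous_eta : Continuous fun W : UK E => eta W.1 := by
  rw [continuous_iff_continuousAt]
  intro W
  rw [ContinuousAt, Metric.tendsto_nhds]
  intro e he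
  obtain ⟨N, hN⟩ := exists_nat_gt (2 * (2 * Real.pi) / e)
  have hN0 : (0 : ℝ) < N := (by positivity : (0 : ℝ) ≤ 2 * (2 * Real.pi) / e).trans_lt hN
  have hNe : 2 * (2 * Real.pi / N) < e := by
    rw [div_lt_iff₀ he] at hN
    rw [← mul_div_assoc, div_lt_iff₀ hN0]
    linarith
  -- A sample angle off the spectrum of `W` in each cell: counting numbers between such angles are
  -- locally constant in the operator, so finitely many of them control all levels up to two cells.
  have hcell : ∀ k : Fin N, ∃ t : Angle, 2 * Real.pi / N * (k : ℕ) < t ∧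
      (t : ℝ) < 2 * Real.pi / N * ((k : ℕ) + 1) ∧
      Complex.exp ((t : ℝ) * Complex.I) ∉ spectrum ℂ W.1 := by
    intro k
    have hk : ((k : ℕ) : ℝ) + 1 ≤ N := by exact_mod_cast k.2
    refine W.exists_angle_notMem (by positivity) ?_ ?_
    · have : 0 < 2 * Real.pi / N := by positivity
      linarith
    · calc 2 * Real.pi / N * ((k : ℕ) + 1) ≤ 2 * Real.pi / N * N := by gcongr
        _ = 2 * Real.pi := by field_simp
  choose θ h1 h2 h3 using hcell
  have hNn : 0 < N := by exact_mod_cast hN0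
  set a := θ ⟨0, hNn⟩
  have hev : ∀ᶠ V in 𝓝 W, ∀ k, countingU V.1 (θ k) a = countingU W.1 (θ k) a :=
    eventually_all.2 fun k => W.exists_countingU_eq (h3 k) (h3 _)
  filter_upwards [hev] with V hV
  rw [V.eta_eq a, W.eta_eq a]
  refine ((XInf.dist_proj_le _ _).trans (XTilde.dist_le_of_nu fun n => ?_)).trans_lt hNe
  rw [abs_le]
  constructor
  · have := nu_sub_le hNn θ (fun k => ⟨h1 k, h2 k⟩) (fun k => (hV k).symm) n
      (f := W.etaFun a) (g := V.etaFun a)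
    linarith
  · exact nu_sub_le hNn θ (fun k => ⟨h1 k, h2 k⟩) hV n

end UK
end Stability

/-! ### Resolvent algebra -/

section Resolvent

variable {E : Type*} [NormedAddCommGroup E] [InnerProductSpace ℂ E]

lemma IsResolventAt.unique {A : E →ₗ.[ℂ] E} {z : ℂ} {R R' : E →L[ℂ] E}
    (h : IsResolventAt A z R) (h' : IsResolventAt A z R') : R = R' := by
  ext y
  obtain ⟨hd, hy⟩ := h'.1 y
  have := h.2 ⟨R' y, hd⟩
  rwa [hy] at this

lemma isResolventAt_res {A : E →ₗ.[ℂ] E} {z : ℂ} (h : z ∈ rho A) :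
    IsResolventAt A z (res A z) := by
  have h' : ∃ R, IsResolventAt A z R := h
  rw [res, dif_pos h']
  exact h'.choose_spec

lemma IsResolventAt.res_eq {A : E →ₗ.[ℂ] E} {z : ℂ} {R : E →L[ℂ] E}
    (h : IsResolventAt A z R) : res A z = R :=
  (isResolventAt_res ⟨R, h⟩).unique h

lemma resolvent_identity {A : E →ₗ.[ℂ] E} {z w : ℂ} (hz : z ∈ rho A) (hw : w ∈ rho A) :
    res A z = res A w + (z - w) • (res A w * res A z) := by
  ext y
  obtain ⟨hd, hy⟩ := (isResolventAt_res hz).1 y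
  have h := (isResolventAt_res hw).2 ⟨res A z y, hd⟩
  have h1 : A ⟨res A z y, hd⟩ - w • res A z y = y + (z - w) • res A z y := by
    rw [sub_smul, ← add_sub_assoc, ← sub_eq_iff_eq_add.1 hy]
  simp only at h
  rw [h1, map_add, map_smul] at h
  exact h.symm

lemma resolvent_mul_eq_one {A : E →ₗ.[ℂ] E} {z w : ℂ} (hz : z ∈ rho A) (hw : w ∈ rho A) :
    (1 - (z - w) • res A w) * (1 + (z - w) • res A z) = 1 := by
  have h := resolvent_identity hz hw
  have h2 : (1 - (z - w) • res A w) * (1 + (z - w) • res A z) =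
      1 + (z - w) • (res A z - (res A w + (z - w) • (res A w * res A z))) := by
    simp only [sub_mul, mul_add, one_mul, mul_one, smul_mul_assoc, mul_smul_comm, smul_sub,
      smul_add]
    abel
  rw [h2, ← h, sub_self, smul_zero, add_zero]

lemma resolvent_mul_eq_one' {A : E →ₗ.[ℂ] E} {z w : ℂ} (hz : z ∈ rho A) (hw : w ∈ rho A) :
    (1 + (z - w) • res A z) * (1 - (z - w) • res A w) = 1 := by
  have h := resolvent_mul_eq_one hw hz
  rwa [← neg_sub z w, neg_smul, neg_smul, sub_neg_eq_add, ← sub_eq_add_neg] at h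

lemma isUnit_one_sub_smul_res {A : E →ₗ.[ℂ] E} {z w : ℂ} (hz : z ∈ rho A) (hw : w ∈ rho A) :
    IsUnit (1 - (z - w) • res A w) :=
  ⟨⟨_, _, resolvent_mul_eq_one hz hw, resolvent_mul_eq_one' hz hw⟩, rfl⟩

lemma isResolventAt_of_inverse {A : E →ₗ.[ℂ] E} {z w : ℂ} (hw : w ∈ rho A) {S : E →L[ℂ] E}
    (h1 : (1 - (z - w) • res A w) * S = 1) (h2 : S * (1 - (z - w) • res A w) = 1) :
    IsResolventAt A z (res A w * S) := by
  constructor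
  · intro y
    obtain ⟨hd, hy⟩ := (isResolventAt_res hw).1 (S y)
    refine ⟨hd, ?_⟩
    have h3 : S y - (z - w) • res A w (S y) = y := by
      simpa using congrArg (fun T : E →L[ℂ] E => T y) h1
    calc A ⟨res A w (S y), hd⟩ - z • res A w (S y)
        = (A ⟨res A w (S y), hd⟩ - w • res A w (S y)) - (z - w) • res A w (S y) := by
          rw [sub_smul]; abel
      _ = y := by rw [hy, h3]
  · intro x
    have hx := (isResolventAt_res hw).2 x
    set u := A x - w • (x : E) with hu
    have h3 : A x - z • (x : E) = (1 - (z - w) • res A w) u := by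
      simp only [sub_apply, one_apply_eq_self, smul_apply]
      rw [hx, hu, sub_smul]
      abel
    rw [h3, mul_apply_eq_comp, ← mul_apply_eq_comp S, h2, one_apply_eq_self, hx]

lemma mem_rho_of_isUnit {A : E →ₗ.[ℂ] E} {z w : ℂ} (hw : w ∈ rho A)
    (h : IsUnit (1 - (z - w) • res A w)) : z ∈ rho A := by
  obtain ⟨u, hu⟩ := h
  exact ⟨_, isResolventAt_of_inverse hw (S := ↑u⁻¹) (by rw [← hu, u.mul_inv])
    (by rw [← hu, u.inv_mul])⟩

lemma isResolventAt_apply_eigenvector {A : E →ₗ.[ℂ] E} {z w : ℂ} (hz : z ∈ rho A) (hw : w ∈ rho A)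
    {r : ℂ} {x : E} (hx : res A w x = r • x) :
    res A z x = (r / (1 - (z - w) * r)) • x ∧ (x ≠ 0 → 1 - (z - w) * r ≠ 0) := by
  have h := congrArg (fun T : E →L[ℂ] E => T x) (resolvent_mul_eq_one' hz hw)
  have h1 : (1 - (z - w) • res A w) x = (1 - (z - w) * r) • x := by
    simp [hx, sub_smul, mul_smul]
  simp only [mul_apply_eq_comp, h1, map_smul, one_apply_eq_self] at h
  rcases eq_or_ne x 0 with rfl | h0
  · simp
  have hne : 1 - (z - w) * r ≠ 0 := fun h' => h0 (by rw [← h, h', zero_smul])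
  refine ⟨?_, fun _ => hne⟩
  have h2 := congrArg (fun T : E →L[ℂ] E => T x) (resolvent_identity hw hz)
  simp only [add_apply, smul_apply, mul_apply_eq_comp, hx, map_smul] at h2
  have h3 : (1 - (z - w) * r) • res A z x = r • x := by
    rw [h2, sub_smul, one_smul, smul_smul, ← neg_sub z w]
    module
  rw [div_eq_inv_mul, mul_smul, ← h3, inv_smul_smul₀ hne]

lemma eq_zero_of_res_eq_zero {A : E →ₗ.[ℂ] E} {z : ℂ} (hz : z ∈ rho A) {x : E}
    (h : res A z x = 0) : x = 0 := by
  obtain ⟨hd, hy⟩ := (isResolventAt_res hz).1 x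
  have h3 : (⟨res A z x, hd⟩ : A.domain) = 0 := Subtype.ext h
  rw [h3, h, LinearPMap.map_zero, smul_zero, sub_zero] at hy
  exact hy.symm

lemma ker_le_map_eigenspace {A : E →ₗ.[ℂ] E} {w : ℂ} (hw : w ∈ rho A) {r : ℂ} (hr : r ≠ 0) :
    Module.End.eigenspace (res A w : E →ₗ[ℂ] E) r ≤
      (eigenspace A (w + r⁻¹)).map A.domain.subtype := by
  intro x hx
  have hx' : res A w x = r • x := Module.End.mem_eigenspace_iff.1 hx
  obtain ⟨hd, hy⟩ := (isResolventAt_res hw).1 (r⁻¹ • x)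
  have hxx : res A w (r⁻¹ • x) = x := by rw [map_smul, hx', inv_smul_smul₀ hr]
  rw [hxx] at hd
  refine ⟨⟨x, hd⟩, ?_, rfl⟩
  have hy' : A ⟨x, hd⟩ - w • x = r⁻¹ • x := by
    have : (⟨res A w (r⁻¹ • x), by rwa [hxx]⟩ : A.domain) = ⟨x, hd⟩ := Subtype.ext hxx
    rw [this, hxx] at hy
    exact hy
  change A ⟨x, hd⟩ - (w + r⁻¹) • x = 0
  rw [add_smul, ← hy']
  abel

end Resolvent

/-! ### Resolvents and Cayley transforms of self-adjoint operators -/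

section SelfAdjointResolvent

variable {E : Type*} [NormedAddCommGroup E] [InnerProductSpace ℂ E] [CompleteSpace E]
  {A : E →ₗ.[ℂ] E}

lemma inner_symm (hA : IsSelfAdjoint A) (x y : A.domain) :
    inner ℂ (A x) (y : E) = inner ℂ (x : E) (A y) := by
  have h := LinearPMap.adjoint_isFormalAdjoint hA.dense_domain
  rw [LinearPMap.isSelfAdjoint_def.1 hA] at h
  exact h x y

lemma star_res (hA : IsSelfAdjoint A) {z : ℂ} (hz : z ∈ rho A) (hz' : star z ∈ rho A) :
    star (res A z) = res A (star z) := by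
  rw [ContinuousLinearMap.star_eq_adjoint, eq_comm, ContinuousLinearMap.eq_adjoint_iff]
  intro x y
  obtain ⟨hx, hx'⟩ := (isResolventAt_res hz').1 x
  obtain ⟨hy, hy'⟩ := (isResolventAt_res hz).1 y
  have h := inner_symm hA ⟨_, hx⟩ ⟨_, hy⟩
  calc inner ℂ (res A (star z) x) y
      = inner ℂ (res A (star z) x) (A ⟨_, hy⟩ - z • res A z y) := by rw [hy']
    _ = inner ℂ (A ⟨_, hx⟩ - star z • res A (star z) x) (res A z y) := by
        rw [inner_sub_left, inner_sub_right, inner_smul_left, inner_smul_right, ← h]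
        simp
    _ = inner ℂ x (res A z y) := by rw [hx']

lemma isSelfAdjoint_res (hA : IsSelfAdjoint A) {l : ℝ} (hl : (l : ℂ) ∈ rho A) :
    IsSelfAdjoint (res A l) := by
  have h : star (l : ℂ) = l := Complex.conj_ofReal l
  have := star_res hA hl (by rwa [h])
  rwa [h] at this

/-- Besides the bound $|\operatorname{Im}z|^{-1}$ of the resolvent, this identity yields the Poisson
integral of a scalar spectral measure. -/
lemma im_inner_res (hA : IsSelfAdjoint A) {z : ℂ} (hz : z ∈ rho A) (x : E) :
    (inner ℂ x (res A z x)).im = z.im * ‖res A z x‖ ^ 2 := by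
  obtain ⟨hx, hx'⟩ := (isResolventAt_res hz).1 x
  have h := inner_symm hA ⟨_, hx⟩ ⟨_, hx⟩
  have h0 : (inner ℂ (A ⟨_, hx⟩) (res A z x)).im = 0 := by
    rw [← Complex.conj_eq_iff_im]
    have h2 := inner_conj_symm (𝕜 := ℂ) (A ⟨_, hx⟩) (res A z x)
    simp only at h
    rw [← h] at h2
    have h3 := inner_conj_symm (𝕜 := ℂ) (res A z x) (A ⟨_, hx⟩)
    rw [h3, ← h]
  nth_rw 1 [← hx']
  rw [inner_sub_left, inner_smul_left, Complex.sub_im, h0, inner_self_eq_norm_sq_to_K]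
  have key : ∀ a : ℝ, ((starRingEnd ℂ) z * (a : ℂ) ^ 2).im = -(z.im * a ^ 2) := fun a => by
    rw [← Complex.ofReal_pow, Complex.im_mul_ofReal, Complex.conj_im, neg_mul]
  rw [zero_sub]
  exact (congrArg Neg.neg (key _)).trans (neg_neg _)

lemma norm_res_le (hA : IsSelfAdjoint A) {z : ℂ} (hz : z ∈ rho A) (hz' : z.im ≠ 0) :
    ‖res A z‖ ≤ |z.im|⁻¹ := by
  refine ContinuousLinearMap.opNorm_le_bound _ (by positivity) fun x => ?_
  rcases eq_or_ne (res A z x) 0 with h0 | h0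
  · rw [h0, norm_zero]; positivity
  have h := im_inner_res hA hz x
  have h1 : |z.im| * ‖res A z x‖ ^ 2 ≤ ‖x‖ * ‖res A z x‖ := by
    have h2 := (Complex.abs_im_le_norm _).trans (norm_inner_le_norm (𝕜 := ℂ) x (res A z x))
    rwa [h, abs_mul, abs_of_nonneg (sq_nonneg ‖res A z x‖)] at h2
  have h3 : 0 < ‖res A z x‖ := norm_pos_iff.2 h0
  rw [inv_mul_eq_div, le_div_iff₀ (abs_pos.2 hz')]
  nlinarith

lemma isUnit_one_sub_smul {R : E →L[ℂ] E} (hR : IsSelfAdjoint R) {z : ℂ} (hz : z.im ≠ 0) :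
    IsUnit (1 - z • R) := by
  have hz0 : z ≠ 0 := by rintro rfl; simp at hz
  have h1 : z⁻¹ ∉ spectrum ℂ R := fun h => by
    have := hR.im_eq_zero_of_mem_spectrum h
    rw [Complex.inv_im] at this
    have h2 : Complex.normSq z ≠ 0 := by simpa using hz0
    field_simp at this
    exact hz (by linarith)
  rw [spectrum.notMem_iff] at h1
  have h2 := h1.smul (Units.mk0 z hz0)
  rwa [smul_sub, Units.smul_mk0, Units.smul_mk0, Algebra.algebraMap_eq_smul_one, smul_inv_smul₀ hz0] at h2

/-- A real point of the resolvent set reduces the claim to a bounded self-adjoint operator: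
$1-(z-l)(A-l)^{-1}$ is invertible because $(z-l)^{-1}$ is not real. -/
lemma mem_rho_of_im_ne_zero (hA : IsSelfAdjoint A) {l : ℝ} (hl : (l : ℂ) ∈ rho A) {z : ℂ}
    (hz : z.im ≠ 0) : z ∈ rho A :=
  mem_rho_of_isUnit hl (isUnit_one_sub_smul (isSelfAdjoint_res hA hl) (by simpa using hz))

/-- The Cayley transform `(A - z̄) (A - z)⁻¹`. -/
noncomputable def cayley (A : E →ₗ.[ℂ] E) (z : ℂ) : E →L[ℂ] E := 1 + (z - star z) • res A z

lemma star_cayley (hA : IsSelfAdjoint A) {z : ℂ} (hz : z ∈ rho A) (hz' : star z ∈ rho A) :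
    star (cayley A z) = 1 + (star z - z) • res A (star z) := by
  rw [cayley, star_add, star_one, star_smul, star_res hA hz hz', star_sub, star_star]

lemma cayley_mem_unitary (hA : IsSelfAdjoint A) {z : ℂ} (hz : z ∈ rho A) (hz' : star z ∈ rho A) :
    cayley A z ∈ unitary (E →L[ℂ] E) := by
  have h1 := resolvent_mul_eq_one hz hz'
  have h2 := resolvent_mul_eq_one' hz hz'
  rw [Unitary.mem_iff, star_cayley hA hz hz', ← neg_sub z, neg_smul, ← sub_eq_add_neg]
  exact ⟨h1, h2⟩

lemma M_eq (H : E →ₗ.[ℂ] E) (hA : IsSelfAdjoint A) {z : ℂ} (hz : z ∈ rho A)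
    (hz' : star z ∈ rho A) : M z H A = cayley H z * star (cayley A z) := by
  rw [star_cayley hA hz hz']; rfl

lemma continuousAt_res {l z : ℂ} (hl : l ∈ rho A) (hz : z ∈ rho A) : ContinuousAt (res A) z := by
  have hu := isUnit_one_sub_smul_res hz hl
  have hopen : ∀ᶠ w in 𝓝 z, IsUnit (1 - (w - l) • res A l) :=
    (by fun_prop : ContinuousAt (fun w : ℂ => 1 - (w - l) • res A l) z).eventually_mem
      (Units.isOpen.mem_nhds hu)
  have heq : res A =ᶠ[𝓝 z] fun w => res A l * Ring.inverse (1 - (w - l) • res A l) := by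
    filter_upwards [hopen] with w hw
    exact (isResolventAt_of_inverse hl (Ring.mul_inverse_cancel _ hw)
      (Ring.inverse_mul_cancel _ hw)).res_eq
  refine ContinuousAt.congr ?_ heq.symm
  obtain ⟨u, hu'⟩ := hu
  have h1 : ContinuousAt Ring.inverse (1 - (z - l) • res A l) := by
    rw [← hu']
    exact NormedRing.inverse_continuousAt u
  exact continuousAt_const.mul (ContinuousAt.comp (f := fun w : ℂ => 1 - (w - l) • res A l) h1
    (by fun_prop))

end SelfAdjointResolvent

/-! ### Spectral projections above a gap and compact perturbations -/

section UpperPart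

variable {E : Type*} [NormedAddCommGroup E] [InnerProductSpace ℂ E] [CompleteSpace E]

/-- `P` is the spectral projection of the bounded self-adjoint operator `R` for `[c, ∞)`, where
`(c - d, c + d)` does not meet the spectrum of `R`. -/
structure IsUpperProjection (R : E →L[ℂ] E) (c d : ℝ) (P : E →L[ℂ] E) : Prop where
  pos : 0 < d
  selfAdjoint : IsSelfAdjoint P
  mul_self : P * P = P
  comm : Commute R P
  lower : ∀ x, P x = x → (c + d) * ‖x‖ ^ 2 ≤ (inner ℂ (R x) x).re
  upper : ∀ x, P x = 0 → (inner ℂ (R x) x).re ≤ (c - d) * ‖x‖ ^ 2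

lemma re_inner_nonneg {T : E →L[ℂ] E} (hT : 0 ≤ T) (x : E) : 0 ≤ (inner ℂ (T x) x).re :=
  ((ContinuousLinearMap.nonneg_iff_isPositive T).1 hT).re_inner_nonneg_left x

/-- The indicator of $[c,\infty)$ is continuous on the spectrum because of the gap at `c`, so
continuous functional calculus provides the projection. If the spectrum above `c` is finite, the
indicator is a sum of indicators of isolated points, whose images consist of eigenvectors. -/
lemma exists_isUpperProjection {R : E →L[ℂ] E} (hR : IsSelfAdjoint R) {c : ℝ}
    (hc : c ∉ spectrum ℝ R) : ∃ P d, IsUpperProjection R c d P ∧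
      ((spectrum ℝ R ∩ Ici c).Finite → (∀ r ∈ spectrum ℝ R ∩ Ici c,
        FiniteDimensional ℂ (Module.End.eigenspace (R : E →ₗ[ℂ] E) (r : ℂ))) →
        FiniteDimensional ℂ (LinearMap.range (P : E →ₗ[ℂ] E))) := by
  classical
  obtain ⟨d, hd, hball⟩ := Metric.isOpen_iff.1 (spectrum.isClosed (𝕜 := ℝ) R).isOpen_compl c hc
  have hgap : ∀ x ∈ spectrum ℝ R, x ≤ c - d ∨ c + d ≤ x := by
    intro x hx
    by_contra! h
    refine hball (show x ∈ Metric.ball c d from ?_) hx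
    rw [Metric.mem_ball, Real.dist_eq, abs_lt]
    constructor <;> linarith
  set p : ℝ → ℝ := fun x => if c ≤ x then 1 else 0 with hp
  have hloc : ∀ x ∈ spectrum ℝ R, ∀ᶠ y in 𝓝[spectrum ℝ R] x, (c ≤ y ↔ c ≤ x) := by
    intro x hx
    rcases hgap x hx with h | h
    · filter_upwards [mem_nhdsWithin_of_mem_nhds (Iio_mem_nhds (show x < c by linarith))] with y hy
      rw [mem_Iio] at hy
      constructor <;> intro <;> linarith
    · filter_upwards [mem_nhdsWithin_of_mem_nhds (Ioi_mem_nhds (show c < x by linarith))] with y hy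
      rw [mem_Ioi] at hy
      constructor <;> intro <;> linarith
  have hpc : ContinuousOn p (spectrum ℝ R) := by
    intro x hx
    refine ContinuousWithinAt.congr_of_eventuallyEq (f := fun _ => p x)
      continuousWithinAt_const ?_ rfl
    filter_upwards [hloc x hx] with y hy
    simp only [hp, hy]
  have hid : ContinuousOn (fun x : ℝ => x) (spectrum ℝ R) := continuousOn_id
  have hcid : cfc (fun x : ℝ => x) R = R := cfc_id' ℝ R
  refine ⟨cfc p R, d, ⟨hd, cfc_predicate p R, ?_, ?_, ?_, ?_⟩, ?_⟩
  · rw [← cfc_mul p p R hpc hpc]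
    congr 1
    ext x
    simp only [hp]; split_ifs <;> simp
  · have := cfc_commute_cfc (fun x : ℝ => x) p R
    rwa [hcid] at this
  · intro x hx
    -- The quadratic form bound is the positivity of this function of `R`, tested on a vector fixed
    -- by the projection.
    have h0 : 0 ≤ cfc (fun t : ℝ => (t - (c + d)) * p t) R := by
      refine cfc_nonneg fun t ht => ?_
      simp only [hp]
      split_ifs with h
      · rcases hgap t ht with h1 | h1 <;> linarith
      · simp
    rw [cfc_mul (fun t : ℝ => t - (c + d)) p R (by fun_prop) hpc,
      cfc_sub (fun t : ℝ => t) (fun _ => c + d) R hid (by fun_prop), hcid, cfc_const (c + d) R] at h0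
    have h1 := re_inner_nonneg h0 x
    rw [mul_apply_eq_comp, hx, sub_apply, inner_sub_left, Complex.sub_re] at h1
    have h2 : (inner ℂ ((algebraMap ℝ (E →L[ℂ] E) (c + d)) x) x).re = (c + d) * ‖x‖ ^ 2 := by
      rw [Algebra.algebraMap_eq_smul_one, smul_apply, one_apply_eq_self, inner_smul_left_eq_smul,
        Complex.smul_re, smul_eq_mul, inner_self_eq_norm_sq_to_K]
      norm_cast
    linarith
  · intro x hx
    have h0 : 0 ≤ cfc (fun t : ℝ => ((c - d) - t) * (1 - p t)) R := by
      refine cfc_nonneg fun t ht => ?_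
      simp only [hp]
      split_ifs with h
      · simp
      · rcases hgap t ht with h1 | h1 <;> linarith
    rw [cfc_mul (fun t : ℝ => (c - d) - t) (fun t => 1 - p t) R (by fun_prop)
        (continuousOn_const.sub hpc),
      cfc_sub (fun _ => c - d) (fun t : ℝ => t) R (by fun_prop) hid, hcid, cfc_const (c - d) R,
      cfc_sub (fun _ => 1) p R (by fun_prop) hpc, cfc_const_one ℝ R] at h0
    have h1 := re_inner_nonneg h0 x
    have h3 : (1 - cfc p R) x = x := by rw [sub_apply, hx, one_apply_eq_self, sub_zero]
    rw [mul_apply_eq_comp, h3, sub_apply,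
      inner_sub_left, Complex.sub_re] at h1
    have h2 : (inner ℂ ((algebraMap ℝ (E →L[ℂ] E) (c - d)) x) x).re = (c - d) * ‖x‖ ^ 2 := by
      rw [Algebra.algebraMap_eq_smul_one, smul_apply, one_apply_eq_self, inner_smul_left_eq_smul,
        Complex.smul_re, smul_eq_mul, inner_self_eq_norm_sq_to_K]
      norm_cast
    linarith
  · intro hfin hker
    set F := hfin.toFinset with hF
    have hq : ∀ r ∈ F, ContinuousOn (fun x : ℝ => if x = r then (1 : ℝ) else 0)
        (spectrum ℝ R) := by
      intro r hr x hx
      refine ContinuousWithinAt.congr_of_eventuallyEq (f := fun _ => if x = r then (1 : ℝ) else 0)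
        continuousWithinAt_const ?_ rfl
      have hr' := hfin.mem_toFinset.1 hr
      have hcl : ∀ᶠ y in 𝓝[spectrum ℝ R] x, y ∉ (spectrum ℝ R ∩ Ici c) \ {x} :=
        mem_nhdsWithin_of_mem_nhds ((hfin.subset sdiff_subset).isClosed.isOpen_compl.mem_nhds
          fun h => h.2 rfl)
      filter_upwards [hloc x hx, hcl, self_mem_nhdsWithin] with y hy1 hy2 hy3
      by_cases hyx : y = x
      · rw [hyx]
      · have h1 : ¬ c ≤ y := fun h => hy2 ⟨⟨hy3, h⟩, hyx⟩
        have h2 : ¬ c ≤ x := fun h => h1 (hy1.2 h)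
        have e1 : y ≠ r := by rintro rfl; exact h1 hr'.2
        have e2 : x ≠ r := by rintro rfl; exact h2 hr'.2
        simp only [if_neg e1, if_neg e2]
    have hsum : cfc p R = ∑ r ∈ F, cfc (fun x : ℝ => if x = r then (1 : ℝ) else 0) R := by
      rw [← cfc_sum _ R F hq]
      refine cfc_congr fun x hx => ?_
      rw [Finset.sum_apply, Finset.sum_ite_eq]
      simp only [hp, hF, Set.Finite.mem_toFinset, mem_inter_iff, hx, true_and, mem_Ici]
    have hle : LinearMap.range ((cfc p R : E →L[ℂ] E) : E →ₗ[ℂ] E) ≤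
        F.sup fun r : ℝ => Module.End.eigenspace (R : E →ₗ[ℂ] E) (r : ℂ) := by
      rintro _ ⟨x, rfl⟩
      rw [hsum, ContinuousLinearMap.coe_coe, _root_.sum_apply]
      refine Submodule.sum_mem _ fun r hr => ?_
      refine Finset.le_sup (f := fun r : ℝ => Module.End.eigenspace (R : E →ₗ[ℂ] E) (r : ℂ)) hr ?_
      rw [Module.End.mem_eigenspace_iff]
      have h1 : R * cfc (fun x : ℝ => if x = r then (1 : ℝ) else 0) R =
          r • cfc (fun x : ℝ => if x = r then (1 : ℝ) else 0) R := by
        conv_lhs => rw [← hcid]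
        rw [hcid, ← cfc_smul r _ R (hq r hr)]
        nth_rw 1 [← hcid]
        rw [← cfc_mul _ _ R hid (hq r hr)]
        congr 1
        ext x
        by_cases h : x = r <;> simp [h]
      exact congrArg (fun T : E →L[ℂ] E => T x) h1
    have : ∀ r : F, FiniteDimensional ℂ (Module.End.eigenspace (R : E →ₗ[ℂ] E) ((r : ℝ) : ℂ)) :=
      fun r => hker r (hfin.mem_toFinset.1 r.2)
    have hfd : FiniteDimensional ℂ
        (F.sup fun r : ℝ => Module.End.eigenspace (R : E →ₗ[ℂ] E) (r : ℂ) : Submodule ℂ E) := by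
      rw [← Finset.sup_attach]
      exact Submodule.finite_finset_sup _ _
    exact Submodule.finiteDimensional_of_le hle

/-- Finiteness of the upper spectral projection is stable under compact perturbations. -/
lemma finiteDimensional_upperProjection {R R₀ P P₀ : E →L[ℂ] E} {c d d₀ : ℝ}
    (hP : IsUpperProjection R c d P) (hP₀ : IsUpperProjection R₀ c d₀ P₀)
    (hK : IsCompactOperator (R - R₀ : E →L[ℂ] E))
    (hfin : FiniteDimensional ℂ (LinearMap.range (P₀ : E →ₗ[ℂ] E))) :
    FiniteDimensional ℂ (LinearMap.range (P : E →ₗ[ℂ] E)) := by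
  set F := LinearMap.range (P : E →ₗ[ℂ] E)
  have hPF : ∀ x ∈ F, P x = x := by
    rintro _ ⟨y, rfl⟩
    exact congrArg (fun T : E →L[ℂ] E => T y) hP.mul_self
  -- On `V` the form of `R` is above `c` and that of `R₀` below `c`, so the compact difference is
  -- bounded below and `V` is finite dimensional. Modulo `V`, the range of `P` embeds into that of
  -- `P₀`.
  set V := F ⊓ LinearMap.ker (P₀ : E →ₗ[ℂ] E) with hV
  have hVfin : FiniteDimensional ℂ V := by
    refine finiteDimensional_of_compact_bounded_below hK V (d + d₀) (add_pos hP.pos hP₀.pos)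
      fun x hx => ?_
    have h1 := hP.lower x (hPF x hx.1)
    have h2 := hP₀.upper x hx.2
    have h3 : (d + d₀) * ‖x‖ ^ 2 ≤ ‖(R - R₀) x‖ * ‖x‖ := by
      calc (d + d₀) * ‖x‖ ^ 2 ≤ (inner ℂ ((R - R₀) x) x).re := by
            rw [sub_apply, inner_sub_left, Complex.sub_re]; linarith
        _ ≤ ‖inner ℂ ((R - R₀) x) x‖ := Complex.re_le_norm _
        _ ≤ _ := norm_inner_le_norm _ _
    rcases eq_or_ne x 0 with rfl | h0
    · simp
    have := norm_pos_iff.2 h0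
    nlinarith
  let T : F →ₗ[ℂ] LinearMap.range (P₀ : E →ₗ[ℂ] E) :=
    (P₀ : E →ₗ[ℂ] E).rangeRestrict ∘ₗ F.subtype
  have hker : FiniteDimensional ℂ (LinearMap.ker T) := by
    let g : LinearMap.ker T →ₗ[ℂ] V :=
      (F.subtype ∘ₗ (LinearMap.ker T).subtype).codRestrict V fun x =>
        ⟨x.1.2, congrArg Subtype.val (LinearMap.mem_ker.1 x.2)⟩
    refine FiniteDimensional.of_injective g fun x y h => ?_
    exact Subtype.ext (Subtype.ext (congrArg (fun v : V => (v : E)) h))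
  have hquot : FiniteDimensional ℂ (F ⧸ LinearMap.ker T) :=
    FiniteDimensional.of_injective (T.quotKerEquivRange.toLinearMap)
      T.quotKerEquivRange.injective
  exact Module.Finite.of_submodule_quotient (LinearMap.ker T)

/-- An orthonormal system of eigenvectors of `R` which carries the spectrum above `c`. -/
structure UpperSystem (R : E →L[ℂ] E) (c : ℝ) where
  n : ℕ
  vec : Fin n → E
  val : Fin n → ℝ
  gap : ℝ
  orthonormal : Orthonormal ℂ vec
  eigen : ∀ i, R (vec i) = (val i : ℂ) • vec i
  lt_val : ∀ i, c < val i
  gap_pos : 0 < gap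
  gap_le : gap ≤ c
  upper : ∀ x, (∀ i, inner ℂ (vec i) x = 0) → (inner ℂ (R x) x).re ≤ (c - gap) * ‖x‖ ^ 2

lemma IsUpperProjection.nonempty_upperSystem {R P : E →L[ℂ] E} (hR : IsSelfAdjoint R) {c d : ℝ}
    (hc : 0 < c) (hP : IsUpperProjection R c d P)
    [FiniteDimensional ℂ (LinearMap.range (P : E →ₗ[ℂ] E))] : Nonempty (UpperSystem R c) := by
  set F := LinearMap.range (P : E →ₗ[ℂ] E)
  have hPF : ∀ x ∈ F, P x = x := by
    rintro _ ⟨y, rfl⟩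
    exact congrArg (fun T : E →L[ℂ] E => T y) hP.mul_self
  have hinv : ∀ x ∈ F, (R : E →ₗ[ℂ] E) x ∈ F := by
    rintro _ ⟨y, rfl⟩
    exact ⟨R y, (congrArg (fun T : E →L[ℂ] E => T y) hP.comm.eq).symm⟩
  have hsymm : (R : E →ₗ[ℂ] E).IsSymmetric :=
    (ContinuousLinearMap.isSelfAdjoint_iff_isSymmetric).1 hR
  have hT := hsymm.restrict_invariant hinv
  set B := hT.eigenvectorBasis rfl with hB
  have heig : ∀ i, R (B i) = ((hT.eigenvalues rfl i : ℝ) : ℂ) • (B i : E) := fun i =>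
    congrArg Subtype.val (hT.apply_eigenvectorBasis rfl i)
  have horth : Orthonormal ℂ fun i => (B i : E) :=
    B.orthonormal.comp_linearIsometry F.subtypeₗᵢ
  -- The gap is cut down to at most `c` so that `c - gap` is nonnegative; the resolvent bound on the
  -- complement relies on this sign.
  refine ⟨⟨_, fun i => B i, hT.eigenvalues rfl, min d c, horth, heig, fun i => ?_,
    lt_min hP.pos hc, min_le_right _ _, fun x hx => ?_⟩⟩
  · have h := hP.lower (B i) (hPF _ (B i).2)
    rw [heig, inner_smul_left, inner_self_eq_norm_sq_to_K, horth.norm_eq_one] at h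
    have := hP.pos
    simp at h
    linarith
  · have hxF : x ∈ Fᗮ := by
      rw [Submodule.mem_orthogonal]
      intro y hy
      have h1 := B.sum_repr ⟨y, hy⟩
      have h2 : y = ∑ i, B.repr ⟨y, hy⟩ i • (B i : E) := by
        simpa using (congrArg Subtype.val h1).symm
      rw [h2, sum_inner]
      refine Finset.sum_eq_zero fun i _ => ?_
      rw [inner_smul_left, hx i, mul_zero]
    have hPx : P x = 0 := by
      rw [← inner_self_eq_zero (𝕜 := ℂ)]
      have h1 : inner ℂ (P (P x)) x = 0 := hxF _ ⟨P x, rfl⟩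
      rwa [← ContinuousLinearMap.adjoint_inner_right, ← ContinuousLinearMap.star_eq_adjoint,
        hP.selfAdjoint.star_eq] at h1
    refine (hP.upper x hPx).trans ?_
    have := min_le_left d c
    gcongr

end UpperPart

/-! ### Eigenvectors with eigenvalue between `l₁` and `l₂` -/

section UpperSystems

variable {E : Type*} [NormedAddCommGroup E] [InnerProductSpace ℂ E] [CompleteSpace E]
  {A : E →ₗ.[ℂ] E} {l₁ l₂ : ℝ}

/-- Spectral mapping for $t\mapsto(t-l_1)^{-1}$. It sends $(l_1,l_2]$ to $[(l_2-l_1)^{-1},\infty)$,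
so an interval question becomes one about the top of a bounded spectrum. -/
lemma mem_spectrum_res_iff (h₁ : (l₁ : ℂ) ∈ rho A) {r : ℝ} (hr : r ≠ 0) :
    r ∈ spectrum ℝ (res A l₁) ↔ ((l₁ + r⁻¹ : ℝ) : ℂ) ∈ sigma A := by
  have hrc : (r : ℂ) ≠ 0 := by exact_mod_cast hr
  have h1 : (r : ℝ) ∈ spectrum ℝ (res A l₁) ↔ (r : ℂ) ∈ spectrum ℂ (res A l₁) :=
    (spectrum.algebraMap_mem_iff ℂ).symm
  have h3 : (1 : E →L[ℂ] E) - ((((l₁ + r⁻¹ : ℝ) : ℂ)) - l₁) • res A l₁ =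
      ((Units.mk0 _ hrc)⁻¹ : ℂˣ) • (algebraMap ℂ (E →L[ℂ] E) r - res A l₁) := by
    rw [Units.smul_def, Algebra.algebraMap_eq_smul_one, smul_sub, smul_smul]
    push_cast
    simp [hrc]
  have h2 : ((l₁ + r⁻¹ : ℝ) : ℂ) ∈ rho A ↔
      IsUnit (algebraMap ℂ (E →L[ℂ] E) r - res A l₁) := by
    rw [← isUnit_smul_iff ((Units.mk0 _ hrc)⁻¹), ← h3]
    exact ⟨fun h => isUnit_one_sub_smul_res h h₁, fun h => mem_rho_of_isUnit h₁ h⟩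
  rw [h1, spectrum.mem_iff, sigma, mem_compl_iff, h2]

lemma notMem_spectrum_res (h₁ : (l₁ : ℂ) ∈ rho A) (h₂ : (l₂ : ℂ) ∈ rho A) (h : l₁ < l₂) :
    (l₂ - l₁)⁻¹ ∉ spectrum ℝ (res A l₁) := by
  have h0 : (l₂ - l₁)⁻¹ ≠ 0 := inv_ne_zero (sub_pos.2 h).ne'
  rw [mem_spectrum_res_iff h₁ h0, inv_inv, add_sub_cancel]
  exact fun h => h h₂

lemma finite_spectrum_res (h₁ : (l₁ : ℂ) ∈ rho A) (h : l₁ < l₂)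
    (hess : Icc l₁ l₂ ∩ sigmaEss A = ∅) :
    (spectrum ℝ (res A l₁) ∩ Ici (l₂ - l₁)⁻¹).Finite ∧
      ∀ r ∈ spectrum ℝ (res A l₁) ∩ Ici (l₂ - l₁)⁻¹,
        FiniteDimensional ℂ (Module.End.eigenspace (res A l₁ : E →ₗ[ℂ] E) (r : ℂ)) := by
  have hpos : 0 < (l₂ - l₁)⁻¹ := inv_pos.2 (sub_pos.2 h)
  have hmem : ∀ r ∈ Ici (l₂ - l₁)⁻¹, l₁ + r⁻¹ ∈ Icc l₁ l₂ := by
    intro r hr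
    have hr0 : 0 < r := hpos.trans_le hr
    have h2 : r⁻¹ ≤ l₂ - l₁ := inv_le_of_inv_le₀ (sub_pos.2 h) hr
    exact ⟨by have := inv_pos.2 hr0; linarith, by linarith⟩
  have hess' : ∀ t ∈ Icc l₁ l₂, t ∉ sigmaEss A := fun t ht ht' =>
    (hess ▸ (⟨ht, ht'⟩ : t ∈ Icc l₁ l₂ ∩ sigmaEss A) : t ∈ (∅ : Set ℝ))
  constructor
  · by_contra hinf
    have hinj : InjOn (fun r : ℝ => l₁ + r⁻¹) (spectrum ℝ (res A l₁) ∩ Ici (l₂ - l₁)⁻¹) :=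
      fun r _ s _ hrs => inv_injective (add_left_cancel hrs)
    have hinf' : ((fun r : ℝ => l₁ + r⁻¹) '' (spectrum ℝ (res A l₁) ∩ Ici (l₂ - l₁)⁻¹)).Infinite :=
      Set.Infinite.image hinj hinf
    have hsub : (fun r : ℝ => l₁ + r⁻¹) '' (spectrum ℝ (res A l₁) ∩ Ici (l₂ - l₁)⁻¹) ⊆
        Icc l₁ l₂ := by
      rintro _ ⟨r, hr, rfl⟩
      exact hmem r hr.2
    -- Infinitely many spectral points in the compact interval would accumulate there, at a point of
    -- the essential spectrum.
    obtain ⟨t, ht, hacc⟩ := hinf'.exists_accPt_of_subset_isCompact isCompact_Icc hsub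
    refine hess' t ht (Or.inl ?_)
    rw [accPt_iff_frequently] at hacc ⊢
    have hcont : Tendsto (fun s : ℝ => (s : ℂ)) (𝓝 t) (𝓝 (t : ℂ)) :=
      Complex.continuous_ofReal.tendsto t
    refine hcont.frequently (hacc.mono ?_)
    rintro _ ⟨hne, r, hr, rfl⟩
    refine ⟨fun h => hne (Complex.ofReal_injective h), ?_⟩
    exact (mem_spectrum_res_iff h₁ (hpos.trans_le hr.2).ne').1 hr.1
  · rintro r ⟨-, hr⟩
    have hr0 : (r : ℂ) ≠ 0 := by exact_mod_cast (hpos.trans_le hr).ne'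
    have h2 : FiniteDimensional ℂ (eigenspace A ((l₁ + r⁻¹ : ℝ) : ℂ)) :=
      by_contra fun hcon => hess' _ (hmem r hr) (Or.inr hcon)
    have h3 := ker_le_map_eigenspace h₁ hr0
    rw [show (l₁ : ℂ) + (r : ℂ)⁻¹ = ((l₁ + r⁻¹ : ℝ) : ℂ) by push_cast; rfl] at h3
    exact Submodule.finiteDimensional_of_le h3

/-- The essential spectrum is used only for `H₀`. Finiteness for `H` follows from the compactness of
the resolvent difference at `l₁`, without identifying the essential spectrum of `H`. -/
lemma exists_upperSystems {H H₀ : E →ₗ.[ℂ] E} (hH : IsSelfAdjoint H) (hH₀ : IsSelfAdjoint H₀)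
    (h : l₁ < l₂) (h₁ : (l₁ : ℂ) ∈ rho H ∩ rho H₀) (h₂ : (l₂ : ℂ) ∈ rho H ∩ rho H₀)
    (hK : IsCompactOperator (res H l₁ - res H₀ l₁ : E →L[ℂ] E))
    (hess : Icc l₁ l₂ ∩ sigmaEss H₀ = ∅) :
    Nonempty (UpperSystem (res H l₁) (l₂ - l₁)⁻¹) ∧
      Nonempty (UpperSystem (res H₀ l₁) (l₂ - l₁)⁻¹) := by
  have hpos : 0 < (l₂ - l₁)⁻¹ := inv_pos.2 (sub_pos.2 h)
  obtain ⟨P₀, d₀, hP₀, hfin₀⟩ := exists_isUpperProjection (isSelfAdjoint_res hH₀ h₁.2)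
    (notMem_spectrum_res h₁.2 h₂.2 h)
  obtain ⟨P, d, hP, -⟩ := exists_isUpperProjection (isSelfAdjoint_res hH h₁.1)
    (notMem_spectrum_res h₁.1 h₂.1 h)
  obtain ⟨hf, hf'⟩ := finite_spectrum_res h₁.2 h hess
  have i1 := hfin₀ hf hf'
  have i2 := finiteDimensional_upperProjection hP hP₀ hK i1
  exact ⟨hP.nonempty_upperSystem (isSelfAdjoint_res hH h₁.1) hpos,
    hP₀.nonempty_upperSystem (isSelfAdjoint_res hH₀ h₁.2) hpos⟩

namespace UpperSystem

variable (S : UpperSystem (res A l₁) (l₂ - l₁)⁻¹)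

/-- The eigenvalues of `A` in `(l₁, l₂)`. -/
noncomputable def pt (i : Fin S.n) : ℝ := l₁ + (S.val i)⁻¹

lemma lt (S : UpperSystem (res A l₁) (l₂ - l₁)⁻¹) : l₁ < l₂ :=
  sub_pos.1 (inv_pos.1 (S.gap_pos.trans_le S.gap_le))

lemma val_pos (i : Fin S.n) : 0 < S.val i := (S.gap_pos.trans_le S.gap_le).trans (S.lt_val i)

lemma pt_mem (i : Fin S.n) : S.pt i ∈ Ioo l₁ l₂ := by
  have h := sub_pos.2 S.lt
  have h2 : (S.val i)⁻¹ < l₂ - l₁ := inv_lt_of_inv_lt₀ h (S.lt_val i)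
  have h3 := inv_pos.2 (S.val_pos i)
  exact ⟨by rw [pt]; linarith, by rw [pt]; linarith⟩

lemma res_vec (h₁ : (l₁ : ℂ) ∈ rho A) {z : ℂ} (hz : z ∈ rho A) (i : Fin S.n) :
    res A z (S.vec i) = ((S.pt i : ℂ) - z)⁻¹ • S.vec i := by
  obtain ⟨h, hne⟩ := isResolventAt_apply_eigenvector hz h₁ (S.eigen i)
  have h0 : (S.val i : ℂ) ≠ 0 := by exact_mod_cast (S.val_pos i).ne'
  rw [h]
  congr 1
  have h3 : (S.pt i : ℂ) - z = (1 - (z - l₁) * S.val i) / S.val i := by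
    rw [pt]; push_cast; field_simp; ring
  rw [h3, inv_div]

lemma inner_res_eq_zero (hA : IsSelfAdjoint A) (h₁ : (l₁ : ℂ) ∈ rho A) {z : ℂ} (hz : z.im ≠ 0)
    {x : E} (hx : ∀ i, inner ℂ (S.vec i) x = 0) (i : Fin S.n) :
    inner ℂ (S.vec i) (res A z x) = 0 := by
  have hz' : (star z).im ≠ 0 := by simpa using hz
  rw [← ContinuousLinearMap.adjoint_inner_left, ← ContinuousLinearMap.star_eq_adjoint,
    star_res hA (mem_rho_of_im_ne_zero hA h₁ hz) (mem_rho_of_im_ne_zero hA h₁ hz'),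
    S.res_vec h₁ (mem_rho_of_im_ne_zero hA h₁ hz'), inner_smul_left, hx, mul_zero]

/-- A bound of the resolvent on the orthogonal complement of the system, up to `[l₁, l₂]`. -/
noncomputable def bound : ℝ := ‖res A l₁‖ / ((l₂ - l₁) * S.gap)

lemma bound_nonneg : 0 ≤ S.bound := by
  have := S.gap_pos
  have := sub_pos.2 S.lt
  rw [bound]; positivity

/-- With $R=(A-l_1)^{-1}$ and $w=(A-l_1)(A-z)^{-1}x$ one has $x=w-(z-l_1)Rw$. Since $w$ is
orthogonal to the system, $\langle Rw,w\rangle\le((l_2-l_1)^{-1}-\mathrm{gap})\|w\|^2$, and the real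
part of $\langle x,w\rangle$ bounds $\|w\|$ by $\|x\|$ uniformly in $\operatorname{Im}z$. -/
lemma norm_res_le_bound (hA : IsSelfAdjoint A) (h₁ : (l₁ : ℂ) ∈ rho A) {z : ℂ} (hz : z.im ≠ 0)
    (hre : z.re ∈ Icc l₁ l₂) {x : E} (hx : ∀ i, inner ℂ (S.vec i) x = 0) :
    ‖res A z x‖ ≤ S.bound * ‖x‖ := by
  have hzr := mem_rho_of_im_ne_zero hA h₁ hz
  set w := x + (z - l₁) • res A z x with hw
  have hwx : w - (z - l₁) • res A l₁ w = x := by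
    have := congrArg (fun T : E →L[ℂ] E => T x) (resolvent_mul_eq_one hzr h₁)
    simpa [hw] using this
  have hRw : res A l₁ w = res A z x := by
    have := congrArg (fun T : E →L[ℂ] E => T x) (resolvent_identity hzr h₁)
    simpa [hw] using this.symm
  have hwv : ∀ i, inner ℂ (S.vec i) w = 0 := fun i => by
    rw [hw, inner_add_right, inner_smul_right, hx, S.inner_res_eq_zero hA h₁ hz hx, mul_zero,
      add_zero]
  have hup := S.upper w hwv
  have him : (inner ℂ (res A l₁ w) w).im = 0 := by
    have hsymm := (ContinuousLinearMap.isSelfAdjoint_iff_isSymmetric).1 (isSelfAdjoint_res hA h₁)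
    exact (Complex.conj_eq_iff_im).1 ((inner_conj_symm _ _).trans (hsymm w w).symm)
  have hlt := sub_pos.2 S.lt
  have hκ : 0 < (l₂ - l₁) * S.gap := mul_pos hlt S.gap_pos
  have hkey : (l₂ - l₁) * S.gap * ‖w‖ ^ 2 ≤ ‖x‖ * ‖w‖ := by
    have h1 : (inner ℂ x w).re = ‖w‖ ^ 2 - (z.re - l₁) * (inner ℂ (res A l₁ w) w).re := by
      conv_lhs => rw [← hwx]
      rw [inner_sub_left, inner_smul_left, Complex.sub_re, Complex.mul_re, him, mul_zero, sub_zero,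
        inner_self_eq_norm_sq_to_K]
      simp only [Complex.conj_re, Complex.sub_re, Complex.ofReal_re]
      congr 1
      norm_cast
    have h2 : (inner ℂ x w).re ≤ ‖x‖ * ‖w‖ :=
      (Complex.re_le_norm _).trans (norm_inner_le_norm _ _)
    have h3 : (z.re - l₁) * (inner ℂ (res A l₁ w) w).re ≤ (l₂ - l₁) * (((l₂ - l₁)⁻¹ - S.gap) * ‖w‖ ^ 2) := by
      have h4 : 0 ≤ ((l₂ - l₁)⁻¹ - S.gap) * ‖w‖ ^ 2 :=
        mul_nonneg (sub_nonneg.2 S.gap_le) (sq_nonneg _)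
      calc _ ≤ (z.re - l₁) * (((l₂ - l₁)⁻¹ - S.gap) * ‖w‖ ^ 2) :=
            mul_le_mul_of_nonneg_left hup (by linarith [hre.1])
        _ ≤ _ := mul_le_mul_of_nonneg_right (by linarith [hre.2]) h4
    have h5 : (l₂ - l₁) * (((l₂ - l₁)⁻¹ - S.gap) * ‖w‖ ^ 2) =
        ‖w‖ ^ 2 - (l₂ - l₁) * S.gap * ‖w‖ ^ 2 := by
      field_simp
    linarith
  have hw' : (l₂ - l₁) * S.gap * ‖w‖ ≤ ‖x‖ := by
    rcases eq_or_ne w 0 with h0 | h0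
    · rw [h0]; simp
    · have := norm_pos_iff.2 h0
      nlinarith
  rw [← hRw, bound, div_mul_eq_mul_div, le_div_iff₀ hκ]
  calc ‖res A l₁ w‖ * ((l₂ - l₁) * S.gap) ≤ ‖res A l₁‖ * ‖w‖ * ((l₂ - l₁) * S.gap) := by
        gcongr; exact (res A l₁).le_opNorm w
    _ = ‖res A l₁‖ * ((l₂ - l₁) * S.gap * ‖w‖) := by ring
    _ ≤ ‖res A l₁‖ * ‖x‖ := by gcongr

end UpperSystem
end UpperSystems

/-! ### Mass estimates and Poisson sums -/

section MeasureLemmas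

/-- A measure which gives mass `O(y²)` to intervals of radius `y` centred in `[a, b]` does not
charge `[a, b]`. -/
lemma measure_Icc_eq_zero {m : Measure ℝ} [IsFiniteMeasure m] {a b K : ℝ}
    (h : ∀ s ∈ Icc a b, ∀ y > 0, m.real (Icc (s - y) (s + y)) ≤ K * y ^ 2) :
    m (Icc a b) = 0 := by
  rcases lt_or_ge b a with hab | hab
  · simp [Icc_eq_empty_of_lt hab]
  have hm : m.real (Icc a b) ≤ 0 := by
    have hle : ∀ n : ℕ, m.real (Icc a b) ≤
        ((n : ℝ) + 1 + 1) * (K * ((b - a + 1) / ((n : ℝ) + 1)) ^ 2) := by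
      intro n
      have hn : (0 : ℝ) < n + 1 := by positivity
      set y := (b - a + 1) / ((n : ℝ) + 1) with hy
      have hy0 : 0 < y := by rw [hy]; apply div_pos <;> linarith
      -- About `n` intervals of radius of order `1 / n` and mass of order `1 / n²` cover, so the
      -- total is of order `1 / n`. The minimum with `b` keeps the centres in the interval where the
      -- hypothesis applies.
      have hsub : Icc a b ⊆ ⋃ k ∈ Finset.range (n + 2), Icc (min (a + k * y) b - y) (min (a + k * y) b + y) := by
        intro t ht
        have hta : 0 ≤ (t - a) / y := div_nonneg (by linarith [ht.1]) hy0.le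
        have h1 := Nat.floor_le hta
        have h2 := Nat.lt_floor_add_one ((t - a) / y)
        rw [le_div_iff₀ hy0] at h1
        rw [div_lt_iff₀ hy0] at h2
        simp only [mem_iUnion, Finset.mem_range, mem_Icc]
        refine ⟨⌊(t - a) / y⌋₊, ?_, ?_⟩
        · have h3 : (t - a) / y ≤ n + 1 := by
            rw [div_le_iff₀ hy0, hy, mul_div_cancel₀ _ hn.ne']
            linarith [ht.2]
          have : ⌊(t - a) / y⌋₊ ≤ n + 1 := by
            refine Nat.floor_le_of_le ?_
            push_cast; exact h3
          omega
        · rw [min_eq_left (by linarith [ht.2])]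
          constructor <;> linarith
      calc m.real (Icc a b) ≤ m.real (⋃ k ∈ Finset.range (n + 2),
            Icc (min (a + k * y) b - y) (min (a + k * y) b + y)) := measureReal_mono hsub (measure_ne_top _ _)
        _ ≤ ∑ k ∈ Finset.range (n + 2),
            m.real (Icc (min (a + k * y) b - y) (min (a + k * y) b + y)) :=
          measureReal_biUnion_finset_le _ _
        _ ≤ ∑ k ∈ Finset.range (n + 2), K * y ^ 2 := by
          refine Finset.sum_le_sum fun k _ => h _ ⟨le_min ?_ hab, min_le_right _ _⟩ y hy0
          have : (0 : ℝ) ≤ k * y := by positivity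
          linarith
        _ = ((n : ℝ) + 1 + 1) * (K * y ^ 2) := by
          rw [Finset.sum_const, Finset.card_range, nsmul_eq_mul]
          push_cast; ring
    have hlim : Tendsto (fun n : ℕ => ((n : ℝ) + 1 + 1) * (K * ((b - a + 1) / ((n : ℝ) + 1)) ^ 2))
        atTop (𝓝 ((1 + 0) * (K * (b - a + 1) ^ 2 * 0))) := by
      have h0 := tendsto_one_div_add_atTop_nhds_zero_nat (𝕜 := ℝ)
      refine (((tendsto_const_nhds (x := (1 : ℝ))).add h0).mul
        (h0.const_mul (K * (b - a + 1) ^ 2))).congr fun n => ?_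
      have hn : (n : ℝ) + 1 ≠ 0 := by positivity
      field_simp
    have := ge_of_tendsto' hlim hle
    simpa using this
  have h0 : m.real (Icc a b) = 0 := le_antisymm hm measureReal_nonneg
  exact (measureReal_eq_zero_iff).1 h0

/-- A finite sum of real multiples of `1 / |t - z|²` which stays bounded near each `t` is trivial. -/
lemma coeff_eq_zero_of_bounded {T : Finset ℝ} {a : ℝ → ℝ} {t₀ : ℝ} (ht₀ : t₀ ∈ T) {C : ℝ}
    (h : ∀ y > 0, |∑ t ∈ T, a t / ((t - t₀) ^ 2 + y ^ 2)| ≤ C) : a t₀ = 0 := by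
  have h1 : Tendsto (fun y : ℝ => ∑ t ∈ T, y ^ 2 * (a t / ((t - t₀) ^ 2 + y ^ 2))) (𝓝[>] 0)
      (𝓝 (∑ t ∈ T, if t = t₀ then a t else 0)) := by
    refine tendsto_finsetSum _ fun t _ => ?_
    split_ifs with h0
    · refine tendsto_const_nhds.congr' ?_
      filter_upwards [self_mem_nhdsWithin] with y hy
      have : y ≠ 0 := (mem_Ioi.1 hy).ne'
      rw [h0]; field_simp; simp
    · have hne : (t - t₀) ^ 2 + (0 : ℝ) ^ 2 ≠ 0 := by
        have := sub_ne_zero.2 h0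
        positivity
      have : ContinuousAt (fun y : ℝ => y ^ 2 * (a t / ((t - t₀) ^ 2 + y ^ 2))) 0 := by
        refine ContinuousAt.mul (by fun_prop) (ContinuousAt.div₀ (by fun_prop) (by fun_prop) hne)
      have h2 := this.tendsto
      simp only [ne_eq, OfNat.ofNat_ne_zero, not_false_eq_true, zero_pow, zero_mul] at h2
      exact h2.mono_left nhdsWithin_le_nhds
  have h2 : Tendsto (fun y : ℝ => ∑ t ∈ T, y ^ 2 * (a t / ((t - t₀) ^ 2 + y ^ 2))) (𝓝[>] 0)
      (𝓝 0) := by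
    have hz : Tendsto (fun y : ℝ => C * y ^ 2) (𝓝[>] 0) (𝓝 0) := by
      have : ContinuousAt (fun y : ℝ => C * y ^ 2) 0 := by fun_prop
      have := this.tendsto
      simp only [ne_eq, OfNat.ofNat_ne_zero, not_false_eq_true, zero_pow, mul_zero] at this
      exact this.mono_left nhdsWithin_le_nhds
    refine squeeze_zero_norm' ?_ hz
    filter_upwards [self_mem_nhdsWithin] with y hy
    rw [← Finset.mul_sum, Real.norm_eq_abs, abs_mul, abs_of_nonneg (sq_nonneg y), mul_comm]
    exact mul_le_mul_of_nonneg_right (h y hy) (sq_nonneg y)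
  have := tendsto_nhds_unique h1 h2
  simpa [Finset.sum_ite_eq', ht₀] using this

end MeasureLemmas

/-! ### Spectral subspaces of self-adjoint operators -/

section RanE

variable {E : Type*} [NormedAddCommGroup E] [InnerProductSpace ℂ E] [CompleteSpace E]
  {A : E →ₗ.[ℂ] E} {l₁ l₂ : ℝ}

lemma im_inv_sub (t s y : ℝ) :
    (((t : ℂ) - (s + y * Complex.I))⁻¹).im = y / ((t - s) ^ 2 + y ^ 2) := by
  rw [Complex.inv_im, Complex.normSq_apply]
  simp
  ring_nf

lemma integral_poisson (hA : IsSelfAdjoint A) (h₁ : (l₁ : ℂ) ∈ rho A) {x : E} {m : Measure ℝ}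
    (hm : IsScalarSpectralMeasure A x m) (s : ℝ) {y : ℝ} (hy : 0 < y) :
    Integrable (fun t : ℝ => 1 / ((t - s) ^ 2 + y ^ 2)) m ∧
    ∫ t : ℝ, 1 / ((t - s) ^ 2 + y ^ 2) ∂m = ‖res A (s + y * Complex.I) x‖ ^ 2 := by
  have := hm.1
  set z : ℂ := s + y * Complex.I with hz
  have him : z.im = y := by simp [hz]
  have hz0 : z.im ≠ 0 := by rw [him]; exact hy.ne'
  have hint : Integrable (fun t : ℝ => ((t : ℂ) - z)⁻¹) m := by
    refine Integrable.of_bound (C := y⁻¹) ?_ (Eventually.of_forall fun t => ?_)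
    · exact (by fun_prop : Measurable fun t : ℝ => ((t : ℂ) - z)⁻¹).aestronglyMeasurable
    · rw [norm_inv]
      refine inv_anti₀ hy ?_
      calc y = |((t : ℂ) - z).im| := by simp [him, abs_of_pos hy]
        _ ≤ _ := Complex.abs_im_le_norm _
  have h1 := im_inner_res hA (mem_rho_of_im_ne_zero hA h₁ hz0) x
  rw [hm.2 z hz0, him] at h1
  have hfun : (fun t : ℝ => 1 / ((t - s) ^ 2 + y ^ 2)) = fun t : ℝ => y⁻¹ * (((t : ℂ) - z)⁻¹).im := by
    ext t
    rw [hz, im_inv_sub]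
    field_simp
  have h2 : (∫ t : ℝ, ((t : ℂ) - z)⁻¹ ∂m).im = ∫ t : ℝ, (((t : ℂ) - z)⁻¹).im ∂m := by
    have := integral_im (𝕜 := ℂ) hint
    exact this.symm
  constructor
  · rw [hfun]
    exact hint.im.const_mul _
  · rw [hfun, integral_const_mul, ← h2, h1, inv_mul_cancel_left₀ hy.ne']

lemma measureReal_le_of_poisson {m : Measure ℝ} [IsFiniteMeasure m] {s y K : ℝ} (hy : 0 < y)
    (hint : Integrable (fun t : ℝ => 1 / ((t - s) ^ 2 + y ^ 2)) m)
    (h : ∫ t : ℝ, 1 / ((t - s) ^ 2 + y ^ 2) ∂m ≤ K) :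
    m.real (Icc (s - y) (s + y)) ≤ 2 * K * y ^ 2 := by
  have h1 : ∫ t : ℝ, (Icc (s - y) (s + y)).indicator (fun _ => 1 / (2 * y ^ 2)) t ∂m ≤ K := by
    refine (integral_mono ?_ hint fun t => ?_).trans h
    · exact (integrable_const _).indicator measurableSet_Icc
    · by_cases ht : t ∈ Icc (s - y) (s + y)
      · rw [indicator_of_mem ht]
        have : (t - s) ^ 2 ≤ y ^ 2 := sq_le_sq' (by linarith [ht.1]) (by linarith [ht.2])
        exact one_div_le_one_div_of_le (by positivity) (by linarith)
      · rw [indicator_of_notMem ht]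
        positivity
  rw [integral_indicator measurableSet_Icc, setIntegral_const, smul_eq_mul] at h1
  rw [mul_one_div, div_le_iff₀ (by positivity)] at h1
  linarith

namespace UpperSystem

variable (S : UpperSystem (res A l₁) (l₂ - l₁)⁻¹)

lemma norm_sq_res (hA : IsSelfAdjoint A) (h₁ : (l₁ : ℂ) ∈ rho A) {z : ℂ} (hz : z.im ≠ 0)
    (c : Fin S.n → ℂ) {x : E} (hx : ∀ i, inner ℂ (S.vec i) x = 0) :
    ‖res A z (∑ i, c i • S.vec i + x)‖ ^ 2 =
      ∑ i, ‖c i‖ ^ 2 / ‖(S.pt i : ℂ) - z‖ ^ 2 + ‖res A z x‖ ^ 2 := by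
  have hzr := mem_rho_of_im_ne_zero hA h₁ hz
  have h1 : res A z (∑ i, c i • S.vec i) = ∑ i, (c i * ((S.pt i : ℂ) - z)⁻¹) • S.vec i := by
    rw [map_sum]
    refine Finset.sum_congr rfl fun i _ => ?_
    rw [map_smul, S.res_vec h₁ hzr, smul_smul]
  have h2 : inner ℂ (∑ i, (c i * ((S.pt i : ℂ) - z)⁻¹) • S.vec i) (res A z x) = 0 := by
    rw [sum_inner]
    refine Finset.sum_eq_zero fun i _ => ?_
    rw [inner_smul_left, S.inner_res_eq_zero hA h₁ hz hx, mul_zero]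
  rw [map_add, h1, sq, norm_add_sq_eq_norm_sq_add_norm_sq_of_inner_eq_zero _ _ h2, ← sq, ← sq]
  congr 1
  have h3 := S.orthonormal.inner_sum (fun i => c i * ((S.pt i : ℂ) - z)⁻¹)
    (fun i => c i * ((S.pt i : ℂ) - z)⁻¹) Finset.univ
  rw [inner_self_eq_norm_sq_to_K] at h3
  have h4 : ∀ w : ℂ, (starRingEnd ℂ) w * w = ((‖w‖ ^ 2 : ℝ) : ℂ) := fun w => by
    rw [Complex.conj_mul']; push_cast; rfl
  simp only [h4] at h3
  have h5 : ‖∑ i, (c i * ((S.pt i : ℂ) - z)⁻¹) • S.vec i‖ ^ 2 =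
      ∑ i, ‖c i * ((S.pt i : ℂ) - z)⁻¹‖ ^ 2  :=
    Complex.ofReal_injective (by push_cast at h3 ⊢; exact h3)
  rw [h5]
  refine Finset.sum_congr rfl fun i _ => ?_
  rw [norm_mul, norm_inv, mul_pow, inv_pow, div_eq_mul_inv]

lemma sq_norm_pt_sub (i : Fin S.n) (s y : ℝ) :
    ‖(S.pt i : ℂ) - (s + y * Complex.I)‖ ^ 2 = (S.pt i - s) ^ 2 + y ^ 2 := by
  rw [← Complex.normSq_eq_norm_sq, Complex.normSq_apply]
  simp
  ring

lemma exists_decomp (x : E) : ∃ (c : Fin S.n → ℂ) (x' : E), x = ∑ i, c i • S.vec i + x' ∧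
    ∀ i, inner ℂ (S.vec i) x' = 0 := by
  refine ⟨fun i => inner ℂ (S.vec i) x, x - ∑ i, (inner ℂ (S.vec i) x) • S.vec i, by abel,
    fun i => ?_⟩
  rw [inner_sub_right, S.orthonormal.inner_right_fintype, sub_self]

/-- The Poisson integral of $m$ is $\|(A-s-iy)^{-1}x\|^2$, and the part $x'$ of $x$ orthogonal to
the system contributes a bounded amount for $s\in[l_1,l_2]$. Hence $m$ is carried by the
eigenvalues, and comparing the singularities there leaves nothing for $x'$. -/
lemma mem_span_of_measure (hA : IsSelfAdjoint A) (h₁ : (l₁ : ℂ) ∈ rho A) {x : E} {m : Measure ℝ}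
    (hm : IsScalarSpectralMeasure A x m) (hmI : m (Ico l₁ l₂)ᶜ = 0) :
    x ∈ Submodule.span ℂ (range S.vec) := by
  classical
  have := hm.1
  obtain ⟨c, x', rfl, hx'⟩ := S.exists_decomp x
  set C := (S.bound * ‖x'‖) ^ 2 with hC
  have hres : ∀ s ∈ Icc l₁ l₂, ∀ y : ℝ, 0 < y → ‖res A (s + y * Complex.I) x'‖ ^ 2 ≤ C := by
    intro s hs y hy
    refine pow_le_pow_left₀ (norm_nonneg _) (S.norm_res_le_bound hA h₁ ?_ ?_ hx') 2
    · simpa using hy.ne'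
    · simpa using hs
  have hI : ∀ s y : ℝ, 0 < y → ∫ t : ℝ, 1 / ((t - s) ^ 2 + y ^ 2) ∂m =
      ∑ i, ‖c i‖ ^ 2 / ((S.pt i - s) ^ 2 + y ^ 2) + ‖res A (s + y * Complex.I) x'‖ ^ 2 := by
    intro s y hy
    rw [(integral_poisson hA h₁ hm s hy).2, S.norm_sq_res hA h₁ (by simpa using hy.ne') c hx']
    simp only [S.sq_norm_pt_sub]
  set T : Finset ℝ := Finset.univ.image S.pt with hT
  -- Away from the eigenvalues the Poisson integral is bounded, so intervals of radius `y` have mass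
  -- of order `y²` and the measure vanishes locally.
  have hloc : ∀ s ∈ Icc l₁ l₂ \ (T : Set ℝ), ∃ u ∈ 𝓝[Icc l₁ l₂ \ (T : Set ℝ)] s, m u = 0 := by
    intro s hs
    obtain ⟨e, he, hball⟩ := Metric.isOpen_iff.1
      (T.finite_toSet.isClosed.isOpen_compl) s hs.2
    have hfar : ∀ i, e ≤ |S.pt i - s| := by
      intro i
      by_contra! hlt
      exact hball (show S.pt i ∈ Metric.ball s e by rwa [Metric.mem_ball, Real.dist_eq])
        (Finset.mem_coe.2 (Finset.mem_image_of_mem _ (Finset.mem_univ i)))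
    refine ⟨Icc (max l₁ (s - e / 2)) (min l₂ (s + e / 2)), ?_, ?_⟩
    · refine mem_nhdsWithin.2 ⟨Ioo (s - e / 2) (s + e / 2), isOpen_Ioo,
        ⟨by linarith, by linarith⟩, ?_⟩
      rintro t ⟨ht, ht'⟩
      exact ⟨max_le ht'.1.1 ht.1.le, le_min ht'.1.2 ht.2.le⟩
    · refine measure_Icc_eq_zero (K := 2 * (∑ i, ‖c i‖ ^ 2 / (e / 2) ^ 2 + C))
        fun s' hs' y hy => ?_
      refine measureReal_le_of_poisson hy (integral_poisson hA h₁ hm s' hy).1 ?_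
      rw [hI s' y hy]
      have hs1 := le_trans (le_max_left _ _) hs'.1
      have hs2 := le_trans (le_max_right _ _) hs'.1
      have hs3 := le_trans hs'.2 (min_le_left _ _)
      have hs4 := le_trans hs'.2 (min_le_right _ _)
      refine add_le_add (Finset.sum_le_sum fun i _ => ?_) (hres s' ⟨hs1, hs3⟩ y hy)
      have h1 : e / 2 ≤ |S.pt i - s'| := by
        have h2 := hfar i
        have h3 : |S.pt i - s| ≤ |S.pt i - s'| + |s' - s| := abs_sub_le _ _ _
        have h4 : |s' - s| ≤ e / 2 := abs_le.2 ⟨by linarith, by linarith⟩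
        linarith
      have h5 : (e / 2) ^ 2 ≤ (S.pt i - s') ^ 2 := by
        rw [← sq_abs (S.pt i - s')]
        exact pow_le_pow_left₀ (by linarith) h1 2
      have h6 : (e / 2) ^ 2 ≤ (S.pt i - s') ^ 2 + y ^ 2 := by nlinarith [sq_nonneg y]
      exact div_le_div_of_nonneg_left (sq_nonneg _) (by positivity) h6
  have hmT : m (T : Set ℝ)ᶜ = 0 := by
    have h1 := measure_null_of_locally_null _ hloc
    refine measure_mono_null (t := (Ico l₁ l₂)ᶜ ∪ (Icc l₁ l₂ \ (T : Set ℝ))) (fun t ht => ?_)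
      (measure_union_null hmI h1)
    by_cases h : t ∈ Ico l₁ l₂
    · exact Or.inr ⟨Ico_subset_Icc_self h, ht⟩
    · exact Or.inl h
  have hIT : ∀ s y : ℝ, 0 < y → ∫ t : ℝ, 1 / ((t - s) ^ 2 + y ^ 2) ∂m =
      ∑ t ∈ T, m.real {t} * (1 / ((t - s) ^ 2 + y ^ 2)) := by
    intro s y hy
    have hres : m.restrict (T : Set ℝ) = m := Measure.restrict_eq_self_of_ae_mem (by
      rw [ae_iff]; exact hmT)
    have h1 := setIntegral_finset T (μ := m) (f := fun t : ℝ => 1 / ((t - s) ^ 2 + y ^ 2))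
      (integral_poisson hA h₁ hm s hy).1.integrableOn
    rw [hres] at h1
    simpa only [smul_eq_mul] using h1
  -- The excess of the atom at `t` over what the system accounts for. Its Poisson sum equals
  -- $\|(A-s-iy)^{-1}x'\|^2$, which has no singularity, so every excess is zero.
  set a : ℝ → ℝ := fun t => m.real {t} - ∑ i with S.pt i = t, ‖c i‖ ^ 2 with ha
  have hkey : ∀ s y : ℝ, 0 < y → ∑ t ∈ T, a t / ((t - s) ^ 2 + y ^ 2) =
      ‖res A (s + y * Complex.I) x'‖ ^ 2 := by
    intro s y hy
    have h1 := hI s y hy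
    rw [hIT s y hy, ← Finset.sum_fiberwise_of_maps_to (s := Finset.univ) (t := T) (g := S.pt)
      (fun i _ => Finset.mem_image_of_mem _ (Finset.mem_univ i))] at h1
    rw [← sub_eq_iff_eq_add', ← Finset.sum_sub_distrib] at h1
    rw [← h1]
    refine Finset.sum_congr rfl fun t _ => ?_
    rw [ha, sub_div, mul_one_div, Finset.sum_div]
    congr 1
    refine Finset.sum_congr rfl fun i hi => ?_
    rw [(Finset.mem_filter.1 hi).2]
  have ha0 : ∀ t ∈ T, a t = 0 := by
    intro t ht
    refine coeff_eq_zero_of_bounded ht (C := C) fun y hy => ?_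
    rw [hkey t y hy, abs_of_nonneg (sq_nonneg _)]
    obtain ⟨i, -, rfl⟩ := Finset.mem_image.1 ht
    exact hres _ (Ioo_subset_Icc_self (S.pt_mem i)) y hy
  have h0 : res A ((0 : ℝ) + (1 : ℝ) * Complex.I) x' = 0 := by
    have h1 := hkey 0 1 one_pos
    rw [Finset.sum_eq_zero fun t ht => by rw [ha0 t ht, zero_div]] at h1
    exact norm_eq_zero.1 (pow_eq_zero_iff two_ne_zero |>.1 h1.symm)
  have hx0 : x' = 0 := by
    have hz : (((0 : ℝ) : ℂ) + (1 : ℝ) * Complex.I).im ≠ 0 := by simp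
    exact eq_zero_of_res_eq_zero (mem_rho_of_im_ne_zero hA h₁ hz) h0
  rw [hx0, add_zero]
  exact Submodule.sum_mem _ fun i _ => Submodule.smul_mem _ _ (Submodule.subset_span ⟨i, rfl⟩)

lemma ranE_eq_span (hA : IsSelfAdjoint A) (h₁ : (l₁ : ℂ) ∈ rho A) :
    ranE A (Ico l₁ l₂) = Submodule.span ℂ (range S.vec) := by
  apply le_antisymm
  · refine Submodule.span_le.2 ?_
    rintro x ⟨m, hm, hmI⟩
    exact S.mem_span_of_measure hA h₁ hm hmI
  · refine Submodule.span_mono ?_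
    rintro _ ⟨i, rfl⟩
    refine ⟨Measure.dirac (S.pt i), ⟨inferInstance, fun z hz => ?_⟩, ?_⟩
    · rw [S.res_vec h₁ (mem_rho_of_im_ne_zero hA h₁ hz), inner_smul_right,
        inner_self_eq_norm_sq_to_K, S.orthonormal.norm_eq_one, integral_dirac]
      simp
    · have h := S.pt_mem i
      simp only [Measure.dirac_apply, indicator_apply_eq_zero]
      exact fun h' => absurd (⟨h.1.le, h.2⟩ : S.pt i ∈ Ico l₁ l₂) h'

lemma finrank_ranE (hA : IsSelfAdjoint A) (h₁ : (l₁ : ℂ) ∈ rho A) :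
    Module.finrank ℂ (ranE A (Ico l₁ l₂)) = S.n := by
  rw [S.ranE_eq_span hA h₁, finrank_span_eq_card S.orthonormal.linearIndependent, Fintype.card_fin]

lemma finiteDimensional_ranE (S : UpperSystem (res A l₁) (l₂ - l₁)⁻¹)
    (hA : IsSelfAdjoint A) (h₁ : (l₁ : ℂ) ∈ rho A) :
    FiniteDimensional ℂ (ranE A (Ico l₁ l₂)) := by
  rw [S.ranE_eq_span hA h₁]
  exact FiniteDimensional.span_of_finite ℂ (finite_range _)

end UpperSystem

/-- A zero spectral measure makes the Poisson integral zero, hence the resolvent kills the vector.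
Needed for `l₁ = l₂`, where there is no upper system. -/
lemma ranE_empty (hA : IsSelfAdjoint A) (h₁ : (l₁ : ℂ) ∈ rho A) : ranE A ∅ = ⊥ := by
  rw [ranE, Submodule.span_eq_bot]
  rintro x ⟨m, hm, hm0⟩
  have hm0' : m = 0 := by rwa [compl_empty, Measure.measure_univ_eq_zero] at hm0
  have h := (integral_poisson hA h₁ hm 0 one_pos).2
  rw [hm0', integral_zero_measure] at h
  have h0 : res A ((0 : ℝ) + (1 : ℝ) * Complex.I) x = 0 :=
    norm_eq_zero.1 (pow_eq_zero_iff two_ne_zero |>.1 h.symm)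
  have hz : (((0 : ℝ) : ℂ) + (1 : ℝ) * Complex.I).im ≠ 0 := by simp
  exact eq_zero_of_res_eq_zero (mem_rho_of_im_ne_zero hA h₁ hz) h0

end RanE

/-! ### Constancy of representatives off the spectrum -/

section LocalConstancy

variable {E : Type*} [NormedAddCommGroup E] [InnerProductSpace ℂ E] [CompleteSpace E]

/-- Off the spectrum of `W` the representatives of `η(W)` are locally constant. -/
lemma UK.exists_const_near (W : UK E) (t : Angle)
    (ht : Complex.exp ((t : ℝ) * Complex.I) ∉ spectrum ℂ W.1) :
    ∃ d > 0, ∃ s u : Angle, (s : ℝ) ≤ t - d ∧ t + d ≤ (u : ℝ) ∧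
      ∀ f, XInf.proj f = eta W.1 → f.toFun s = f.toFun u := by
  have hfin := W.finite_angles (a := t / 2) (b := (t + 2 * Real.pi) / 2) (half_pos t.2.1)
    (by linarith [t.2.2])
  have h1 : ∀ᶠ s : ℝ in 𝓝 (t : ℝ), s ∈ {s ∈ Ico (t / 2 : ℝ) ((t + 2 * Real.pi) / 2) |
      ∃ x, x ≠ 0 ∧ W.1 x = Complex.exp (s * Complex.I) • x}ᶜ :=
    hfin.isClosed.isOpen_compl.mem_nhds fun ⟨_, _, hx0, hx⟩ =>
      ht (mem_spectrum_of_eigenvector hx0 hx)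
  have h2 : ∀ᶠ s : ℝ in 𝓝 (t : ℝ), s ∈ Ioo (t / 2 : ℝ) ((t + 2 * Real.pi) / 2) :=
    Ioo_mem_nhds (half_lt_self t.2.1) (by linarith [t.2.2])
  obtain ⟨e, he, hball⟩ := Metric.eventually_nhds_iff_ball.1 (h1.and h2)
  have hd : 0 < e / 2 := half_pos he
  have hmem : ∀ r : ℝ, t - e / 2 ≤ r → r ≤ t + e / 2 → r ∈ Metric.ball (t : ℝ) e := fun r h h' => by
    rw [Metric.mem_ball, Real.dist_eq, abs_lt]
    constructor <;> linarith
  have hs := (hball (t - e / 2) (hmem _ le_rfl (by linarith))).2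
  have hu := (hball (t + e / 2) (hmem _ (by linarith) le_rfl)).2
  have hpos := t.2.1
  have hlt := t.2.2
  refine ⟨e / 2, hd, ⟨t - e / 2, by linarith [hs.1], by linarith⟩,
    ⟨t + e / 2, by linarith, by linarith [hu.2]⟩, le_rfl, le_rfl, fun f hf => ?_⟩
  rw [← sub_eq_zero, (W.proj_eq_eta_iff.1 hf), W.countingU_of_le
    (show (t : ℝ) - e / 2 ≤ t + e / 2 by linarith)]
  refine W.dim_eq_zero fun r hr hx => ?_
  have hb := hball r (hmem _ hr.1 hr.2.le)
  exact hb.1 ⟨⟨hb.2.1.le, hb.2.2⟩, hx⟩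

/-- The value at `-1` of a continuous family of representatives of `η(Φ)` is constant as long as
`Φ` stays at distance less than `2` from the identity. -/
lemma toFun_mid_eq_of_norm_lt {B : Type*} [TopologicalSpace B] {S : Set B} (hS : IsPreconnected S)
    {f : B → XTilde} (hf : ContinuousOn f S) {Φ : B → UK E}
    (h : ∀ b ∈ S, XInf.proj (f b) = eta (Φ b).1) (hn : ∀ b ∈ S, ‖(Φ b).1 - 1‖ < 2) {a b : B}
    (ha : a ∈ S) (hb : b ∈ S) : (f a).toFun XTilde.mid = (f b).toFun XTilde.mid := by
  refine hS.constant (f := fun c => (f c).toFun XTilde.mid) (fun c hc => ?_) ha hb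
  have hmid : Complex.exp ((XTilde.mid : ℝ) * Complex.I) = -1 := Complex.exp_pi_mul_I
  -- An eigenvector for $-1$ would be stretched by $\Phi-1$ by the factor `2`.
  have hspec : Complex.exp ((XTilde.mid : ℝ) * Complex.I) ∉ spectrum ℂ (Φ c).1 := by
    intro hcon
    obtain ⟨x, hx0, hx⟩ := exists_eigenvector_of_mem_spectrum (Φ c).2.2 (UK.exp_ne_one _) hcon
    have h1 := ((Φ c).1 - 1).le_opNorm x
    have h2 : ((Φ c).1 - 1) x = (-2 : ℂ) • x := by
      rw [sub_apply, hx, hmid, one_apply_eq_self]; module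
    rw [h2, norm_smul] at h1
    have h3 := norm_pos_iff.2 hx0
    have h4 := hn c hc
    have h5 : ‖(-2 : ℂ)‖ = 2 := by norm_num
    rw [h5] at h1
    nlinarith
  obtain ⟨d, hd, s, u, hs, hu, hsu⟩ := (Φ c).exists_const_near _ hspec
  refine ContinuousWithinAt.congr_of_eventuallyEq (f := fun _ => (f c).toFun XTilde.mid)
    continuousWithinAt_const ?_ rfl
  filter_upwards [(hf c hc).tendsto (Metric.ball_mem_nhds _ hd)] with c' hc'
  exact XTilde.toFun_eq_of_dist_lt hc' hs hu (hsu _ (h c hc))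

end LocalConstancy

/-! ### Step functions as a lift of a full turn -/

section StepLift

/-- The function which is `n` on `(0, θ]` and `0` on `(θ, 2π)`. -/
noncomputable def XTilde.step (n : ℕ) (θ : ℝ) : XTilde where
  toFun t := if (t : ℝ) ≤ θ then n else 0
  antitone s t h := by
    have : (s : ℝ) ≤ t := h
    dsimp only
    split_ifs with h1 h2
    · exact le_rfl
    · linarith
    · positivity
    · exact le_rfl
  leftCont t := by
    by_cases ht : (t : ℝ) ≤ θ
    · refine ContinuousWithinAt.congr (f := fun _ => (n : ℤ)) continuousWithinAt_const
        (fun s hs => if_pos (le_trans (show (s : ℝ) ≤ t from hs) ht)) (if_pos ht)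
    · refine ContinuousWithinAt.congr_of_eventuallyEq (f := fun _ => (0 : ℤ))
        continuousWithinAt_const ?_ (if_neg ht)
      refine mem_nhdsWithin_of_mem_nhds ?_
      filter_upwards [(continuous_subtype_val.tendsto t).eventually (lt_mem_nhds (not_le.1 ht))]
        with s hs
      exact if_neg (not_le.2 hs)

lemma XTilde.step_toFun (n : ℕ) (θ : ℝ) (t : Angle) :
    (step n θ).toFun t = if (t : ℝ) ≤ θ then (n : ℤ) else 0 := rfl

lemma XTilde.nu_step_le (n : ℕ) (θ θ' : ℝ) (k : ℤ) :
    (step n θ).nu k ≤ (step n θ').nu k + |θ - θ'| := by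
  have h0 := (step n θ').nu_nonneg k
  have h1 := abs_nonneg (θ - θ')
  refine csSup_le ⟨0, Or.inl rfl⟩ ?_
  rintro t (ht | ⟨ht, h⟩)
  · rw [mem_singleton_iff.1 ht]; positivity
  rw [step_toFun] at h
  by_cases hk : k < 0
  · have : k < (step n θ').toFun ⟨t, ht⟩ := by
      rw [step_toFun]; split_ifs <;> omega
    have := (lt_toFun_iff _ _ _).1 this
    simp only at this
    linarith
  have hle : t ≤ θ := by
    by_contra hcon
    rw [if_neg hcon] at h
    omega
  rw [if_pos hle] at h
  rcases le_or_gt (t - |θ - θ'|) 0 with h2 | h2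
  · linarith
  have h3 : t - |θ - θ'| ≤ θ' := by linarith [le_abs_self (θ - θ')]
  have : k < (step n θ').toFun ⟨t - |θ - θ'|, h2, by linarith [ht.2]⟩ := by
    rw [step_toFun, if_pos h3]; exact h
  have := (lt_toFun_iff _ _ _).1 this
  simp only at this
  linarith

/-- The metric measures positions of jumps, so continuity persists when the jump enters at angle `0`
and leaves at `2π`. Between these ends the function passes from the constant `0` to the constant
`n`, two representatives of one class. -/
lemma XTilde.continuous_step (n : ℕ) : Continuous (step n) :=
  (LipschitzWith.of_dist_le_mul (K := 1) fun θ θ' => by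
    rw [NNReal.coe_one, one_mul, Real.dist_eq]
    refine dist_le_of_nu fun k => abs_le.2 ⟨?_, ?_⟩
    · have := nu_step_le n θ' θ k
      rw [abs_sub_comm] at this
      linarith
    · have := nu_step_le n θ θ' k
      linarith).continuous

end StepLift

/-! ### Rotations of finitely many orthonormal vectors -/

section Rotation

variable {E : Type*} [NormedAddCommGroup E] [InnerProductSpace ℂ E]

lemma isCompactOperator_rankOne (x y : E) :
    IsCompactOperator (InnerProductSpace.rankOne ℂ x y : E →L[ℂ] E) := by
  refine ⟨(fun c : ℂ => c • x) '' Metric.closedBall 0 1,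
    (isCompact_closedBall _ _).image (by fun_prop), ?_⟩
  have h : {z : E | inner ℂ y z ∈ Metric.ball (0 : ℂ) 1} ∈ 𝓝 (0 : E) := by
    have hc : ContinuousAt (fun z : E => inner ℂ y z) 0 := by fun_prop
    exact hc.preimage_mem_nhds (by rw [inner_zero_right]; exact Metric.ball_mem_nhds _ one_pos)
  filter_upwards [h] with z hz
  exact ⟨_, Metric.ball_subset_closedBall hz, (InnerProductSpace.rankOne_apply x y z).symm⟩

variable {n : ℕ} {b : Fin n → E}

/-- The operator acting on `b i` as multiplication by `h i`, and trivially on the orthogonal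
complement of these vectors. -/
noncomputable def rot (b : Fin n → E) (h : Fin n → ℂ) : E →L[ℂ] E :=
  1 + ∑ i, (h i - 1) • InnerProductSpace.rankOne ℂ (b i) (b i)

lemma rot_apply (b : Fin n → E) (h : Fin n → ℂ) (x : E) :
    rot b h x = x + ∑ i, ((h i - 1) * inner ℂ (b i) x) • b i := by
  simp [rot, smul_smul]

lemma rot_one (b : Fin n → E) : rot b 1 = 1 := by
  simp [rot]

lemma isCompactOperator_sum {ι : Type*} (s : Finset ι) {T : ι → E →L[ℂ] E}
    (h : ∀ i, IsCompactOperator (T i)) : IsCompactOperator (∑ i ∈ s, T i : E →L[ℂ] E) := by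
  classical
  induction s using Finset.induction_on with
  | empty => exact isCompactOperator_zero
  | insert a s ha ih =>
    rw [Finset.sum_insert ha]
    exact (h a).add ih

lemma isCompactOperator_rot_sub_one (b : Fin n → E) (h : Fin n → ℂ) :
    IsCompactOperator (rot b h - 1 : E →L[ℂ] E) := by
  rw [rot, add_sub_cancel_left]
  exact isCompactOperator_sum _ fun i => (isCompactOperator_rankOne _ _).smul _

lemma continuous_rot {B : Type*} [TopologicalSpace B] {h : B → Fin n → ℂ} (hh : Continuous h) :
    Continuous fun c => rot b (h c) := by
  unfold rot
  fun_prop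

lemma inner_rot (hb : Orthonormal ℂ b) (h : Fin n → ℂ) (x : E) (i : Fin n) :
    inner ℂ (b i) (rot b h x) = h i * inner ℂ (b i) x := by
  rw [rot_apply, inner_add_right, hb.inner_right_fintype]
  ring

lemma rot_vec (hb : Orthonormal ℂ b) (h : Fin n → ℂ) (i : Fin n) : rot b h (b i) = h i • b i := by
  classical
  rw [rot_apply, Finset.sum_eq_single i]
  · rw [orthonormal_iff_ite.1 hb, if_pos rfl, mul_one]; module
  · intro j _ hj
    rw [orthonormal_iff_ite.1 hb, if_neg hj, mul_zero, zero_smul]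
  · simp

lemma rot_mul (hb : Orthonormal ℂ b) (h k : Fin n → ℂ) : rot b h * rot b k = rot b (h * k) := by
  ext x
  rw [mul_apply_eq_comp, rot_apply b h]
  simp only [inner_rot hb]
  rw [rot_apply, rot_apply, add_assoc, ← Finset.sum_add_distrib]
  congr 1
  refine Finset.sum_congr rfl fun i _ => ?_
  rw [← add_smul, Pi.mul_apply]
  congr 1
  ring

variable [CompleteSpace E]

lemma star_rot (b : Fin n → E) (h : Fin n → ℂ) : star (rot b h) = rot b (star h) := by
  simp [rot, ContinuousLinearMap.star_eq_adjoint]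

lemma rot_mem_unitary (hb : Orthonormal ℂ b) {h : Fin n → ℂ} (hh : ∀ i, ‖h i‖ = 1) :
    rot b h ∈ unitary (E →L[ℂ] E) := by
  have h1 : star h * h = 1 := funext fun i => by
    simp [Complex.conj_mul', hh i]
  rw [Unitary.mem_iff, star_rot, rot_mul hb, rot_mul hb, mul_comm h, h1, rot_one]
  exact ⟨rfl, rfl⟩

lemma UK.dim_rot (hb : Orthonormal ℂ b) {θ : ℝ} (hθ : θ ∈ Icc 0 (2 * Real.pi)) (W : UK E)
    (hW : W.1 = rot b fun _ => Complex.exp (θ * Complex.I)) (s t : Angle) :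
    W.dim s t = if (s : ℝ) ≤ θ ∧ θ < (t : ℝ) then (n : ℤ) else 0 := by
  have key : ∀ r ∈ Ico (s : ℝ) t, ∀ x, W.1 x = Complex.exp (r * Complex.I) • x →
      x ∈ Submodule.span ℂ (range b) ∧ (x ≠ 0 → r = θ) := by
    intro r hr x hx
    have hrA : r ∈ Ioo (0 : ℝ) (2 * Real.pi) := ⟨s.2.1.trans_le hr.1, hr.2.trans t.2.2⟩
    have h1 := exp_ne_one ⟨r, hrA⟩
    simp only at h1
    have hsp : x ∈ Submodule.span ℂ (range b) := by
      have h2 : (Complex.exp (r * Complex.I) - 1) • x ∈ Submodule.span ℂ (range b) := by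
        rw [sub_smul, one_smul, ← hx, hW, rot_apply, add_sub_cancel_left]
        exact Submodule.sum_mem _ fun i _ =>
          Submodule.smul_mem _ _ (Submodule.subset_span (mem_range_self i))
      exact (Submodule.smul_mem_iff _ (sub_ne_zero.2 h1)).1 h2
    refine ⟨hsp, fun hx0 => ?_⟩
    obtain ⟨i, hi⟩ : ∃ i, inner ℂ (b i) x ≠ 0 := by
      by_contra! hcon
      refine hx0 (inner_self_eq_zero (𝕜 := ℂ).1 ?_)
      have : Submodule.span ℂ (range b) ≤ (ℂ ∙ x)ᗮ := by
        refine Submodule.span_le.2 ?_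
        rintro _ ⟨i, rfl⟩
        exact Submodule.mem_orthogonal_singleton_iff_inner_left.2 (hcon i)
      exact Submodule.mem_orthogonal_singleton_iff_inner_right.1 (this hsp)
    have h3 : Complex.exp (θ * Complex.I) = Complex.exp (r * Complex.I) := by
      have h4 := inner_rot hb (fun _ => Complex.exp (θ * Complex.I)) x i
      rw [← hW, hx, inner_smul_right] at h4
      exact (mul_right_cancel₀ hi h4).symm
    -- The angle `2π` stands for the eigenvalue `1`, which the arcs never contain.
    rcases hθ.2.lt_or_eq with h5 | h5
    · exact (exp_angle_injective ⟨hθ.1, h5⟩ ⟨hrA.1.le, hrA.2⟩ h3).symm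
    · refine absurd (h3.symm.trans ?_) h1
      rw [h5]; push_cast; exact Complex.exp_two_pi_mul_I
  split_ifs with h
  · have : eigSpan W.1 (arc s t) = Submodule.span ℂ (range b) := by
      refine le_antisymm (eigSpan_le ?_) (Submodule.span_le.2 ?_)
      · rintro _ ⟨r, hr, rfl⟩ x hx
        exact (key r hr x hx).1
      · rintro _ ⟨i, rfl⟩
        refine mem_eigSpan_of_eigen (D := arc s t) ⟨θ, h, rfl⟩ ?_
        rw [hW, rot_vec hb]
    rw [dim, this, finrank_span_eq_card hb.linearIndependent, Fintype.card_fin]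
  · refine W.dim_eq_zero fun r hr hex => h ?_
    obtain ⟨x, hx0, hx⟩ := hex
    rw [← (key r hr x hx).2 hx0]
    exact hr

/-- Both endpoints `0` and `2π` are included, where the operator is the identity. The explicit lift
therefore shows that a full turn of `n` vectors has flow `n`. -/
lemma UK.proj_step_eq_eta (hb : Orthonormal ℂ b) {θ : ℝ} (hθ : θ ∈ Icc 0 (2 * Real.pi)) (W : UK E)
    (hW : W.1 = rot b fun _ => Complex.exp (θ * Complex.I)) :
    XInf.proj (XTilde.step n θ) = eta W.1 := by
  rw [W.proj_eq_eta_iff]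
  intro s t
  rw [W.countingU_eq, W.dim_rot hb hθ hW, W.dim_rot hb hθ hW, XTilde.step_toFun, XTilde.step_toFun]
  split_ifs <;> grind

end Rotation

/-! ### The Cayley transform with independent angles -/

namespace UpperSystem

variable {E : Type*} [NormedAddCommGroup E] [InnerProductSpace ℂ E] [CompleteSpace E]
  {A : E →ₗ.[ℂ] E} {l₁ l₂ : ℝ} (S : UpperSystem (res A l₁) (l₂ - l₁)⁻¹)

/-- The orthogonal projection onto the complement of the system. -/
noncomputable def coproj : E →L[ℂ] E := rot S.vec 0

lemma inner_coproj (x : E) (i : Fin S.n) : inner ℂ (S.vec i) (S.coproj x) = 0 := by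
  rw [coproj, inner_rot S.orthonormal, Pi.zero_apply, zero_mul]

/-- The eigenvalue of the Cayley transform at `S.vec i`. -/
noncomputable def cayleyVal (z : ℂ) (i : Fin S.n) : ℂ := 1 + (z - star z) * ((S.pt i : ℂ) - z)⁻¹

lemma cayley_vec (h₁ : (l₁ : ℂ) ∈ rho A) {z : ℂ} (hz : z ∈ rho A) (i : Fin S.n) :
    cayley A z (S.vec i) = S.cayleyVal z i • S.vec i := by
  rw [cayley, cayleyVal, add_apply, smul_apply, one_apply_eq_self, S.res_vec h₁ hz]
  module

/-- The point `x + i |y|`, where `x` is clamped to `[l₁, l₂]`. -/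
noncomputable def clamp (_ : UpperSystem (res A l₁) (l₂ - l₁)⁻¹) (u v : ℝ) : ℂ :=
  ⟨max l₁ (min l₂ u), |v|⟩

lemma clamp_re_mem (u v : ℝ) : (S.clamp u v).re ∈ Icc l₁ l₂ :=
  ⟨le_max_left _ _, max_le S.lt.le (min_le_left _ _)⟩

lemma clamp_im_ne_zero (u : ℝ) {v : ℝ} (hv : v ≠ 0) : (S.clamp u v).im ≠ 0 := abs_ne_zero.2 hv

lemma clamp_sub_star (u v : ℝ) : S.clamp u v - star (S.clamp u v) = 2 * |v| * Complex.I := by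
  apply Complex.ext
  · simp [clamp]
  · simp [clamp]; ring

lemma continuous_clamp : Continuous fun q : ℝ × ℝ => S.clamp q.1 q.2 := by
  have : (fun q : ℝ × ℝ => S.clamp q.1 q.2) =
      fun q : ℝ × ℝ => ((max l₁ (min l₂ q.1) : ℝ) : ℂ) + (|q.2| : ℝ) * Complex.I := by
    funext q
    apply Complex.ext <;> simp [clamp]
  rw [this]
  fun_prop

lemma clamp_eq {u v : ℝ} (hu : u ∈ Icc l₁ l₂) (hv : 0 ≤ v) : S.clamp u v = u + v * Complex.I := by
  apply Complex.ext
  · simp [clamp, hu.1, hu.2]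
  · simp [clamp, abs_of_nonneg hv]

/-- A unitary operator which agrees with the Cayley transform at `u + i v` on the orthogonal
complement of the system, and rotates the vectors of the system by the angles `p`. -/
noncomputable def op (u v : ℝ) (p : Fin S.n → ℝ) : E →L[ℂ] E :=
  rot S.vec (fun i => Complex.exp (p i * Complex.I)) +
    (2 * |v| * Complex.I) • (res A (S.clamp u v) * S.coproj)

lemma op_zero (u : ℝ) (p : Fin S.n → ℝ) :
    S.op u 0 p = rot S.vec fun i => Complex.exp (p i * Complex.I) := by
  simp [op]

lemma norm_exp_angle {n : ℕ} (p : Fin n → ℝ) (i : Fin n) : ‖Complex.exp (p i * Complex.I)‖ = 1 :=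
  Complex.norm_exp_ofReal_mul_I _

/-- The right side shows unitarity when both sets of eigenvalues are unimodular. The left side no
longer contains the resolvent on the eigenvectors, so it can be continued to the real axis. -/
lemma rot_add_cayley (h₁ : (l₁ : ℂ) ∈ rho A) {z : ℂ} (hz : z ∈ rho A) (h : Fin S.n → ℂ)
    (hne : ∀ i, S.cayleyVal z i ≠ 0) :
    rot S.vec h + (z - star z) • (res A z * S.coproj) =
      cayley A z * rot S.vec (fun i => h i / S.cayleyVal z i) := by
  have hc : cayley A z * rot S.vec (fun i => h i / S.cayleyVal z i) =
      cayley A z + ∑ i, (h i - S.cayleyVal z i) • InnerProductSpace.rankOne ℂ (S.vec i) (S.vec i) := by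
    rw [rot, mul_add, mul_one, Finset.mul_sum]
    congr 1
    refine Finset.sum_congr rfl fun i _ => ?_
    ext x
    have := hne i
    simp only [mul_smul_comm, smul_apply, mul_apply_eq_comp, InnerProductSpace.rankOne_apply,
      map_smul, S.cayley_vec h₁ hz, smul_smul]
    congr 1
    field_simp
  have hr : res A z * S.coproj = res A z -
      ∑ i, ((S.pt i : ℂ) - z)⁻¹ • InnerProductSpace.rankOne ℂ (S.vec i) (S.vec i) := by
    rw [coproj, rot, mul_add, mul_one, Finset.mul_sum, sub_eq_add_neg (res A z),
      ← Finset.sum_neg_distrib]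
    congr 1
    refine Finset.sum_congr rfl fun i _ => ?_
    ext x
    simp only [mul_smul_comm, smul_apply, mul_apply_eq_comp, InnerProductSpace.rankOne_apply,
      map_smul, S.res_vec h₁ hz, smul_smul, neg_apply, Pi.zero_apply]
    module
  have hsum : ∑ i, (h i - 1) • InnerProductSpace.rankOne ℂ (S.vec i) (S.vec i) =
      ∑ i, (h i - S.cayleyVal z i) • InnerProductSpace.rankOne ℂ (S.vec i) (S.vec i) +
      (z - star z) •
        ∑ i, ((S.pt i : ℂ) - z)⁻¹ • InnerProductSpace.rankOne ℂ (S.vec i) (S.vec i) := by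
    rw [Finset.smul_sum, ← Finset.sum_add_distrib]
    refine Finset.sum_congr rfl fun i _ => ?_
    rw [smul_smul, ← add_smul, cayleyVal]
    congr 1
    ring
  rw [hc, hr, rot, cayley, hsum, smul_sub]
  abel

lemma norm_cayleyVal (hA : IsSelfAdjoint A) (h₁ : (l₁ : ℂ) ∈ rho A) {z : ℂ} (hz : z.im ≠ 0)
    (i : Fin S.n) : ‖S.cayleyVal z i‖ = 1 := by
  have hz' : (star z).im ≠ 0 := by simpa using hz
  have hzr := mem_rho_of_im_ne_zero hA h₁ hz
  exact norm_eigenvalue (cayley_mem_unitary hA hzr (mem_rho_of_im_ne_zero hA h₁ hz'))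
    (S.orthonormal.ne_zero i) (S.cayley_vec h₁ hzr i)

lemma op_mem_unitary (hA : IsSelfAdjoint A) (h₁ : (l₁ : ℂ) ∈ rho A) (u v : ℝ) (p : Fin S.n → ℝ) :
    S.op u v p ∈ unitary (E →L[ℂ] E) := by
  rcases eq_or_ne v 0 with rfl | hv
  · rw [op_zero]
    exact rot_mem_unitary S.orthonormal (norm_exp_angle p)
  have hz := S.clamp_im_ne_zero u hv
  have hz' : (star (S.clamp u v)).im ≠ 0 := by simpa using hz
  have hzr := mem_rho_of_im_ne_zero hA h₁ hz
  have hg := fun i => S.norm_cayleyVal hA h₁ hz i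
  rw [op, ← S.clamp_sub_star u, S.rot_add_cayley h₁ hzr _ fun i => norm_ne_zero_iff.1 (by
    rw [hg]; exact one_ne_zero)]
  refine mul_mem (cayley_mem_unitary hA hzr (mem_rho_of_im_ne_zero hA h₁ hz'))
    (rot_mem_unitary S.orthonormal fun i => ?_)
  rw [norm_div, hg, norm_exp_angle, div_one]

lemma op_eq_cayley (hA : IsSelfAdjoint A) (h₁ : (l₁ : ℂ) ∈ rho A) {u v : ℝ} (hu : u ∈ Icc l₁ l₂)
    (hv : 0 < v) {p : Fin S.n → ℝ}
    (hp : ∀ i, Complex.exp (p i * Complex.I) = S.cayleyVal (u + v * Complex.I) i) :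
    S.op u v p = cayley A (u + v * Complex.I) := by
  have hz := S.clamp_im_ne_zero u hv.ne'
  have hzr := mem_rho_of_im_ne_zero hA h₁ hz
  rw [op, ← S.clamp_sub_star u, S.rot_add_cayley h₁ hzr _ fun i => norm_ne_zero_iff.1 (by
    rw [S.norm_cayleyVal hA h₁ hz]; exact one_ne_zero)]
  have : (fun i => Complex.exp (p i * Complex.I) / S.cayleyVal (S.clamp u v) i) = 1 := by
    funext i
    rw [hp, ← S.clamp_eq hu hv.le, Pi.one_apply, div_self]
    rw [← norm_ne_zero_iff, S.norm_cayleyVal hA h₁ hz]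
    exact one_ne_zero
  rw [this, rot_one, mul_one, S.clamp_eq hu hv.le]

lemma continuous_op (hA : IsSelfAdjoint A) (h₁ : (l₁ : ℂ) ∈ rho A) :
    Continuous fun q : (ℝ × ℝ) × (Fin S.n → ℝ) => S.op q.1.1 q.1.2 q.2 := by
  refine Continuous.add (continuous_rot (by fun_prop)) ?_
  have key : Continuous fun q : ℝ × ℝ =>
      (2 * |q.2| * Complex.I) • (res A (S.clamp q.1 q.2) * S.coproj) := by
    rw [continuous_iff_continuousAt]
    rintro ⟨u, v⟩
    -- At the axis the resolvent is bounded on the complement of the system and the prefactor `2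
    -- |v|` tends to zero; elsewhere the resolvent is continuous.
    rcases eq_or_ne v 0 with rfl | hv
    · have h0 : Tendsto (fun q : ℝ × ℝ => 2 * |q.2| * (S.bound * ‖S.coproj‖)) (𝓝 (u, 0)) (𝓝 0) := by
        have : Continuous fun q : ℝ × ℝ => 2 * |q.2| * (S.bound * ‖S.coproj‖) := by fun_prop
        simpa using this.tendsto (u, 0)
      rw [ContinuousAt]
      simp only [abs_zero, Complex.ofReal_zero, mul_zero, zero_mul, zero_smul]
      refine squeeze_zero_norm (fun q => ?_) h0
      rcases eq_or_ne q.2 0 with hq | hq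
      · simp [hq]
      rw [norm_smul, norm_mul, norm_mul, Complex.norm_I, mul_one, Complex.norm_real, norm_abs_eq_norm,
        Complex.norm_ofNat, Real.norm_eq_abs]
      refine mul_le_mul_of_nonneg_left ?_ (by positivity)
      have := S.bound_nonneg
      refine ContinuousLinearMap.opNorm_le_bound _ (by positivity) fun x => ?_
      calc ‖res A (S.clamp q.1 q.2) (S.coproj x)‖ ≤ S.bound * ‖S.coproj x‖ :=
            S.norm_res_le_bound hA h₁ (S.clamp_im_ne_zero _ hq) (S.clamp_re_mem _ _)
              (S.inner_coproj x)
        _ ≤ S.bound * (‖S.coproj‖ * ‖x‖) := by gcongr; exact S.coproj.le_opNorm x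
        _ = _ := by ring
    · have h1 := continuousAt_res h₁ (mem_rho_of_im_ne_zero hA h₁ (S.clamp_im_ne_zero u hv))
      have h2 : ContinuousAt (fun q : ℝ × ℝ => res A (S.clamp q.1 q.2)) (u, v) :=
        ContinuousAt.comp (f := fun q : ℝ × ℝ => S.clamp q.1 q.2) (x := (u, v)) h1
          S.continuous_clamp.continuousAt
      have h3 : ContinuousAt (fun q : ℝ × ℝ => (2 * |q.2| * Complex.I : ℂ)) (u, v) := by fun_prop
      exact h3.smul (h2.mul continuousAt_const)
  exact key.comp continuous_fst

/-- The argument of the eigenvalue of the Cayley transform. -/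
noncomputable def angle (u v : ℝ) (i : Fin S.n) : ℝ :=
  2 * Complex.arg (((S.pt i - u : ℝ) : ℂ) + v * Complex.I)

/-- With $w=a-u+iv$ the eigenvalue of the Cayley transform at $a$ is $w/\bar w$, so its argument is
twice that of $w$. -/
lemma exp_angle (u : ℝ) {v : ℝ} (hv : 0 < v) (i : Fin S.n) :
    Complex.exp (S.angle u v i * Complex.I) = S.cayleyVal (u + v * Complex.I) i := by
  set w : ℂ := ((S.pt i - u : ℝ) : ℂ) + v * Complex.I with hw
  have hw0 : w ≠ 0 := fun h => by
    have := congrArg Complex.im h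
    simp [hw] at this
    exact hv.ne' this
  have hw' : star w ≠ 0 := star_ne_zero.2 hw0
  have h1 : S.cayleyVal (u + v * Complex.I) i = w / star w := by
    have h2 : (S.pt i : ℂ) - (u + v * Complex.I) = star w := by
      simp [hw]; ring
    rw [cayleyVal, h2]
    have h3 : ((u : ℂ) + v * Complex.I) - star ((u : ℂ) + v * Complex.I) = w - star w := by
      simp [hw]
    rw [h3]
    field_simp
    abel
  have hn : (‖w‖ : ℂ) ≠ 0 := by exact_mod_cast norm_ne_zero_iff.2 hw0
  have h4 := Complex.norm_mul_exp_arg_mul_I w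
  rw [h1, angle, ← hw]
  push_cast
  rw [eq_div_iff hw', mul_assoc, two_mul, Complex.exp_add]
  have h5 : star w * w = (‖w‖ : ℂ) ^ 2 := Complex.conj_mul' w
  have h6 : Complex.exp (w.arg * Complex.I) = w / ‖w‖ := by rw [eq_div_iff hn, mul_comm]; exact h4
  rw [h6]
  field_simp
  linear_combination h5

lemma continuous_angle_left {v : ℝ} (hv : 0 < v) : Continuous fun u => S.angle u v := by
  refine continuous_pi fun i => continuous_const.mul ?_
  rw [continuous_iff_continuousAt]
  intro u
  have h : (((S.pt i - u : ℝ) : ℂ) + v * Complex.I) ∈ Complex.slitPlane :=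
    Or.inr (by simp [hv.ne'])
  exact (Complex.continuousAt_arg h).comp (f := fun u : ℝ => (((S.pt i - u : ℝ) : ℂ) + v * Complex.I))
    (by fun_prop)

/-- On the closed upper half plane the argument is discontinuous only at the origin, that is at
$u=a$, $v=0$. The vertical lines over `l₁` and `l₂` avoid it, and the limits at $v=0$ are `0` and
`2π` respectively. -/
lemma continuousOn_angle {u : ℝ} (hu : u ∉ Ioo l₁ l₂) : ContinuousOn (S.angle u) (Ici 0) := by
  refine continuousOn_pi.2 fun i => continuousOn_const.mul fun v hv => ?_
  have hne : S.pt i - u ≠ 0 := fun h => hu (by rw [← sub_eq_zero.1 h]; exact S.pt_mem i)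
  have hmaps : MapsTo (fun v : ℝ => (((S.pt i - u : ℝ) : ℂ) + v * Complex.I)) (Ici 0)
      {z : ℂ | 0 ≤ z.im} := fun v hv => by simpa using hv
  have hcont : ContinuousWithinAt (fun v : ℝ => (((S.pt i - u : ℝ) : ℂ) + v * Complex.I)) (Ici 0) v := by
    fun_prop
  refine ContinuousWithinAt.comp (g := Complex.arg) (t := {z : ℂ | 0 ≤ z.im}) ?_ hcont hmaps
  by_cases h : (((S.pt i - u : ℝ) : ℂ) + v * Complex.I) ∈ Complex.slitPlane
  · exact (Complex.continuousAt_arg h).continuousWithinAt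
  · rw [Complex.mem_slitPlane_iff, not_or, not_lt, not_not] at h
    refine Complex.continuousWithinAt_arg_of_re_neg_of_im_zero (h.1.lt_of_ne ?_) h.2
    simpa using hne

lemma angle_left_zero : S.angle l₁ 0 = 0 := by
  funext i
  have := (S.pt_mem i).1
  rw [angle, Complex.ofReal_zero, zero_mul, add_zero, Complex.arg_ofReal_of_nonneg (by linarith)]
  simp

lemma angle_right_zero : S.angle l₂ 0 = fun _ => 2 * Real.pi := by
  funext i
  have := (S.pt_mem i).2
  rw [angle, Complex.ofReal_zero, zero_mul, add_zero, Complex.arg_ofReal_of_neg (by linarith)]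

end UpperSystem

/-! ### Vertical lines and the value of `mu` -/

section BoundaryPath

variable {E : Type*} [NormedAddCommGroup E] [InnerProductSpace ℂ E] [CompleteSpace E]
  {H H₀ : E →ₗ.[ℂ] E} {l : ℝ}

lemma mem_rho_line {A : E →ₗ.[ℂ] E} (hA : IsSelfAdjoint A) (hl : (l : ℂ) ∈ rho A) (y : ℝ) :
    (l + y * Complex.I) ∈ rho A := by
  rcases eq_or_ne y 0 with rfl | hy
  · simpa using hl
  · exact mem_rho_of_im_ne_zero hA hl (by simpa using hy)

lemma star_line (l y : ℝ) : star (l + y * Complex.I) = l + (-y : ℝ) * Complex.I := by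
  simp

/-- With Cayley transforms $U,U_0$ one has $M-1=(U-U_0)U_0^*$, and $U-U_0$ is $z-\bar z$ times the
difference of the resolvents. -/
lemma M_mem_of_mem_rho (hH : IsSelfAdjoint H) (hH₀ : IsSelfAdjoint H₀)
    (hcomp : ResolventComparable H H₀) {z : ℂ} (hz : z ∈ rho H ∩ rho H₀)
    (hz' : star z ∈ rho H ∩ rho H₀) :
    M z H H₀ ∈ unitary (E →L[ℂ] E) ∧ IsCompactOperator (M z H H₀ - 1 : E →L[ℂ] E) ∧
      ‖M z H H₀ - 1‖ ≤ 2 * |z.im| * ‖res H z - res H₀ z‖ := by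
  have hU := cayley_mem_unitary hH hz.1 hz'.1
  have hU₀ := cayley_mem_unitary hH₀ hz.2 hz'.2
  have hsub : M z H H₀ - 1 = ((z - star z) • (res H z - res H₀ z)) * star (cayley H₀ z) := by
    have h1 : (1 : E →L[ℂ] E) = cayley H₀ z * star (cayley H₀ z) :=
      (Unitary.mem_iff.1 hU₀).2.symm
    conv_lhs => rw [M_eq H hH₀ hz.2 hz'.2, h1, ← sub_mul]
    rw [cayley, cayley, add_sub_add_left_eq_sub, ← smul_sub]
  refine ⟨?_, ?_, ?_⟩
  · rw [M_eq H hH₀ hz.2 hz'.2]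
    exact mul_mem hU (Unitary.star_mem hU₀)
  · rw [hsub]
    exact ((hcomp.compact _ ⟨hz.2, hz.1⟩).smul (z - star z)).comp_clm _
  · rw [hsub]
    refine (norm_mul_le _ _).trans ?_
    have h1 : ‖star (cayley H₀ z)‖ ≤ 1 :=
      ContinuousLinearMap.opNorm_le_bound _ zero_le_one fun x => by
        rw [unitary_norm (Unitary.star_mem hU₀), one_mul]
    refine (mul_le_of_le_one_right (norm_nonneg _) h1).trans_eq ?_
    have h2 : z - star z = ((2 * z.im : ℝ) : ℂ) * Complex.I := Complex.sub_conj z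
    rw [norm_smul, h2, norm_mul, Complex.norm_I, mul_one, Complex.norm_real, norm_mul,
      Real.norm_ofNat, Real.norm_eq_abs]

lemma M_mem (hH : IsSelfAdjoint H) (hH₀ : IsSelfAdjoint H₀) (hcomp : ResolventComparable H H₀)
    (hl : (l : ℂ) ∈ rho H ∩ rho H₀) (y : ℝ) :
    M (l + y * Complex.I) H H₀ ∈ unitary (E →L[ℂ] E) ∧
      IsCompactOperator (M (l + y * Complex.I) H H₀ - 1 : E →L[ℂ] E) ∧
      ‖M (l + y * Complex.I) H H₀ - 1‖ ≤
        2 * |y| * ‖res H (l + y * Complex.I) - res H₀ (l + y * Complex.I)‖ := by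
  have key := M_mem_of_mem_rho hH hH₀ hcomp ⟨mem_rho_line hH hl.1 y, mem_rho_line hH₀ hl.2 y⟩
    (star_line l y ▸ ⟨mem_rho_line hH hl.1 (-y), mem_rho_line hH₀ hl.2 (-y)⟩)
  simpa using key

/-- The path `y ↦ M (l + i y)` in the space of unitary operators. -/
noncomputable def UK.line (hH : IsSelfAdjoint H) (hH₀ : IsSelfAdjoint H₀)
    (hcomp : ResolventComparable H H₀) (hl : (l : ℂ) ∈ rho H ∩ rho H₀) (y : ℝ) : UK E :=
  ⟨M (l + y * Complex.I) H H₀, (M_mem hH hH₀ hcomp hl y).1, (M_mem hH hH₀ hcomp hl y).2.1⟩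

variable (E) in
/-- The identity operator. -/
noncomputable def UK.id : UK E :=
  ⟨1, one_mem _, by rw [sub_self]; exact isCompactOperator_zero⟩

lemma UK.line_zero (hH : IsSelfAdjoint H) (hH₀ : IsSelfAdjoint H₀)
    (hcomp : ResolventComparable H H₀) (hl : (l : ℂ) ∈ rho H ∩ rho H₀) :
    UK.line hH hH₀ hcomp hl 0 = UK.id E := by
  refine Subtype.ext ?_
  simp [line, UK.id, M]

lemma UK.continuous_line (hH : IsSelfAdjoint H) (hH₀ : IsSelfAdjoint H₀)
    (hcomp : ResolventComparable H H₀) (hl : (l : ℂ) ∈ rho H ∩ rho H₀) :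
    Continuous (UK.line hH hH₀ hcomp hl) := by
  refine Continuous.subtype_mk ?_ _
  have key : ∀ {A : E →ₗ.[ℂ] E}, IsSelfAdjoint A → (l : ℂ) ∈ rho A →
      Continuous fun y : ℝ => res A (l + y * Complex.I) := fun hA hl =>
    continuous_iff_continuousAt.2 fun y =>
      ContinuousAt.comp (f := fun y : ℝ => (l + y * Complex.I : ℂ))
        (continuousAt_res hl (mem_rho_line hA hl y)) (by fun_prop)
  have h1 := key hH hl.1
  have h2 : Continuous fun y : ℝ => res H₀ (star (l + y * Complex.I)) := by
    simp only [star_line]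
    exact (key hH₀ hl.2).comp continuous_neg
  unfold M
  fun_prop

lemma UK.tendsto_line_atTop (hH : IsSelfAdjoint H) (hH₀ : IsSelfAdjoint H₀)
    (hcomp : ResolventComparable H H₀) (hl : (l : ℂ) ∈ rho H ∩ rho H₀) :
    Tendsto (UK.line hH hH₀ hcomp hl) atTop (𝓝 (UK.id E)) := by
  rw [tendsto_subtype_rng, tendsto_iff_norm_sub_tendsto_zero]
  refine squeeze_zero' (Eventually.of_forall fun y => norm_nonneg _) ?_
    (by simpa using (hcomp.decay l).const_mul 2)
  filter_upwards [eventually_ge_atTop 0] with y hy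
  refine (M_mem hH hH₀ hcomp hl y).2.2.trans_eq ?_
  rw [abs_of_nonneg hy, mul_assoc]

lemma UK.eta_id : eta (UK.id E).1 = XInf.proj (XTilde.const 0) := by
  have h : XTilde.step 0 0 = XTilde.const 0 := XTilde.ext' fun t => by
    simp [XTilde.step_toFun, XTilde.const]
  rw [← h, ← (UK.id E).proj_step_eq_eta (b := fun i : Fin 0 => (0 : E))
    ⟨fun i => i.elim0, fun i => i.elim0⟩ ⟨le_rfl, by positivity⟩]
  simp [UK.id, rot]

lemma hasBoundaryLimit (hH : IsSelfAdjoint H) (hH₀ : IsSelfAdjoint H₀)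
    (hcomp : ResolventComparable H H₀) (hl : (l : ℂ) ∈ rho H ∩ rho H₀) :
    HasBoundaryLimit l H H₀ :=
  ⟨_, ((UK.continuous_eta.comp (UK.continuous_line hH hH₀ hcomp hl)).tendsto 0).mono_left
    nhdsWithin_le_nhds⟩

/-- Any continuous family `g` of representatives along the half-line computes `mu`, since two lifts
differ by a constant. At both ends $M$ tends to the identity, where representatives are constant
functions, so the value may be read at $-1$ for every `t`; near infinity it has already stabilised,
which spares extending `g` there. -/
lemma mu_eventually_eq (hH : IsSelfAdjoint H) (hH₀ : IsSelfAdjoint H₀)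
    (hcomp : ResolventComparable H H₀) (hl : (l : ℂ) ∈ rho H ∩ rho H₀) {g : ℝ → XTilde}
    (hg : ContinuousOn g (Ici 0))
    (hgM : ∀ y ≥ 0, XInf.proj (g y) = eta (UK.line hH hH₀ hcomp hl y).1) (t : Angle) :
    ∀ᶠ y in atTop, mu t l H H₀ = (g 0).toFun XTilde.mid - (g y).toFun XTilde.mid := by
  have hφ : ∀ s : ℝ, 0 < s → ContinuousAt (fun s : ℝ => (1 - s) / s) s := fun s hs =>
    ContinuousAt.div (by fun_prop) (by fun_prop) hs.ne'
  have hφ1 : ∀ s : ℝ, (1 - s) / s = s⁻¹ - s / s := fun s => by rw [sub_div, one_div]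
  have hφ0 : Tendsto (fun s : ℝ => (1 - s) / s) (𝓝[>] 0) atTop := by
    have h1 : Tendsto (fun s : ℝ => s⁻¹ + (-1)) (𝓝[>] 0) atTop :=
      tendsto_atTop_add_const_right _ _ tendsto_inv_nhdsGT_zero
    refine h1.congr' ?_
    filter_upwards [self_mem_nhdsWithin] with s hs
    rw [hφ1, div_self (ne_of_gt hs), sub_eq_add_neg]
  -- The path in the parameter `s`, continued by the identity for `s ≤ 0`; it is continuous at `0`
  -- by the decay assumption.
  set V : ℝ → UK E := fun s =>
    if s ≤ 0 then UK.id E else UK.line hH hH₀ hcomp hl ((1 - s) / s) with hV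
  have hV1 : ∀ s, 0 < s → V s = UK.line hH hH₀ hcomp hl ((1 - s) / s) := fun s hs =>
    if_neg (not_le.2 hs)
  have hVc : Continuous V := by
    rw [continuous_iff_continuousAt]
    intro s
    rcases lt_trichotomy s 0 with hs | rfl | hs
    · refine ContinuousAt.congr (f := fun _ => UK.id E) continuousAt_const ?_
      filter_upwards [gt_mem_nhds hs] with r hr
      exact (if_pos hr.le).symm
    · rw [continuousAt_iff_continuous_left'_right']
      have h0 : V 0 = UK.id E := if_pos le_rfl
      constructor
      · refine ContinuousWithinAt.congr (f := fun _ => UK.id E) continuousWithinAt_const ?_ h0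
        intro r hr
        exact if_pos (le_of_lt hr)
      · rw [ContinuousWithinAt, h0]
        refine ((UK.tendsto_line_atTop hH hH₀ hcomp hl).comp hφ0).congr' ?_
        filter_upwards [self_mem_nhdsWithin] with r hr
        exact (hV1 r hr).symm
    · refine ContinuousAt.congr (f := fun s => UK.line hH hH₀ hcomp hl ((1 - s) / s))
        (ContinuousAt.comp (f := fun s : ℝ => (1 - s) / s)
          (UK.continuous_line hH hH₀ hcomp hl).continuousAt (hφ s hs)) ?_
      filter_upwards [lt_mem_nhds hs] with r hr
      exact (hV1 r hr).symm
  let G : C(unitInterval, XInf) :=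
    ⟨fun s => eta (V s).1, UK.continuous_eta.comp (hVc.comp continuous_subtype_val)⟩
  have hG : IsExt (fun s => eta (M (l + ((1 - s) / s : ℝ) * Complex.I) H H₀)) G := fun s hs => by
    change eta (V s).1 = _
    rw [hV1 s hs.1]
    rfl
  have hex : ∃ L, IsLift (fun s : ℝ => M (l + ((1 - s) / s : ℝ) * Complex.I) H H₀) L := by
    obtain ⟨f, hf⟩ := XInf.surjective_proj (G 0)
    obtain ⟨L, hL, -⟩ := XInf.isCoveringMap_proj.exists_path_lifts G f hf.symm
    exact ⟨L, G, hG, fun s => congrFun hL s⟩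
  have hmu : mu t l H H₀ = (hex.choose 1).toFun t - (hex.choose 0).toFun t := by
    rw [mu, sf, dif_pos hex]
  have hspec := hex.choose_spec
  set L := hex.choose
  obtain ⟨G', hG', hL⟩ := hspec
  set L' : ℝ → XTilde := fun s => L (projIcc 0 1 zero_le_one s) with hL'
  have hL'c : Continuous L' := L.continuous.comp continuous_projIcc
  have hLV : ∀ s ∈ Ioo (0 : ℝ) 1, XInf.proj (L' s) = eta (V s).1 := fun s hs => by
    have hs' : s ∈ Icc (0 : ℝ) 1 := ⟨hs.1.le, hs.2.le⟩
    rw [hL']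
    simp only
    rw [projIcc_of_mem _ hs', hL, hG' ⟨s, hs'⟩ hs, hV1 s hs.1]
    rfl
  have hL0 : L' 0 = L 0 := by simp [hL']
  have hL1 : L' 1 = L 1 := by simp [hL']
  have hgφ : ContinuousOn (fun s : ℝ => g ((1 - s) / s)) (Ioc 0 1) :=
    hg.comp (fun s hs => (hφ s hs.1).continuousWithinAt)
      fun s hs => div_nonneg (sub_nonneg.2 hs.2) hs.1.le
  obtain ⟨n, hn⟩ := XInf.exists_shift_eqOn isPreconnected_Ioo hL'c.continuousOn
    (hgφ.mono Ioo_subset_Ioc_self) fun s hs => by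
      rw [hLV s hs, hV1 s hs.1, hgM _ (div_nonneg (sub_nonneg.2 hs.2.le) hs.1.le)]
  have hneB1 : (𝓝[Ioo (0 : ℝ) 1] 1).NeBot := right_nhdsWithin_Ioo_neBot one_pos
  have hneB0 : (𝓝[Ioo (0 : ℝ) 1] 0).NeBot := left_nhdsWithin_Ioo_neBot one_pos
  have hend1 : L 1 = (g 0).shift n := by
    have h1 : Tendsto L' (𝓝[Ioo (0 : ℝ) 1] 1) (𝓝 (L 1)) := by
      rw [← hL1]; exact (hL'c.tendsto 1).mono_left nhdsWithin_le_nhds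
    have h2 : Tendsto (fun s : ℝ => (g ((1 - s) / s)).shift n) (𝓝[Ioo (0 : ℝ) 1] 1)
        (𝓝 ((g 0).shift n)) := by
      have h3 := (hgφ 1 ⟨one_pos, le_rfl⟩).tendsto
      simp only [sub_self, zero_div] at h3
      have h4 : Continuous fun f : XTilde => f.shift n :=
        (Isometry.of_dist_eq fun f g => XTilde.dist_shift f g n).continuous
      exact ((h4.tendsto _).comp h3).mono_left (nhdsWithin_mono _ Ioo_subset_Ioc_self)
    refine tendsto_nhds_unique h1 (h2.congr' ?_)
    filter_upwards [self_mem_nhdsWithin] with s hs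
    exact (hn s hs).symm
  -- The chosen lift covers some extension of the path, which is prescribed only on the open
  -- interval. Its value at `0` is found by a limit of distances, so no separation of `XInf` is
  -- required.
  have hend0 : dist (XInf.proj (L 0)) (XInf.proj (XTilde.const 0)) = 0 := by
    have h1 : Tendsto (fun s => dist (XInf.proj (L' s)) (eta (V s).1)) (𝓝[Ioo (0 : ℝ) 1] 0)
        (𝓝 (dist (XInf.proj (L' 0)) (eta (V 0).1))) :=
      (((XInf.continuous_proj.comp hL'c).dist (UK.continuous_eta.comp hVc)).tendsto 0).mono_left
        nhdsWithin_le_nhds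
    have h2 : V 0 = UK.id E := if_pos le_rfl
    rw [hL0, h2, UK.eta_id] at h1
    refine tendsto_nhds_unique h1 (tendsto_const_nhds.congr' ?_)
    filter_upwards [self_mem_nhdsWithin] with s hs
    rw [hLV s hs, dist_self]
  have hg0 : g 0 = XTilde.const ((g 0).toFun XTilde.mid) := by
    refine XInf.eq_const_of_dist_proj_const (k := 0) ?_
    rw [hgM 0 le_rfl, UK.line_zero, UK.eta_id, dist_self]
  have hL0c := XInf.eq_const_of_dist_proj_const hend0
  have hconst : ∀ᶠ s in 𝓝[>] (0 : ℝ), (L' s).toFun XTilde.mid = (L 0).toFun XTilde.mid := by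
    have h1 : ∀ᶠ s in 𝓝 (0 : ℝ), dist (L' s) (L 0) < 1 := by
      rw [← hL0]; exact (hL'c.tendsto 0) (Metric.ball_mem_nhds _ one_pos)
    filter_upwards [mem_nhdsWithin_of_mem_nhds h1] with s hs
    rw [hL0c] at hs
    exact XTilde.toFun_mid_of_dist_const hs
  have hψ : Tendsto (fun y : ℝ => (1 + y)⁻¹) atTop (𝓝[>] 0) :=
    tendsto_inv_atTop_nhdsGT_zero.comp (tendsto_atTop_add_const_left _ _ tendsto_id)
  filter_upwards [hψ.eventually hconst, eventually_gt_atTop 0] with y hy hy0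
  have hs : (1 + y)⁻¹ ∈ Ioo (0 : ℝ) 1 := ⟨by positivity, inv_lt_one_of_one_lt₀ (by linarith)⟩
  -- The substitution `s = 1 / (1 + y)` inverts the parametrisation of the half-line.
  have hsy : (1 - (1 + y)⁻¹) / (1 + y)⁻¹ = y := by field_simp; ring
  rw [hn _ hs, hsy] at hy
  have hy' : (g y).toFun XTilde.mid + n = (L 0).toFun XTilde.mid := hy
  rw [hmu, hend1, hL0c]
  change (g 0).toFun t + n - (L 0).toFun XTilde.mid = _
  have h5 : (g 0).toFun t = (g 0).toFun XTilde.mid := by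
    conv_lhs => rw [hg0]
    rfl
  omega

end BoundaryPath

/-! ### Homotopy over the strip -/

section Flow

variable {E : Type*} [NormedAddCommGroup E] [InnerProductSpace ℂ E] [CompleteSpace E]
  {H H₀ : E →ₗ.[ℂ] E} {l₁ l₂ : ℝ}

/-- Rotations and coprojections differ from the identity by finite rank operators, so up to compact
terms only the difference of the resolvents remains. -/
lemma UpperSystem.isCompactOperator_op_sub (S : UpperSystem (res H l₁) (l₂ - l₁)⁻¹)
    (S₀ : UpperSystem (res H₀ l₁) (l₂ - l₁)⁻¹) (hH : IsSelfAdjoint H) (hH₀ : IsSelfAdjoint H₀)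
    (hcomp : ResolventComparable H H₀) (h₁ : (l₁ : ℂ) ∈ rho H ∩ rho H₀) (u v : ℝ)
    (p : Fin S.n → ℝ) (q : Fin S₀.n → ℝ) :
    IsCompactOperator (S.op u v p - S₀.op u v q : E →L[ℂ] E) := by
  have hrot : IsCompactOperator (rot S.vec (fun i => Complex.exp (p i * Complex.I)) -
      rot S₀.vec (fun i => Complex.exp (q i * Complex.I)) : E →L[ℂ] E) := by
    rw [← sub_sub_sub_cancel_right _ _ (1 : E →L[ℂ] E)]
    exact (isCompactOperator_rot_sub_one _ _).sub (isCompactOperator_rot_sub_one _ _)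
  rcases eq_or_ne v 0 with rfl | hv
  · rw [S.op_zero, S₀.op_zero]
    exact hrot
  have hz := S.clamp_im_ne_zero u hv
  have hD := hcomp.compact _ ⟨mem_rho_of_im_ne_zero hH₀ h₁.2 hz, mem_rho_of_im_ne_zero hH h₁.1 hz⟩
  have hR : IsCompactOperator (res H (S.clamp u v) * S.coproj -
      res H₀ (S.clamp u v) * S₀.coproj : E →L[ℂ] E) := by
    have h1 : res H (S.clamp u v) * S.coproj - res H₀ (S.clamp u v) * S₀.coproj =
        (res H (S.clamp u v) - res H₀ (S.clamp u v)) + (res H (S.clamp u v) * (S.coproj - 1) -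
          res H₀ (S.clamp u v) * (S₀.coproj - 1)) := by noncomm_ring
    rw [h1]
    exact hD.add (((isCompactOperator_rot_sub_one S.vec 0).clm_comp (res H (S.clamp u v))).sub
      ((isCompactOperator_rot_sub_one S₀.vec 0).clm_comp (res H₀ (S.clamp u v))))
  have h2 : S.op u v p - S₀.op u v q = (rot S.vec (fun i => Complex.exp (p i * Complex.I)) -
      rot S₀.vec (fun i => Complex.exp (q i * Complex.I))) + (2 * |v| * Complex.I : ℂ) •
        (res H (S.clamp u v) * S.coproj - res H₀ (S.clamp u v) * S₀.coproj) := by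
    rw [UpperSystem.op, UpperSystem.op, smul_sub]
    exact add_sub_add_comm _ _ _ _
  rw [h2]
  exact hrot.add (hR.smul (2 * |v| * Complex.I : ℂ))

/-- A continuous choice of representatives of `η` for the family of products of `S.op` and
`S₀.op`. -/
lemma exists_flow_lift (S : UpperSystem (res H l₁) (l₂ - l₁)⁻¹)
    (S₀ : UpperSystem (res H₀ l₁) (l₂ - l₁)⁻¹) (hH : IsSelfAdjoint H) (hH₀ : IsSelfAdjoint H₀)
    (hcomp : ResolventComparable H H₀) (h₁ : (l₁ : ℂ) ∈ rho H ∩ rho H₀) :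
    ∃ (Φ : (ℝ × ℝ) × ((Fin S.n → ℝ) × (Fin S₀.n → ℝ)) → UK E)
      (Λ : (ℝ × ℝ) × ((Fin S.n → ℝ) × (Fin S₀.n → ℝ)) → XTilde), Continuous Λ ∧
      (∀ q, (Φ q).1 = S.op q.1.1 q.1.2 q.2.1 * star (S₀.op q.1.1 q.1.2 q.2.2)) ∧
      ∀ q, XInf.proj (Λ q) = eta (Φ q).1 := by
  have hU := S.op_mem_unitary hH h₁.1
  have hU₀ := S₀.op_mem_unitary hH₀ h₁.2
  let Φ : (ℝ × ℝ) × ((Fin S.n → ℝ) × (Fin S₀.n → ℝ)) → UK E := fun q =>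
    ⟨S.op q.1.1 q.1.2 q.2.1 * star (S₀.op q.1.1 q.1.2 q.2.2),
      mul_mem (hU _ _ _) (Unitary.star_mem (hU₀ _ _ _)), by
        have h1 : S.op q.1.1 q.1.2 q.2.1 * star (S₀.op q.1.1 q.1.2 q.2.2) - 1 =
            (S.op q.1.1 q.1.2 q.2.1 - S₀.op q.1.1 q.1.2 q.2.2) *
              star (S₀.op q.1.1 q.1.2 q.2.2) := by
          rw [sub_mul, (Unitary.mem_iff.1 (hU₀ q.1.1 q.1.2 q.2.2)).2]
        rw [h1]
        exact (S.isCompactOperator_op_sub S₀ hH hH₀ hcomp h₁ _ _ _ _).comp_clm _⟩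
  have hΦ : Continuous Φ := by
    refine Continuous.subtype_mk ?_ _
    have c1 := (S.continuous_op hH h₁.1).comp
      (g := fun q : (ℝ × ℝ) × (Fin S.n → ℝ) => S.op q.1.1 q.1.2 q.2)
      (f := fun q : (ℝ × ℝ) × ((Fin S.n → ℝ) × (Fin S₀.n → ℝ)) => (q.1, q.2.1)) (by fun_prop)
    have c2 := (S₀.continuous_op hH₀ h₁.2).comp
      (g := fun q : (ℝ × ℝ) × (Fin S₀.n → ℝ) => S₀.op q.1.1 q.1.2 q.2)
      (f := fun q : (ℝ × ℝ) × ((Fin S.n → ℝ) × (Fin S₀.n → ℝ)) => (q.1, q.2.2)) (by fun_prop)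
    exact c1.mul c2.star
  let F : C((ℝ × ℝ) × ((Fin S.n → ℝ) × (Fin S₀.n → ℝ)), XInf) :=
    ⟨fun q => eta (Φ q).1, UK.continuous_eta.comp hΦ⟩
  obtain ⟨f, hf⟩ := XInf.surjective_proj (F 0)
  -- The parameter space is a real vector space, hence simply connected and locally path connected.
  obtain ⟨Λ, ⟨-, hΛ⟩, -⟩ := XInf.isCoveringMap_proj.existsUnique_continuousMap_lifts F 0 f hf
  exact ⟨Φ, Λ, Λ.continuous, fun _ => rfl, fun q => congrFun hΛ q⟩

/-- The distance of `M` from the identity tends to zero uniformly on compact intervals. -/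
lemma eventually_norm_M_sub_one_lt (hH : IsSelfAdjoint H) (hH₀ : IsSelfAdjoint H₀)
    (hcomp : ResolventComparable H H₀) (h : l₁ ≤ l₂) (h₁ : (l₁ : ℂ) ∈ rho H ∩ rho H₀) :
    ∀ᶠ y : ℝ in atTop, ∀ u ∈ Icc l₁ l₂,
      2 * |y| * ‖res H (u + y * Complex.I) - res H₀ (u + y * Complex.I)‖ < 2 := by
  -- Moving from `l₁` to `u` costs two factors of norm at most `2`, so the quantity is at most
  -- $8\,y\,\|D(l_1+iy)\|$, with $D$ the difference of the resolvents.
  have h0 := (hcomp.decay l₁).eventually (gt_mem_nhds (by norm_num : (0 : ℝ) < 1 / 4))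
  filter_upwards [h0, eventually_ge_atTop (l₂ - l₁), eventually_gt_atTop 0] with y hy hyl hy0 u hu
  set z : ℂ := l₁ + y * Complex.I with hz
  set w : ℂ := u + y * Complex.I with hw
  have hzi : z.im ≠ 0 := by simpa [hz] using hy0.ne'
  have hwi : w.im ≠ 0 := by simpa [hw] using hy0.ne'
  have hwz : w - z = ((u - l₁ : ℝ) : ℂ) := by rw [hw, hz]; push_cast; ring
  have hz1 := mem_rho_of_im_ne_zero hH h₁.1 hzi
  have hw1 := mem_rho_of_im_ne_zero hH h₁.1 hwi
  have hz0 := mem_rho_of_im_ne_zero hH₀ h₁.2 hzi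
  have hw0 := mem_rho_of_im_ne_zero hH₀ h₁.2 hwi
  -- This transports the difference of the resolvents from `z` to `w`. Both outer factors have norm
  -- at most `2` as soon as `y ≥ l₂ - l₁`.
  have hid : res H w - res H₀ w =
      (1 + (w - z) • res H w) * (res H z - res H₀ z) * (1 + (w - z) • res H₀ w) := by
    have e1 : (1 + (w - z) • res H w) * res H z = res H w := by
      have := resolvent_identity hz1 hw1
      rw [add_mul, one_mul, smul_mul_assoc]
      nth_rw 1 [this]
      module
    have e2 : res H₀ z * (1 + (w - z) • res H₀ w) = res H₀ w := by
      rw [mul_add, mul_one, mul_smul_comm]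
      exact (resolvent_identity hw0 hz0).symm
    rw [mul_sub, e1, sub_mul, mul_assoc (1 + (w - z) • res H w), e2]
    simp only [mul_add, add_mul, one_mul, mul_one, smul_mul_assoc, mul_smul_comm]
    abel
  have hb : ∀ {A : E →ₗ.[ℂ] E}, IsSelfAdjoint A → w ∈ rho A → ‖1 + (w - z) • res A w‖ ≤ 2 := by
    intro A hA hwA
    have e1 := norm_res_le hA hwA hwi
    have e2 : |w.im| = y := by simp [hw, abs_of_pos hy0]
    have e3 : ‖(1 : E →L[ℂ] E)‖ ≤ 1 := ContinuousLinearMap.norm_id_le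
    refine (norm_add_le _ _).trans ?_
    rw [norm_smul, hwz, Complex.norm_real, Real.norm_of_nonneg (by linarith [hu.1])]
    rw [e2] at e1
    have e4 : (u - l₁) * ‖res A w‖ ≤ y * y⁻¹ :=
      mul_le_mul (by linarith [hu.2]) e1 (norm_nonneg _) hy0.le
    rw [mul_inv_cancel₀ hy0.ne'] at e4
    linarith
  have hn : ‖res H w - res H₀ w‖ ≤ 2 * ‖res H z - res H₀ z‖ * 2 := by
    rw [hid]
    refine (norm_mul_le _ _).trans (mul_le_mul ((norm_mul_le _ _).trans ?_) (hb hH₀ hw0)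
      (norm_nonneg _) (by positivity))
    gcongr
    exact hb hH hw1
  rw [abs_of_pos hy0]
  nlinarith

lemma star_rot_two_pi_sub {n : ℕ} (b : Fin n → E) (r : ℝ) :
    star (rot b fun _ => Complex.exp (r * Complex.I)) =
      rot b fun _ => Complex.exp ((2 * Real.pi - r : ℝ) * Complex.I) := by
  rw [star_rot]
  congr 1
  funext i
  have h1 : ((2 * Real.pi - r : ℝ) : ℂ) * Complex.I =
      2 * Real.pi * Complex.I + -(r * Complex.I) := by push_cast; ring
  rw [h1, Complex.exp_add, Complex.exp_two_pi_mul_I, one_mul, Pi.star_apply]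
  change (starRingEnd ℂ) _ = _
  rw [← Complex.exp_conj]
  simp

lemma mid_eq_zero_step {n : ℕ} : (XTilde.step n 0).toFun XTilde.mid = 0 :=
  if_neg (not_le.2 Real.pi_pos)

lemma mid_two_pi_step {n : ℕ} : (XTilde.step n (2 * Real.pi)).toFun XTilde.mid = n :=
  if_pos (show Real.pi ≤ 2 * Real.pi by linarith [Real.pi_pos])

/-- All comparisons are made with one global lift `Λ`, so the difference of the two vertical flows
is the increment of `Λ` along the bottom. That increment is computed along any path between the two
corner parameters, here a composite of pure rotations and a translation in `u`. -/
lemma mu_sub_mu (hH : IsSelfAdjoint H) (hH₀ : IsSelfAdjoint H₀)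
    (hcomp : ResolventComparable H H₀) (h₁ : (l₁ : ℂ) ∈ rho H ∩ rho H₀)
    (h₂ : (l₂ : ℂ) ∈ rho H ∩ rho H₀) (S : UpperSystem (res H l₁) (l₂ - l₁)⁻¹)
    (S₀ : UpperSystem (res H₀ l₁) (l₂ - l₁)⁻¹) (t : Angle) :
    mu t l₂ H H₀ - mu t l₁ H H₀ = S.n - S₀.n := by
  have hlt := S.lt
  obtain ⟨Φ, Λ, hΛ, hΦ, hΦΛ⟩ := exists_flow_lift S S₀ hH hH₀ hcomp h₁
  have hπ : (0 : ℝ) ≤ 2 * Real.pi := by positivity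
  have hexp : Complex.exp ((2 * Real.pi : ℝ) * Complex.I) = 1 := by
    push_cast; exact Complex.exp_two_pi_mul_I
  have hM : ∀ u ∈ Icc l₁ l₂, ∀ y > 0, (Φ ((u, y), (S.angle u y, S₀.angle u y))).1 =
      M (u + y * Complex.I) H H₀ := by
    intro u hu y hy
    have hyi : (u + y * Complex.I : ℂ).im ≠ 0 := by simpa using hy.ne'
    rw [hΦ]
    simp only
    rw [S.op_eq_cayley hH h₁.1 hu hy (S.exp_angle u hy), S₀.op_eq_cayley hH₀ h₁.2 hu hy
      (S₀.exp_angle u hy), M_eq H hH₀ (mem_rho_of_im_ne_zero hH₀ h₁.2 hyi)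
      (mem_rho_of_im_ne_zero hH₀ h₁.2 (by simpa using hy.ne'))]
  have hbot : ∀ (u : ℝ) (p : Fin S.n → ℝ) (q : Fin S₀.n → ℝ), (Φ ((u, 0), (p, q))).1 =
      rot S.vec (fun i => Complex.exp (p i * Complex.I)) *
        star (rot S₀.vec fun i => Complex.exp (q i * Complex.I)) := fun u p q => by
    rw [hΦ]; simp only; rw [S.op_zero, S₀.op_zero]
  have hvert : ∀ l, l ∈ Icc l₁ l₂ → l ∉ Ioo l₁ l₂ → (hl : (l : ℂ) ∈ rho H ∩ rho H₀) →
      (Φ ((l, 0), (S.angle l 0, S₀.angle l 0))).1 = 1 → ∀ᶠ y in atTop, mu t l H H₀ =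
        (Λ ((l, 0), (S.angle l 0, S₀.angle l 0))).toFun XTilde.mid -
          (Λ ((l, y), (S.angle l y, S₀.angle l y))).toFun XTilde.mid := by
    intro l hl hl' hlr h1
    refine mu_eventually_eq hH hH₀ hcomp hlr
      (g := fun y => Λ ((l, y), (S.angle l y, S₀.angle l y))) ?_ ?_ t
    · have c1 := S.continuousOn_angle hl'
      have c2 := S₀.continuousOn_angle hl'
      exact hΛ.comp_continuousOn (by fun_prop)
    · intro y hy
      rw [hΦΛ]
      rcases (show 0 ≤ y from hy).eq_or_lt with rfl | hy
      · rw [h1, UK.line_zero]; rfl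
      · rw [hM l hl y hy]; rfl
  have hS1 := S.angle_left_zero
  have hS2 := S.angle_right_zero
  have hS01 := S₀.angle_left_zero
  have hS02 := S₀.angle_right_zero
  have hv1 := hvert l₁ ⟨le_rfl, hlt.le⟩ (fun h => lt_irrefl _ h.1) h₁ (by
    rw [hbot, hS1, hS01]
    simp [rot])
  have hrot2 : ∀ {n : ℕ} (b : Fin n → E),
      rot b (fun _ => Complex.exp ((2 * Real.pi : ℝ) * Complex.I)) = 1 := fun b => by
    rw [hexp]; exact rot_one b
  have hrot0 : ∀ {n : ℕ} (b : Fin n → E),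
      rot b (fun _ => Complex.exp ((0 : ℝ) * Complex.I)) = 1 := fun b => by
    simp [rot]
  have hv2 := hvert l₂ ⟨hlt.le, le_rfl⟩ (fun h => lt_irrefl _ h.2) h₂ (by
    rw [hbot, hS2, hS02]
    simp only
    rw [hrot2, hrot2, star_one, mul_one])
  rw [hS1, hS01] at hv1
  rw [hS2, hS02] at hv2
  obtain ⟨y, hy1, hy2, hy3, hy0⟩ := (hv1.and (hv2.and ((eventually_norm_M_sub_one_lt hH hH₀ hcomp
    hlt.le h₁).and (eventually_gt_atTop 0)))).exists
  -- Top edge: for `y > 0` the angles are continuous in `u`, and `M` stays at distance less than `2`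
  -- from the identity.
  have htop : (Λ ((l₁, y), (S.angle l₁ y, S₀.angle l₁ y))).toFun XTilde.mid =
      (Λ ((l₂, y), (S.angle l₂ y, S₀.angle l₂ y))).toFun XTilde.mid := by
    have c1 := S.continuous_angle_left hy0
    have c2 := S₀.continuous_angle_left hy0
    refine toFun_mid_eq_of_norm_lt (S := Icc l₁ l₂) isPreconnected_Icc
      (f := fun u => Λ ((u, y), (S.angle u y, S₀.angle u y)))
      (Φ := fun u => Φ ((u, y), (S.angle u y, S₀.angle u y)))
      (hΛ.comp (by fun_prop)).continuousOn (fun u _ => hΦΛ _) (fun u hu => ?_)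
      ⟨le_rfl, hlt.le⟩ ⟨hlt.le, le_rfl⟩
    rw [hM u hu y hy0]
    have hz : (u + y * Complex.I : ℂ).im ≠ 0 := by simpa using hy0.ne'
    have hz' : (star (u + y * Complex.I : ℂ)).im ≠ 0 := by simpa using hy0.ne'
    have h3 := (M_mem_of_mem_rho hH hH₀ hcomp
      ⟨mem_rho_of_im_ne_zero hH h₁.1 hz, mem_rho_of_im_ne_zero hH₀ h₁.2 hz⟩
      ⟨mem_rho_of_im_ne_zero hH h₁.1 hz', mem_rho_of_im_ne_zero hH₀ h₁.2 hz'⟩).2.2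
    have him : (u + y * Complex.I : ℂ).im = y := by simp
    rw [him] at h3
    exact h3.trans_lt (hy3 u hu)
  -- Moving `u` at height `0` with all angles equal to `2π`: the operator is the identity
  -- throughout.
  have hb1 : (Λ ((l₂, 0), (fun _ => 2 * Real.pi, fun _ => 2 * Real.pi))).toFun XTilde.mid =
      (Λ ((l₁, 0), (fun _ => 2 * Real.pi, fun _ => 2 * Real.pi))).toFun XTilde.mid := by
    refine toFun_mid_eq_of_norm_lt (S := univ) isPreconnected_univ
      (f := fun u : ℝ => Λ ((u, 0), (fun _ => 2 * Real.pi, fun _ => 2 * Real.pi)))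
      (Φ := fun u : ℝ => Φ ((u, 0), (fun _ => 2 * Real.pi, fun _ => 2 * Real.pi)))
      (hΛ.comp (by fun_prop)).continuousOn (fun u _ => hΦΛ _) (fun u _ => ?_) trivial trivial
    rw [hbot]
    rw [hrot2, hrot2, star_one, mul_one, sub_self, norm_zero]
    exact two_pos
  -- Turning the angles of `H` once around moves the explicit step lift from `0` to the constant
  -- `S.n`.
  have hb2 : (Λ ((l₁, 0), (fun _ => 2 * Real.pi, 0))).toFun XTilde.mid -
      (Λ ((l₁, 0), (0, 0))).toFun XTilde.mid = S.n := by
    obtain ⟨k, hk⟩ := XInf.exists_shift_eqOn (s := Icc 0 (2 * Real.pi)) isPreconnected_Icc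
      (L := fun r : ℝ => Λ ((l₁, 0), (fun _ => r, 0))) (L' := XTilde.step S.n)
      (hΛ.comp (by fun_prop)).continuousOn (XTilde.continuous_step _).continuousOn fun r hr => by
        rw [hΦΛ, UK.proj_step_eq_eta S.orthonormal hr]
        rw [hbot]
        have := hrot0 S₀.vec
        simp only [Pi.zero_apply]
        rw [this, star_one, mul_one]
    have e1 := congrArg (fun f => f.toFun XTilde.mid) (hk 0 ⟨le_rfl, hπ⟩)
    have e2 := congrArg (fun f => f.toFun XTilde.mid) (hk (2 * Real.pi) ⟨hπ, le_rfl⟩)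
    change _ = (XTilde.step S.n 0).toFun XTilde.mid + k at e1
    change _ = (XTilde.step S.n (2 * Real.pi)).toFun XTilde.mid + k at e2
    rw [mid_eq_zero_step] at e1
    rw [mid_two_pi_step] at e2
    change (Λ ((l₁, 0), (0, 0))).toFun XTilde.mid = _ at e1
    omega
  -- The factor of `H₀` enters through its adjoint, a rotation by `2π - r`, so the step lift is
  -- traversed backwards and the sign changes.
  have hb3 : (Λ ((l₁, 0), (fun _ => 2 * Real.pi, fun _ => 2 * Real.pi))).toFun XTilde.mid -
      (Λ ((l₁, 0), (fun _ => 2 * Real.pi, 0))).toFun XTilde.mid = -S₀.n := by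
    obtain ⟨k, hk⟩ := XInf.exists_shift_eqOn (s := Icc 0 (2 * Real.pi)) isPreconnected_Icc
      (L := fun r : ℝ => Λ ((l₁, 0), (fun _ => 2 * Real.pi, fun _ => r)))
      (L' := fun r => XTilde.step S₀.n (2 * Real.pi - r))
      (hΛ.comp (by fun_prop)).continuousOn
      ((XTilde.continuous_step _).comp (by fun_prop)).continuousOn fun r hr => by
        rw [hΦΛ, UK.proj_step_eq_eta S₀.orthonormal (θ := 2 * Real.pi - r)
          ⟨by linarith [hr.2], by linarith [hr.1]⟩]
        rw [hbot]
        rw [hrot2, one_mul, star_rot_two_pi_sub]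
    have e1 := congrArg (fun f => f.toFun XTilde.mid) (hk 0 ⟨le_rfl, hπ⟩)
    have e2 := congrArg (fun f => f.toFun XTilde.mid) (hk (2 * Real.pi) ⟨hπ, le_rfl⟩)
    change _ = (XTilde.step S₀.n (2 * Real.pi - 0)).toFun XTilde.mid + k at e1
    change _ = (XTilde.step S₀.n (2 * Real.pi - 2 * Real.pi)).toFun XTilde.mid + k at e2
    rw [sub_zero, mid_two_pi_step] at e1
    rw [sub_self, mid_eq_zero_step] at e2
    change (Λ ((l₁, 0), (fun _ => 2 * Real.pi, 0))).toFun XTilde.mid = _ at e1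
    omega
  omega

end Flow
end SpectralFlow

/-! ### Assembly by the order of the endpoints -/

theorem theoremi1 {E : Type*} [NormedAddCommGroup E] [InnerProductSpace ℂ E] [CompleteSpace E]
    (H₀ H : E →ₗ.[ℂ] E) (hH₀ : IsSelfAdjoint H₀) (hH : IsSelfAdjoint H)
    (hcomp : SpectralFlow.ResolventComparable H H₀)
    (l₁ l₂ : ℝ) (hess : Set.uIcc l₁ l₂ ∩ SpectralFlow.sigmaEss H₀ = ∅)
    (h₁ : (l₁ : ℂ) ∈ SpectralFlow.rho H ∩ SpectralFlow.rho H₀)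
    (h₂ : (l₂ : ℂ) ∈ SpectralFlow.rho H ∩ SpectralFlow.rho H₀) :
    SpectralFlow.HasBoundaryLimit l₁ H H₀ ∧ SpectralFlow.HasBoundaryLimit l₂ H H₀ ∧
    FiniteDimensional ℂ (SpectralFlow.ranE H (Set.Ico (min l₁ l₂) (max l₁ l₂))) ∧
    FiniteDimensional ℂ (SpectralFlow.ranE H₀ (Set.Ico (min l₁ l₂) (max l₁ l₂))) ∧
    ∀ t : SpectralFlow.Angle,
      SpectralFlow.mu t l₂ H H₀ - SpectralFlow.mu t l₁ H H₀ =
        SpectralFlow.counting H l₁ l₂ - SpectralFlow.counting H₀ l₁ l₂ := by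
  refine ⟨SpectralFlow.hasBoundaryLimit hH hH₀ hcomp h₁,
    SpectralFlow.hasBoundaryLimit hH hH₀ hcomp h₂, ?_⟩
  have key : ∀ a b : ℝ, a < b → (a : ℂ) ∈ SpectralFlow.rho H ∩ SpectralFlow.rho H₀ →
      (b : ℂ) ∈ SpectralFlow.rho H ∩ SpectralFlow.rho H₀ →
      Set.Icc a b ∩ SpectralFlow.sigmaEss H₀ = ∅ →
      FiniteDimensional ℂ (SpectralFlow.ranE H (Set.Ico a b)) ∧
      FiniteDimensional ℂ (SpectralFlow.ranE H₀ (Set.Ico a b)) ∧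
      ∀ t : SpectralFlow.Angle, SpectralFlow.mu t b H H₀ - SpectralFlow.mu t a H H₀ =
        Module.finrank ℂ (SpectralFlow.ranE H (Set.Ico a b)) -
          Module.finrank ℂ (SpectralFlow.ranE H₀ (Set.Ico a b)) := by
    intro a b hab ha hb hI
    obtain ⟨⟨S⟩, ⟨S₀⟩⟩ := SpectralFlow.exists_upperSystems hH hH₀ hab ha hb
      (hcomp.compact _ ⟨ha.2, ha.1⟩) hI
    refine ⟨S.finiteDimensional_ranE hH ha.1, S₀.finiteDimensional_ranE hH₀ ha.2, fun t => ?_⟩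
    rw [S.finrank_ranE hH ha.1, S₀.finrank_ranE hH₀ ha.2]
    exact SpectralFlow.mu_sub_mu hH hH₀ hcomp ha hb S S₀ t
  rcases lt_trichotomy l₁ l₂ with h | rfl | h
  · rw [Set.uIcc_of_le h.le] at hess
    rw [min_eq_left h.le, max_eq_right h.le]
    obtain ⟨i1, i2, hmu⟩ := key l₁ l₂ h h₁ h₂ hess
    refine ⟨i1, i2, fun t => ?_⟩
    rw [SpectralFlow.counting, SpectralFlow.counting, if_pos h, if_pos h, hmu]
  · rw [min_self, max_self, Set.Ico_self, SpectralFlow.ranE_empty hH h₁.1,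
      SpectralFlow.ranE_empty hH₀ h₁.2]
    refine ⟨inferInstance, inferInstance, fun t => ?_⟩
    simp [SpectralFlow.counting]
  -- Exchanging the endpoints reverses the sign on both sides, by the sign convention in `counting`.
  · rw [Set.uIcc_of_ge h.le] at hess
    rw [min_eq_right h.le, max_eq_left h.le]
    obtain ⟨i1, i2, hmu⟩ := key l₂ l₁ h h₂ h₁ hess
    refine ⟨i1, i2, fun t => ?_⟩
    have := hmu t
    rw [SpectralFlow.counting, SpectralFlow.counting, if_neg h.not_gt, if_pos h, if_neg h.not_gt,
      if_pos h]
    omega
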